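/- Throughout, $\mathcal H^2$ is the 2-dimensional Hausdorff measure, $B$ the open unit ball, and a cone is a nonempty set $K$ with $tK\subset K$ for all $t\ge 0$. A set $K$ is reduced if $\mathcal H^2(K\cap B(x,r))>0$ for all $x\in K$, $r>0$. For an open set $U\subset\mathbb R^n$, a closed set $E$ is minimal in $U$ with respect to a class $\mathscr F$ of sets if $\mathcal H^2(E\cap \bar B(x,r))<\infty$ for every closed ball $\bar B(x,r)\subset U$ and $\mathcal H^2(E\setminus F)\le\mathcal H^2(F\setminus E)$ for all $F\in\mathscr F$. **Minimal cones in $\mathbb R^n$, $n\ge 3$.** An *Almgren competitor* of a closed set $E\subset \mathbb R^n$ is a closed set $F=\varphi_1(E)$, where $(t,x)\mapsto\varphi_t(x)$ is continuous on $[0,1]\times\mathbb R^n$, $\varphi_0=\mathrm{id}$, $\varphi_1$ is Lipschitz and $\bigcup_t (W_t\cup\varphi_t(W_t))$ is bounded, $W_t=\{\varphi_t(x)\ne x\}$. For an abelian group $G$, a *$G$-topological competitor* of $E$ is a closed set $F$ for which there is a bounded convex set $C$ with $F\setminus C=E\setminus C$ such that every Euclidean $(n-3)$-sphere $S\subset\mathbb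 R^n\setminus(C\cup E)$ which represents a nonzero element of $H_{n-3}(\mathbb R^n\setminus E;G)$ also represents a nonzero element of $H_{n-3}(\mathbb R^n\setminus F;G)$. (Here $S$ represents a nonzero element of $H_k(\Omega;G)$ if the map $\tilde H_k(S;G)\to H_k(\Omega;G)$ induced by inclusion on the reduced singular homology of $S$ is not zero.) A 2-dimensional Almgren (resp. $G$-topological) minimal cone is a reduced closed cone, centred at $0$, which is minimal in $\mathbb R^n$ with respect to its Almgren (resp. $G$-topological) competitors. **Convex domains.** Let $K\subset\mathbb R^n$ be such a cone. A $\mathbb Y$ point is a unit vector $a\in K$ near which $K$ is a union of three half planes meeting at $120^\circ$ angles along the line $\mathbb Ra$. For $\eta>0$ let $$\mathcal U(K,\eta)=\{x\in B:\ \langle x,y\rangle<1-\eta\ \ \forall y\in K\cap\partial B,\ \ \langle x,a\rangle<1-2\eta\ \text{ for every $\mathbb Y$ point } a\},$$ $$A_a=\{x\in\bar B:\ \langle x,a\rangle=1-2\eta,\ \langle x,y\rangle\le 1-\eta\ \ \forall y\in K\cap\partial B\},$$ and let $\mathfrak A=\{tz: t\ge 0,\ z\in A_a \text{ for some } \mathbb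 Y \text{ point } a\}$. The connected components of $K\cap\partial B$ minus the $\mathbb Y$ points are closed (circles) or not closed (open arcs). The band of a circle $s$ is $\{x\in\bar B:\langle x,y\rangle=1-\eta\text{ for some }y\in s\}$; the band of an arc $\gamma$ is $\{x\in\bar B:\langle x,y\rangle=1-\eta\text{ for some }y\in\bar\gamma\}\setminus\mathfrak A$. Let $\eta_1(K)$ be the supremum of the $\eta>0$ such that $0\in\mathcal U(K,\eta)$, no three different bands have a common point on $\partial\mathcal U(K,\eta)$, and the sets $A_a$ are pairwise disjoint. **Stability.** Let $0<\delta<\eta<\eta_1(K)$, $\mathcal U=\mathcal U(K,\eta)$. A *$\delta$-sliding deformation* of $E=K\cap\bar{\mathcal U}$ is a set $\varphi_1(E)$, where $\varphi_t:\bar{\mathcal U}\to\bar{\mathcal U}$, $(t,x)\mapsto\varphi_t(x)$ is continuous on $[0,1]\times\bar{\mathcal U}$, $\varphi_0=\mathrm{id}$, $\varphi_1$ is Lipschitz, $\varphi_t(\partial\mathcal U)\subset\partial\mathcal U$, and $|\varphi_t(x)-x|<\delta$ for all $t\in[0,1]$ and $x\in E\cap\partial\mathcal U$. The cone $K$ is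 *$(\eta,\delta)$-Almgren sliding stable* if $E$ is minimal in $\mathcal U$ with respect to the class of all closed sets $F\subset\bar{\mathcal U}$ which have finite $\mathcal H^2$ measure in each closed ball contained in $\mathcal U$ and are limits, in the Hausdorff distance, of sequences of $\delta$-sliding deformations of $E$. Let $V_\delta=\{x\in\partial\mathcal U:\mathrm{dist}(x,K)\le\delta\}$. The cone $K$ is *$(\eta,\delta)$-$G$-topologically stable* if $\mathcal H^2(F\cap\bar{\mathcal U})\ge\mathcal H^2(K\cap\bar{\mathcal U})$ for every closed set $F$ such that $F\setminus\bar{\mathcal U}=K\setminus\bar{\mathcal U}$, $F\cap\partial\mathcal U\subset V_\delta$, and $F\cup V_\delta$ is a $G$-topological competitor of $K$ in $\mathbb R^n$. We call $K$ Almgren sliding stable (resp. $G$-topologically stable) in $\mathbb R^n$ if it is so for some $0<\delta<\eta<\eta_1(K)$. **Proposition 4.2.** Let $n\ge d\ge 3$, and regard $\mathbb R^d$ as a subspace of $\mathbb R^n$ by any linear isometric embedding (for instance as the first $d$ coordinates). Let $K\subset\mathbb R^d$. 1. If $K$ is a 2-dimensional Almgren minimal cone in $\mathbb R^d$ and is Almgren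 sliding stable in $\mathbb R^d$, then $K$ is an Almgren minimal cone in $\mathbb R^n$ and is Almgren sliding stable in $\mathbb R^n$. 2. Let $G$ be any abelian group. If $K$ is a 2-dimensional $G$-topological minimal cone in $\mathbb R^d$ and is $G$-topologically stable in $\mathbb R^d$, then $K$ is a $G$-topological minimal cone in $\mathbb R^n$ and is $G$-topologically stable in $\mathbb R^n$. -/

import Mathlib

open Set MeasureTheory
open scoped NNReal ENNReal Topology

universe u

noncomputable section

/-! ## Minimal sets of dimension two -/

/-- A closed set `E` is minimal (of dimension `2`) in the open set `U` among the sets of the class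
`𝓕`: it has finite `ℋ²` measure in every compact ball contained in `U`, and
`ℋ²(E \ F) ≤ ℋ²(F \ E)` for all `F ∈ 𝓕`. -/
def IsMinimalAmong {n : ℕ} (U E : Set (EuclideanSpace ℝ (Fin n)))
    (𝓕 : Set (Set (EuclideanSpace ℝ (Fin n)))) : Prop :=
  IsClosed E ∧
  (∀ (x : EuclideanSpace ℝ (Fin n)) (r : ℝ), Metric.closedBall x r ⊆ U →
    μH[2] (E ∩ Metric.closedBall x r) < ∞) ∧
  ∀ F ∈ 𝓕, μH[2] (E \ F) ≤ μH[2] (F \ E)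

/-- `F` is an Almgren competitor of `E` in `ℝⁿ`: a closed set `F = φ₁(E)`, where `φ` is a
continuous deformation of `ℝⁿ` starting from the identity, with `φ₁` Lipschitz, such that the
set of points that move, together with the positions they reach, is bounded (that is, relatively
compact in `ℝⁿ`). -/
def IsAlmgrenCompetitor {n : ℕ} (E F : Set (EuclideanSpace ℝ (Fin n))) : Prop :=
  IsClosed F ∧
  ∃ φ : ℝ → EuclideanSpace ℝ (Fin n) → EuclideanSpace ℝ (Fin n),
    (∀ x, φ 0 x = x) ∧
    ContinuousOn (fun p : ℝ × EuclideanSpace ℝ (Fin n) => φ p.1 p.2) (Icc (0 : ℝ) 1 ×ˢ univ) ∧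
    (∃ L : ℝ≥0, LipschitzWith L (φ 1)) ∧
    Bornology.IsBounded (⋃ t ∈ Icc (0 : ℝ) 1, ({x | φ t x ≠ x} ∪ φ t '' {x | φ t x ≠ x})) ∧
    F = φ 1 '' E

/-- Round `k`-spheres in `ℝⁿ`: spheres of positive radius in a `(k+1)`-dimensional affine
subspace, centred at a point of that subspace. -/
def IsEuclideanSphere {n : ℕ} (k : ℕ) (S : Set (EuclideanSpace ℝ (Fin n))) : Prop :=
  ∃ W : AffineSubspace ℝ (EuclideanSpace ℝ (Fin n)),
    Module.finrank ℝ W.direction = k + 1 ∧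
    ∃ c ∈ W, ∃ r : ℝ, 0 < r ∧ S = {x | x ∈ W ∧ dist x c = r}

/-- The singular homology group `H_k(X; G)`. -/
abbrev singularHomologyGroup (G : Type u) [AddCommGroup G] (k : ℕ) (X : TopCat.{0}) :
    AddCommGrpCat.{u} :=
  ((AlgebraicTopology.singularHomologyFunctor AddCommGrpCat.{u} k).obj (AddCommGrpCat.of G)).obj X

/-- The homomorphism `H_k(X; G) → H_k(Y; G)` induced by a continuous map. -/
abbrev singularHomologyMap (G : Type u) [AddCommGroup G] (k : ℕ) {X Y : TopCat.{0}} (f : X ⟶ Y) :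
    singularHomologyGroup G k X ⟶ singularHomologyGroup G k Y :=
  ((AlgebraicTopology.singularHomologyFunctor AddCommGrpCat.{u} k).obj (AddCommGrpCat.of G)).map f

/-- The inclusion `S ⊆ Ω` of two subsets of `ℝⁿ` as a morphism of topological spaces. -/
def inclTop {n : ℕ} {S Ω : Set (EuclideanSpace ℝ (Fin n))} (h : S ⊆ Ω) :
    TopCat.of S ⟶ TopCat.of Ω :=
  TopCat.ofHom ⟨Set.inclusion h, continuous_inclusion h⟩

/-- The map from a set to a one-point space. -/
def toPointTop {n : ℕ} (S : Set (EuclideanSpace ℝ (Fin n))) : TopCat.of S ⟶ TopCat.of PUnit.{1} :=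
  TopCat.ofHom ⟨fun _ => PUnit.unit, continuous_const⟩

/-- The subset `S` (in the applications a `k`-sphere) represents a nonzero element of
`H_k(Ω; G)`: the homomorphism induced by `S ⊆ Ω` is nonzero on the reduced homology of `S`, i.e. on
the kernel of `H_k(S; G) → H_k(point; G)`. For `k ≥ 1` this kernel is all of `H_k(S; G)`; for
`k = 0` and `S = {p, q}` it consists of the classes `g·[p] - g·[q]`. For a `k`-sphere and `G = ℤ`
the condition says that the image of the fundamental class of `S` is not zero. -/
def RepresentsNonzero {n : ℕ} (G : Type u) [AddCommGroup G] (k : ℕ)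
    (S Ω : Set (EuclideanSpace ℝ (Fin n))) : Prop :=
  ∃ (h : S ⊆ Ω) (α : singularHomologyGroup G k (TopCat.of S)),
    singularHomologyMap G k (toPointTop S) α = 0 ∧ singularHomologyMap G k (inclTop h) α ≠ 0

/-- `F` is a `G`-topological competitor of dimension `2` of the closed set `E` in `ℝⁿ`: for some
bounded convex set `B`, the closed set `F` coincides with `E` outside `B`, and every Euclidean
`(n-3)`-sphere outside `B ∪ E` which represents a nonzero element of `H_{n-3}(ℝⁿ \ E; G)` also
represents a nonzero element of `H_{n-3}(ℝⁿ \ F; G)`. -/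
def IsTopologicalCompetitor {n : ℕ} (G : Type u) [AddCommGroup G]
    (E F : Set (EuclideanSpace ℝ (Fin n))) : Prop :=
  IsClosed F ∧
  ∃ B : Set (EuclideanSpace ℝ (Fin n)), Convex ℝ B ∧ Bornology.IsBounded B ∧
    F \ B = E \ B ∧
    ∀ k : ℕ, k + 3 = n → ∀ S : Set (EuclideanSpace ℝ (Fin n)), IsEuclideanSphere k S →
      S ⊆ (B ∪ E)ᶜ → RepresentsNonzero G k S Eᶜ → RepresentsNonzero G k S Fᶜ

/-- `K` is a cone centred at the origin. -/
def IsConeAtZero {n : ℕ} (K : Set (EuclideanSpace ℝ (Fin n))) : Prop :=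
  0 ∈ K ∧ ∀ x ∈ K, ∀ t : ℝ, 0 ≤ t → t • x ∈ K

/-- `K` is reduced (in dimension `2`): every ball centred on `K` meets `K` in positive measure. -/
def IsReduced2 {n : ℕ} (K : Set (EuclideanSpace ℝ (Fin n))) : Prop :=
  ∀ x ∈ K, ∀ r : ℝ, 0 < r → 0 < μH[2] (K ∩ Metric.ball x r)

/-- (Reduced) `2`-dimensional Almgren minimal cones in `ℝⁿ`. -/
structure IsAlmgrenMinimalCone {n : ℕ} (K : Set (EuclideanSpace ℝ (Fin n))) : Prop where
  cone : IsConeAtZero K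
  reduced : IsReduced2 K
  minimal : IsMinimalAmong univ K {F | IsAlmgrenCompetitor K F}

/-- (Reduced) `2`-dimensional `G`-topological minimal cones in `ℝⁿ`. -/
structure IsTopologicalMinimalCone {n : ℕ} (G : Type u) [AddCommGroup G]
    (K : Set (EuclideanSpace ℝ (Fin n))) : Prop where
  cone : IsConeAtZero K
  reduced : IsReduced2 K
  minimal : IsMinimalAmong univ K {F | IsTopologicalCompetitor G K F}

/-! ## The convex domain associated to a cone -/

/-- `a` is a `𝕐` point of `K ∩ ∂B`: a unit vector near which `K` coincides with a union of three
half planes bounded by the line through `a` and making angles of `120°` along it. -/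
def IsYPoint {n : ℕ} (K : Set (EuclideanSpace ℝ (Fin n))) (a : EuclideanSpace ℝ (Fin n)) : Prop :=
  ‖a‖ = 1 ∧ ∃ w : Fin 3 → EuclideanSpace ℝ (Fin n),
    (∀ i, ‖w i‖ = 1 ∧ inner ℝ (w i) a = 0) ∧
    (∀ i j, i ≠ j → inner ℝ (w i) (w j) = -(1 / 2 : ℝ)) ∧
    ∃ r : ℝ, 0 < r ∧
      K ∩ Metric.ball a r =
        {x | ∃ (i : Fin 3) (s t : ℝ), 0 ≤ t ∧ x = s • a + t • w i} ∩ Metric.ball a r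

/-- The `η`-convex domain `𝒰(K, η)` associated to the cone `K`. -/
def convexDomain {n : ℕ} (K : Set (EuclideanSpace ℝ (Fin n))) (η : ℝ) :
    Set (EuclideanSpace ℝ (Fin n)) :=
  {x | x ∈ Metric.ball 0 1 ∧ (∀ y ∈ K, ‖y‖ = 1 → inner ℝ x y < 1 - η) ∧
    ∀ a, IsYPoint K a → inner ℝ x a < 1 - 2 * η}

/-- The planar part `A_a` of the boundary of `𝒰(K, η)` belonging to the `𝕐` point `a`. -/
def planarPart {n : ℕ} (K : Set (EuclideanSpace ℝ (Fin n))) (η : ℝ)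
    (a : EuclideanSpace ℝ (Fin n)) : Set (EuclideanSpace ℝ (Fin n)) :=
  {x | x ∈ Metric.closedBall 0 1 ∧ inner ℝ x a = 1 - 2 * η ∧
    ∀ y ∈ K, ‖y‖ = 1 → inner ℝ x y ≤ 1 - η}

/-- The cone, centred at `0`, over the union of all the planar parts. -/
def planarCone {n : ℕ} (K : Set (EuclideanSpace ℝ (Fin n))) (η : ℝ) :
    Set (EuclideanSpace ℝ (Fin n)) :=
  {x | ∃ a, IsYPoint K a ∧ ∃ z ∈ planarPart K η a, ∃ t : ℝ, 0 ≤ t ∧ x = t • z}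

/-- The arcs and circles that make up `K ∩ ∂B`, as the connected components of `K ∩ ∂B` minus its
`𝕐` points. A great circle of `K ∩ ∂B` is a component which is closed; an arc joining two `𝕐`
points gives a component (the arc without its end points) which is not closed. -/
def netPieces {n : ℕ} (K : Set (EuclideanSpace ℝ (Fin n))) :
    Set (Set (EuclideanSpace ℝ (Fin n))) :=
  {C | ∃ p, p ∈ {x | x ∈ K ∧ ‖x‖ = 1 ∧ ¬ IsYPoint K x} ∧
    C = connectedComponentIn {x | x ∈ K ∧ ‖x‖ = 1 ∧ ¬ IsYPoint K x} p}

/-- The band around a piece of `K ∩ ∂B`: the set of all `x` in the closed unit ball with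
`⟨x, y⟩ = 1 - η` for some `y` in the (closed) arc or circle; when the piece is an arc, the cone
over the planar parts is removed. -/
def band {n : ℕ} (K : Set (EuclideanSpace ℝ (Fin n))) (η : ℝ)
    (C : Set (EuclideanSpace ℝ (Fin n))) : Set (EuclideanSpace ℝ (Fin n)) :=
  {x | x ∈ Metric.closedBall 0 1 ∧ (∃ y ∈ closure C, inner ℝ x y = 1 - η) ∧
    (¬ IsClosed C → x ∉ planarCone K η)}

/-- The condition on `η` in the definition of `η₁(K)`: the domain `𝒰(K, η)` contains its centre
`0`, no three different bands have a common point on `∂𝒰(K, η)`, and the planar parts are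
pairwise disjoint. -/
def IsAdmissibleWidth {n : ℕ} (K : Set (EuclideanSpace ℝ (Fin n))) (η : ℝ) : Prop :=
  0 ∈ convexDomain K η ∧
  (∀ C₁ ∈ netPieces K, ∀ C₂ ∈ netPieces K, ∀ C₃ ∈ netPieces K, C₁ ≠ C₂ → C₁ ≠ C₃ → C₂ ≠ C₃ →
    frontier (convexDomain K η) ∩ (band K η C₁ ∩ band K η C₂ ∩ band K η C₃) = ∅) ∧
  ∀ a b, IsYPoint K a → IsYPoint K b → a ≠ b → Disjoint (planarPart K η a) (planarPart K η b)

/-- The number `η₁(K)`. -/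
def etaOne {n : ℕ} (K : Set (EuclideanSpace ℝ (Fin n))) : ℝ :=
  sSup {η : ℝ | 0 < η ∧ IsAdmissibleWidth K η}

/-! ## Stability -/

/-- `F` is a `δ`-sliding Lipschitz deformation of `E` in the closure of `U`. -/
def IsSlidingDeformation {n : ℕ} (U E : Set (EuclideanSpace ℝ (Fin n))) (δ : ℝ)
    (F : Set (EuclideanSpace ℝ (Fin n))) : Prop :=
  ∃ φ : ℝ → EuclideanSpace ℝ (Fin n) → EuclideanSpace ℝ (Fin n),
    (∀ t ∈ Icc (0 : ℝ) 1, MapsTo (φ t) (closure U) (closure U)) ∧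
    (∀ x ∈ closure U, φ 0 x = x) ∧
    ContinuousOn (fun p : ℝ × EuclideanSpace ℝ (Fin n) => φ p.1 p.2)
      (Icc (0 : ℝ) 1 ×ˢ closure U) ∧
    (∃ L : ℝ≥0, LipschitzOnWith L (φ 1) (closure U)) ∧
    (∀ t ∈ Icc (0 : ℝ) 1, MapsTo (φ t) (frontier U) (frontier U)) ∧
    (∀ t ∈ Icc (0 : ℝ) 1, ∀ x ∈ E ∩ frontier U, ‖φ t x - x‖ < δ) ∧
    F = φ 1 '' E

/-- The class of Hausdorff limits of `δ`-sliding deformations of `E` in the closure of `U`: the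
closed subsets of `closure U`, of finite `ℋ²` measure in the compact balls contained in `U`, to
which some sequence of `δ`-sliding deformations of `E` converges in the Hausdorff distance. -/
def slidingLimits {n : ℕ} (U E : Set (EuclideanSpace ℝ (Fin n))) (δ : ℝ) :
    Set (Set (EuclideanSpace ℝ (Fin n))) :=
  {F | IsClosed F ∧ F ⊆ closure U ∧
    (∀ (x : EuclideanSpace ℝ (Fin n)) (r : ℝ), Metric.closedBall x r ⊆ U →
      μH[2] (F ∩ Metric.closedBall x r) < ∞) ∧
    ∃ Fs : ℕ → Set (EuclideanSpace ℝ (Fin n)), (∀ j, IsSlidingDeformation U E δ (Fs j)) ∧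
      Filter.Tendsto (fun j => Metric.hausdorffEDist (Fs j) F) Filter.atTop (𝓝 0)}

/-- The cone `K` is `(η, δ)`-Almgren sliding stable: `K` (that is, `K ∩ closure 𝒰(K, η)`) is
`δ`-sliding minimal in the closure of `𝒰(K, η)`. -/
def IsSlidingStableWith {n : ℕ} (K : Set (EuclideanSpace ℝ (Fin n))) (η δ : ℝ) : Prop :=
  IsMinimalAmong (convexDomain K η) (K ∩ closure (convexDomain K η))
    (slidingLimits (convexDomain K η) (K ∩ closure (convexDomain K η)) δ)

/-- The cone `K` is Almgren sliding stable. -/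
def IsAlmgrenSlidingStable {n : ℕ} (K : Set (EuclideanSpace ℝ (Fin n))) : Prop :=
  ∃ η δ : ℝ, 0 < δ ∧ δ < η ∧ η < etaOne K ∧ IsSlidingStableWith K η δ

/-- The part `V_δ` of `∂𝒰(K, η)` at distance at most `δ` from `K`. -/
def boundaryNhd {n : ℕ} (K : Set (EuclideanSpace ℝ (Fin n))) (η δ : ℝ) :
    Set (EuclideanSpace ℝ (Fin n)) :=
  {x | x ∈ frontier (convexDomain K η) ∧ Metric.infDist x K ≤ δ}

/-- `F` is an `(η, δ)`-`G`-topological competitor for the cone `K`. -/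
def IsTopologicalCompetitorWith {n : ℕ} (G : Type u) [AddCommGroup G]
    (K : Set (EuclideanSpace ℝ (Fin n))) (η δ : ℝ) (F : Set (EuclideanSpace ℝ (Fin n))) : Prop :=
  IsClosed F ∧
  F \ closure (convexDomain K η) = K \ closure (convexDomain K η) ∧
  F ∩ frontier (convexDomain K η) ⊆ boundaryNhd K η δ ∧
  IsTopologicalCompetitor G K (F ∪ boundaryNhd K η δ)

/-- The cone `K` is `(η, δ)`-`G`-topologically stable. -/
def IsTopologicallyStableWith {n : ℕ} (G : Type u) [AddCommGroup G]
    (K : Set (EuclideanSpace ℝ (Fin n))) (η δ : ℝ) : Prop :=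
  ∀ F, IsTopologicalCompetitorWith G K η δ F →
    μH[2] (K ∩ closure (convexDomain K η)) ≤ μH[2] (F ∩ closure (convexDomain K η))

/-- The cone `K` is `G`-topologically stable. -/
def IsTopologicallyStable {n : ℕ} (G : Type u) [AddCommGroup G]
    (K : Set (EuclideanSpace ℝ (Fin n))) : Prop :=
  ∃ η δ : ℝ, 0 < δ ∧ δ < η ∧ η < etaOne K ∧ IsTopologicallyStableWith G K η δ

end

/-!
Let `P : ℝⁿ → ℝᵈ` be the orthogonal projection belonging to the embedding `ι` (`proj ι`). It is
`1`-Lipschitz and a left inverse of `ι`, so it does not increase `ℋ²`. All four claims follow the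
same pattern: if `F` is a competitor of `ι(K)` in `ℝⁿ`, then `P(F)` is a competitor of `K` in `ℝᵈ`
of the same kind, and minimality of `K` against `P(F)` gives minimality of `ι(K)` against `F`
(`measure_sdiff_le_of_proj`). What has to be shown is that competitors project to competitors.

*Almgren competitors.* A deformation `φ` of `ℝⁿ` induces the deformation `P ∘ φ ∘ ι` of `ℝᵈ`
(`isAlmgrenCompetitor_proj`).

*Topological competitors* (`isTopologicalCompetitor_proj`). It suffices to add one dimension.
Given a round sphere `S` in `ℝᵈ` which represents a nonzero class of the complement of `K`, let
`T` be the round sphere in `ℝᵈ⁺¹` with the same centre and radius whose equator is `S`. The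
complement of `ι(K)` is the union of two contractible sets, each consisting of the cylinder over
the complement of `K` and an open half space, and they meet in that cylinder; the two hemispheres
of `T`, slightly enlarged, meet in a neighbourhood of the equator. By Mayer–Vietoris `T`
represents a nonzero class of the complement of `ι(K)`
(`IsHyperplane.reducedNonzero_suspension_iff`). Since `T` stays away from the bounded set where
`F` differs from `ι(K)`, the competitor condition applies to `T` and `F`, and the same argument,
with the half spaces replaced by the regions above and below the graphs of `± τ` for a function
`τ` bounding the height of `F`, shows that `S` represents a nonzero class of the complement of
`P(F)`. The relevant part of Mayer–Vietoris is proved for singular chains with coefficients in an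
arbitrary group (`SingularChains.reducedNonzero_union_iff`); it rests on barycentric subdivision
and the theorem of small chains (`SingularChains.exists_sd_iterate_mem`).

*Convex domains.* Inside the open unit ball, the domain of `ι(K)` is the preimage under `P` of the
domain of `K`, and bands and planar parts project to bands and planar parts. Hence every
admissible width of `K` is admissible for `ι(K)` (`IsAdmissibleWidth.image`), and the width `η` of
the stability of `K` can be kept.

*Sliding competitors.* If `φ` is a sliding deformation for `ι(K)`, then `P ∘ φ₁ ∘ ι` preserves the
closure of the domain `𝒰` of `K` and maps the boundary points of `K` to boundary points, because
`K` stays away from the unit sphere inside `𝒰`; but it may move other boundary points into the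
interior. Its values on `K` are also those of a sliding deformation
(`isSlidingDeformation_image`): the straight homotopy from the identity is cut off at a small
distance from `K`, and followed by the radial dilation that restores the boundary. The dilation
increases displacements by a bounded factor, which is why the `δ` of `ℝⁿ` is taken smaller than
that of `ℝᵈ` (`isSlidingDeformation_proj`, `IsAlmgrenSlidingStable.image`).

*Competitors relative to a boundary neighbourhood.* The points of the boundary at distance at most
`δ < η` from the cone do not lie on the unit sphere, so the projection maps the boundary
neighbourhood of `ι(K)` onto that of `K` (`image_proj_boundaryNhd`).
-/

/-! ### Singular chains -/

noncomputable section

open CategoryTheory Simplicial AlgebraicTopology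

namespace SingularChains

/-- The singular chain complex of `E` with coefficients in `G`. -/
abbrev cplx (G : Type u) [AddCommGroup G] (E : Type) [TopologicalSpace E] :
    ChainComplex AddCommGrpCat.{u} ℕ :=
  ((singularChainComplexFunctor AddCommGrpCat.{u}).obj (AddCommGrpCat.of G)).obj (TopCat.of E)

/-- The standard topological `n`-simplex. -/
abbrev Simp (n : ℕ) : Type := stdSimplex ℝ (Fin (n + 1))

variable {G : Type u} [AddCommGroup G] {E E' : Type} [TopologicalSpace E] [TopologicalSpace E']
variable {n : ℕ}

/-- The chain `a • σ` consisting of a single singular simplex. -/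
def gen (σ : C(Simp n, E)) : G →+ (cplx G E).X n :=
  ((TopCat.toSSet.obj (TopCat.of E)).ιChainComplex (R := AddCommGrpCat.of G)
    (((TopCat.of E).toSSetObjEquiv (Opposite.op ⦋n⦌)).symm σ)).hom

/-- The inclusion of the `i`-th face. -/
def face (i : Fin (n + 2)) : C(Simp n, Simp (n + 1)) :=
  ⟨stdSimplex.map (S := ℝ) (Fin.succAbove i), stdSimplex.continuous_map _⟩

/-- The map of chains induced by a continuous map. -/
def push (f : C(E, E')) (n : ℕ) : (cplx G E).X n →+ (cplx G E').X n :=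
  ((((singularChainComplexFunctor AddCommGrpCat.{u}).obj (AddCommGrpCat.of G)).map
    (TopCat.ofHom f)).f n).hom

/-- The boundary of singular chains. -/
def bd (G : Type u) [AddCommGroup G] (E : Type) [TopologicalSpace E] (n : ℕ) :
    (cplx G E).X (n + 1) →+ (cplx G E).X n := ((cplx G E).d (n + 1) n).hom

theorem hom_ext {M : Type u} [AddCommGroup M] {f g : (cplx G E).X n →+ M}
    (h : ∀ (σ : C(Simp n, E)) (a : G), f (gen σ a) = g (gen σ a)) : f = g := by
  have := SSet.chainComplex_hom_ext (X := TopCat.toSSet.obj (TopCat.of E))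
    (R := AddCommGrpCat.of G) (n := n) (T := AddCommGrpCat.of M)
    (f := AddCommGrpCat.ofHom f) (g := AddCommGrpCat.ofHom g) (by
      intro x
      ext a
      have := h ((TopCat.of E).toSSetObjEquiv _ x) a
      exact this)
  ext x
  exact congr($(this).hom x)

/-- Singular chains form a direct sum of copies of `G` over the singular simplices. -/
theorem exists_lift {M : Type u} [AddCommGroup M] (φ : C(Simp n, E) → G →+ M) :
    ∃ f : (cplx G E).X n →+ M, ∀ σ a, f (gen σ a) = φ σ a := by
  let f := Limits.Cofan.IsColimit.desc
    ((TopCat.toSSet.obj (TopCat.of E)).isColimitChainComplexXCofan (AddCommGrpCat.of G) n)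
    (fun x => AddCommGrpCat.ofHom (φ ((TopCat.of E).toSSetObjEquiv _ x)))
  refine ⟨f.hom, fun σ a => ?_⟩
  have := Limits.Cofan.IsColimit.fac
    ((TopCat.toSSet.obj (TopCat.of E)).isColimitChainComplexXCofan (AddCommGrpCat.of G) n)
    (fun x => AddCommGrpCat.ofHom (φ ((TopCat.of E).toSSetObjEquiv _ x)))
    (((TopCat.of E).toSSetObjEquiv (Opposite.op ⦋n⦌)).symm σ)
  have h2 := congr($(this).hom a)
  simp only [Equiv.apply_symm_apply] at h2
  exact h2

theorem push_gen (f : C(E, E')) (σ : C(Simp n, E)) (a : G) :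
    push f n (gen σ a) = gen (f.comp σ) a := by
  have := SSet.ι_chainComplexMap_f (X := TopCat.toSSet.obj (TopCat.of E))
    (Y := TopCat.toSSet.obj (TopCat.of E')) (TopCat.toSSet.map (TopCat.ofHom f))
    (AddCommGrpCat.of G) (((TopCat.of E).toSSetObjEquiv (Opposite.op ⦋n⦌)).symm σ)
  exact congr($(this).hom a)

theorem hom_sum_zsmul_apply {A B : AddCommGrpCat.{u}} {κ : Type*} [Fintype κ] (m : κ → ℤ)
    (f : κ → (A ⟶ B)) (a : A) :
    (∑ i, m i • f i).hom a = ∑ i, m i • (f i).hom a := by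
  change AddCommGrpCat.homAddEquiv (∑ i, m i • f i) a = _
  rw [map_sum, AddMonoidHom.finsetSum_apply]
  refine Finset.sum_congr rfl fun i _ => ?_
  rw [map_zsmul]
  rfl

theorem bd_gen (σ : C(Simp (n + 1), E)) (a : G) :
    bd G E n (gen σ a) = ∑ i : Fin (n + 2), (-1 : ℤ) ^ (i : ℕ) • gen (σ.comp (face i)) a := by
  have := SSet.ιChainComplex_d (X := TopCat.toSSet.obj (TopCat.of E)) (AddCommGrpCat.of G)
    (((TopCat.of E).toSSetObjEquiv (Opposite.op ⦋n+1⦌)).symm σ)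
  have h2 := congr($(this).hom a)
  refine (h2.trans ?_)
  exact hom_sum_zsmul_apply _ _ _

theorem bd_bd (c : (cplx G E).X (n + 2)) : bd G E n (bd G E (n + 1) c) = 0 :=
  congr($((cplx G E).d_comp_d (n+2) (n+1) n).hom c)

theorem push_bd (f : C(E, E')) (c : (cplx G E).X (n + 1)) :
    push f n (bd G E n c) = bd G E' n (push f (n + 1) c) :=
  (congr($((((singularChainComplexFunctor AddCommGrpCat.{u}).obj (AddCommGrpCat.of G)).map
    (TopCat.ofHom f)).comm (n+1) n).hom c)).symm

section Classes
variable {K K' : ChainComplex AddCommGrpCat.{u} ℕ} {k : ℕ}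

/-- The chain `z` is a cycle whose class is `α`. -/
def Represents (z : K.X k) (α : K.homology k) : Prop :=
  ∃ w : K.cycles k, K.iCycles k w = z ∧ K.homologyπ k w = α

theorem Represents.d_eq_zero {z : K.X k} {α : K.homology k} (h : Represents z α) (j : ℕ) :
    K.d k j z = 0 := by
  obtain ⟨w, rfl, -⟩ := h
  exact congr($(K.iCycles_d k j).hom w)

theorem Represents.exists_class {z : K.X k} (h : ∀ j, K.d k j z = 0) :
    ∃ α : K.homology k, Represents z α := by
  have hex : (ShortComplex.mk (K.iCycles k) (K.d k ((ComplexShape.down ℕ).next k))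
      (K.iCycles_d _ _)).Exact :=
    ShortComplex.exact_of_f_is_kernel _ (K.cyclesIsKernel k _ rfl)
  rw [ShortComplex.ab_exact_iff] at hex
  obtain ⟨w, hw⟩ := hex z (h _)
  exact ⟨_, w, hw, rfl⟩

theorem Represents.exists_cycle (α : K.homology k) : ∃ z : K.X k, Represents z α := by
  obtain ⟨w, hw⟩ := (AddCommGrpCat.epi_iff_surjective (K.homologyπ k)).1 inferInstance α
  exact ⟨_, w, rfl, hw⟩

theorem Represents.map (f : K ⟶ K') {z : K.X k} {α : K.homology k} (h : Represents z α) :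
    Represents (f.f k z) (HomologicalComplex.homologyMap f k α) := by
  obtain ⟨w, rfl, rfl⟩ := h
  exact ⟨HomologicalComplex.cyclesMap f k w,
    congr($(HomologicalComplex.cyclesMap_i f k).hom w),
    congr($(HomologicalComplex.homologyπ_naturality f k).hom w).symm⟩

theorem Represents.eq_zero_iff {z : K.X k} {α : K.homology k} (h : Represents z α) :
    α = 0 ↔ ∃ y : K.X (k + 1), K.d (k + 1) k y = z := by
  obtain ⟨w, rfl, rfl⟩ := h
  have hex : (ShortComplex.mk (K.toCycles (k + 1) k) (K.homologyπ k)
      (K.toCycles_comp_homologyπ _ _)).Exact :=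
    ShortComplex.exact_of_g_is_cokernel _ (K.homologyIsCokernel (k + 1) k (by simp))
  rw [ShortComplex.ab_exact_iff] at hex
  constructor
  · intro h0
    obtain ⟨y, hy⟩ := hex w h0
    refine ⟨y, ?_⟩
    rw [← K.toCycles_i (k + 1) k]
    exact congrArg (K.iCycles k) hy
  · rintro ⟨y, hy⟩
    have : K.toCycles (k + 1) k y = w := by
      apply (AddCommGrpCat.mono_iff_injective (K.iCycles k)).1 inferInstance
      rw [← hy, ← K.toCycles_i (k + 1) k]
      rfl
    rw [← this]
    exact congr($(K.toCycles_comp_homologyπ (k + 1) k).hom y)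

end Classes

/-- The chains of `E` whose simplices lie in `A`. -/
def chainsIn (G : Type u) [AddCommGroup G] (A : Set E) (n : ℕ) : AddSubgroup ((cplx G E).X n) :=
  AddSubgroup.closure {c | ∃ (σ : C(Simp n, E)) (a : G), range σ ⊆ A ∧ c = gen σ a}

theorem gen_mem_chainsIn {A : Set E} {σ : C(Simp n, E)} (h : range σ ⊆ A) (a : G) :
    gen σ a ∈ chainsIn G A n := AddSubgroup.subset_closure ⟨σ, a, h, rfl⟩

theorem chainsIn_le {A : Set E} {H : AddSubgroup ((cplx G E).X n)}
    (h : ∀ σ : C(Simp n, E), range σ ⊆ A → ∀ a : G, gen σ a ∈ H) : chainsIn G A n ≤ H := by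
  refine (AddSubgroup.closure_le _).2 ?_
  rintro _ ⟨σ, a, hσ, rfl⟩
  exact h σ hσ a

theorem chainsIn_mono {A B : Set E} (h : A ⊆ B) : chainsIn G A n ≤ chainsIn G B n :=
  chainsIn_le fun _ hσ a => gen_mem_chainsIn (hσ.trans h) a

theorem chainsIn_univ : chainsIn G (univ : Set E) n = ⊤ := by
  have : QuotientAddGroup.mk' (chainsIn G (univ : Set E) n) = 0 := hom_ext fun σ a => by
    simpa using gen_mem_chainsIn (subset_univ _) a
  rw [← QuotientAddGroup.ker_mk' (chainsIn G (univ : Set E) n), this, AddMonoidHom.ker_zero]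

theorem bd_mem_chainsIn {A : Set E} {c : (cplx G E).X (n + 1)} (hc : c ∈ chainsIn G A (n + 1)) :
    bd G E n c ∈ chainsIn G A n := by
  refine chainsIn_le (H := (chainsIn G A n).comap (bd G E n)) (fun σ hσ a => ?_) hc
  rw [AddSubgroup.mem_comap, bd_gen]
  exact sum_mem fun i _ => zsmul_mem (gen_mem_chainsIn (by
    rintro _ ⟨x, rfl⟩; exact hσ ⟨_, rfl⟩) a) _

/-- A chain is uniquely a combination of simplices, so that a chain carried by `A` and by `B` is
carried by `A ∩ B`. -/
theorem chainsIn_inf_le {A B : Set E} : chainsIn G A n ⊓ chainsIn G B n ≤ chainsIn G (A ∩ B) n := by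
  classical
  -- the projection onto the simplices contained in `A`
  obtain ⟨π, hπ⟩ := exists_lift (G := G) (E := E) (n := n)
    (fun σ => if range σ ⊆ A then gen σ else 0)
  rintro c ⟨hA, hB⟩
  have h1 : c ∈ (π - AddMonoidHom.id _).ker := chainsIn_le (fun σ hσ a => by
    simp [AddMonoidHom.mem_ker, hπ, hσ]) hA
  have h2 : c ∈ (chainsIn G (A ∩ B) n).comap π := chainsIn_le (fun σ hσ a => by
    rw [AddSubgroup.mem_comap, hπ]
    split_ifs with h
    · exact gen_mem_chainsIn (subset_inter h hσ) a
    · simp) hB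
  rw [AddMonoidHom.mem_ker, AddMonoidHom.sub_apply, sub_eq_zero] at h1
  rw [AddSubgroup.mem_comap, h1] at h2
  exact h2

/-- The inclusion of a subset as a continuous map. -/
def incl (A : Set E) : C(A, E) := ⟨Subtype.val, continuous_subtype_val⟩

theorem push_mem_chainsIn {A : Set E} {B : Set E'} {f : C(E, E')} (h : MapsTo f A B)
    {c : (cplx G E).X n} (hc : c ∈ chainsIn G A n) : push f n c ∈ chainsIn G B n := by
  refine chainsIn_le (H := (chainsIn G B n).comap (push f n)) (fun σ hσ a => ?_) hc
  rw [AddSubgroup.mem_comap, push_gen]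
  refine gen_mem_chainsIn ?_ a
  rintro _ ⟨x, rfl⟩
  exact h (hσ ⟨x, rfl⟩)

theorem mem_chainsIn_iff {A : Set E} {c : (cplx G E).X n} :
    c ∈ chainsIn G A n ↔ ∃ c', push (incl A) n c' = c := by
  constructor
  · intro hc
    refine chainsIn_le (H := (push (incl A) n).range) (fun σ hσ a => ?_) hc
    refine ⟨gen ⟨fun x => ⟨σ x, hσ ⟨x, rfl⟩⟩, by fun_prop⟩ a, ?_⟩
    rw [push_gen]
    rfl
  · rintro ⟨c', rfl⟩
    exact push_mem_chainsIn (A := univ) (fun x _ => x.2) (by rw [chainsIn_univ]; trivial)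

theorem push_incl_injective (A : Set E) : Function.Injective (push (G := G) (incl A) n) := by
  have h1 : Mono (TopCat.ofHom (incl A)) :=
    (TopCat.mono_iff_injective _).2 Subtype.val_injective
  have h2 : Mono (((singularChainComplexFunctor AddCommGrpCat.{u}).obj (AddCommGrpCat.of G)).map
    (TopCat.ofHom (incl A))) := inferInstance
  have h3 : Mono ((((singularChainComplexFunctor AddCommGrpCat.{u}).obj (AddCommGrpCat.of G)).map
    (TopCat.ofHom (incl A))).f n) := inferInstance
  exact (AddCommGrpCat.mono_iff_injective _).1 h3

theorem push_comp {E'' : Type} [TopologicalSpace E''] (f : C(E, E')) (g : C(E', E''))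
    (c : (cplx G E).X n) : push (g.comp f) n c = push g n (push f n c) := by
  have : push (G := G) (g.comp f) n = (push g n).comp (push f n) := hom_ext fun σ a => by
    simp [push_gen, ContinuousMap.comp_assoc]
  rw [this]; rfl

end SingularChains

end

/-! ### Barycentric subdivision of affine chains -/

noncomputable section

open CategoryTheory Simplicial AlgebraicTopology

namespace SingularChains

variable {k m n : ℕ}

/-- The affine singular simplex with given vertices. -/
def aff (w : Fin (k + 1) → Simp n) : C(Simp k, Simp n) where
  toFun x := ⟨∑ i, x i • (w i : Fin (n + 1) → ℝ),
    (convex_stdSimplex ℝ (Fin (n + 1))).sum_mem (fun i _ => x.2.1 i) x.2.2 (fun i _ => (w i).2)⟩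
  continuous_toFun := by
    refine Continuous.subtype_mk (continuous_finsetSum _ fun i _ => ?_) _
    exact Continuous.smul ((continuous_apply i).comp continuous_subtype_val) continuous_const

theorem aff_apply (w : Fin (k + 1) → Simp n) (x : Simp k) (c : Fin (n + 1)) :
    aff w x c = ∑ i, x i * w i c := by
  change (∑ i, x i • (w i : Fin (n + 1) → ℝ)) c = _
  rw [Finset.sum_apply]
  rfl

theorem aff_vertex (w : Fin (k + 1) → Simp n) (i : Fin (k + 1)) :
    aff w (stdSimplex.vertex i) = w i := by
  ext c
  rw [aff_apply]
  simp [Pi.single_apply]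

theorem aff_vertices : aff (fun i : Fin (k + 1) => stdSimplex.vertex (S := ℝ) i) =
    ContinuousMap.id (Simp k) := by
  ext x c
  rw [aff_apply]
  simp [Pi.single_apply]

theorem aff_aff (u : Fin (m + 1) → Simp n) (w : Fin (k + 1) → Simp m) (x : Simp k) :
    aff (fun i => aff u (w i)) x = aff u (aff w x) := by
  ext c
  simp only [aff_apply, Finset.sum_mul, Finset.mul_sum]
  rw [Finset.sum_comm]
  simp only [mul_assoc]

theorem face_eq_aff (i : Fin (k + 2)) : (face i : C(Simp k, Simp (k + 1))) =
    aff (fun j => stdSimplex.vertex (S := ℝ) (i.succAbove j)) := by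
  ext x c
  rw [aff_apply]
  simp [face, FunOnFinite.linearMap_apply_apply, Finset.sum_ite, Pi.single_apply, eq_comm]

theorem aff_face (w : Fin (k + 2) → Simp n) (i : Fin (k + 2)) (x : Simp k) :
    aff w (face i x) = aff (fun j => w (i.succAbove j)) x := by
  rw [face_eq_aff, ← aff_aff]
  simp only [aff_vertex]

/-- The barycentre of a tuple of points. -/
def bary (w : Fin (k + 1) → Simp n) : Simp n := aff w stdSimplex.barycenter

theorem bary_aff (u : Fin (m + 1) → Simp n) (w : Fin (k + 1) → Simp m) :
    bary (fun i => aff u (w i)) = aff u (bary w) := aff_aff _ _ _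

/-- Integral affine `k`-chains of the standard `n`-simplex: formal sums of tuples of vertices. -/
abbrev Aff (k n : ℕ) : Type := FreeAbelianGroup (Fin (k + 1) → Simp n)

open FreeAbelianGroup (of lift)

/-- The boundary of affine chains. -/
def affBd (k n : ℕ) : Aff (k + 1) n →+ Aff k n :=
  lift fun w => ∑ i : Fin (k + 2), (-1 : ℤ) ^ (i : ℕ) • of fun j => w (i.succAbove j)

/-- The cone with apex `b` over an affine chain. -/
def cone (b : Simp n) : Aff k n →+ Aff (k + 1) n :=
  lift fun w => of (Fin.cons b w : Fin (k + 2) → Simp n)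

theorem affBd_of (w : Fin (k + 2) → Simp n) :
    affBd k n (of w) = ∑ i : Fin (k + 2), (-1 : ℤ) ^ (i : ℕ) • of fun j => w (i.succAbove j) := by
  simp [affBd]

theorem cone_of (b : Simp n) (w : Fin (k + 1) → Simp n) :
    cone b (of w) = of (Fin.cons b w : Fin (k + 2) → Simp n) := by simp [cone]

theorem affBd_cone (b : Simp n) (c : Aff (k + 1) n) :
    affBd (k + 1) n (cone b c) = c - cone b (affBd k n c) := by
  suffices h : (affBd (k + 1) n).comp (cone b) = AddMonoidHom.id _ - (cone b).comp (affBd k n) from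
    congr($h c)
  refine FreeAbelianGroup.lift_ext _ _ fun w => ?_
  simp only [AddMonoidHom.comp_apply, AddMonoidHom.sub_apply, AddMonoidHom.id_apply, cone_of,
    affBd_of, map_sum, map_zsmul]
  rw [Fin.sum_univ_succ, sub_eq_add_neg, ← Finset.sum_neg_distrib]
  refine congrArg₂ (· + ·) (by simp) (Finset.sum_congr rfl fun i _ => ?_)
  rw [← neg_smul, Fin.val_succ, pow_succ, mul_neg_one]
  congr 2
  funext j
  refine Fin.cases ?_ (fun j => ?_) j <;> simp

/-- The map of affine chains induced by the affine map with vertices `u`. -/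
def affMap (u : Fin (m + 1) → Simp n) (k : ℕ) : Aff k m →+ Aff k n :=
  lift fun w => of fun i => aff u (w i)

theorem affMap_of (u : Fin (m + 1) → Simp n) (w : Fin (k + 1) → Simp m) :
    affMap u k (of w) = of fun i => aff u (w i) := by simp [affMap]

theorem affMap_affBd (u : Fin (m + 1) → Simp n) (c : Aff (k + 1) m) :
    affMap u k (affBd k m c) = affBd k n (affMap u (k + 1) c) := by
  suffices h : (affMap u k).comp (affBd k m) = (affBd k n).comp (affMap u (k + 1)) from congr($h c)
  refine FreeAbelianGroup.lift_ext _ _ fun w => ?_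
  simp [affMap_of, affBd_of]

theorem affMap_cone (u : Fin (m + 1) → Simp n) (b : Simp m) (c : Aff k m) :
    affMap u (k + 1) (cone b c) = cone (aff u b) (affMap u k c) := by
  suffices h : (affMap u (k + 1)).comp (cone b) = (cone (aff u b)).comp (affMap u k) from
    congr($h c)
  refine FreeAbelianGroup.lift_ext _ _ fun w => ?_
  simp only [AddMonoidHom.comp_apply, cone_of, affMap_of]
  congr 1
  funext j
  refine Fin.cases ?_ (fun j => ?_) j <;> simp

/-- Barycentric subdivision of affine chains: the cone, from the barycentre, over the subdivided
boundary. -/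
def affSd (n k : ℕ) : Aff k n →+ Aff k n :=
  match k with
  | 0 => AddMonoidHom.id _
  | k + 1 => lift fun w => cone (bary w) (affSd n k (affBd k n (of w)))

/-- The chain homotopy between the identity and the barycentric subdivision of affine chains. -/
def affSdh (n k : ℕ) : Aff k n →+ Aff (k + 1) n :=
  match k with
  | 0 => 0
  | k + 1 => lift fun w => cone (bary w) (of w - affSdh n k (affBd k n (of w)))

theorem affSd_of (w : Fin (k + 2) → Simp n) :
    affSd n (k + 1) (of w) = cone (bary w) (affSd n k (affBd k n (of w))) := by simp [affSd]

theorem affSdh_of (w : Fin (k + 2) → Simp n) :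
    affSdh n (k + 1) (of w) = cone (bary w) (of w - affSdh n k (affBd k n (of w))) := by
  simp [affSdh]

theorem affBd_affBd (c : Aff (k + 2) n) : affBd k n (affBd (k + 1) n c) = 0 := by
  induction k with
  | zero =>
    suffices h : (affBd 0 n).comp (affBd 1 n) = 0 from congr($h c)
    refine FreeAbelianGroup.lift_ext _ _ fun w => ?_
    have h0 : ∀ v : Fin 2 → Simp n, affBd 0 n (of v) = (of fun _ => v 1) - of fun _ => v 0 := by
      intro v
      rw [affBd_of, Fin.sum_univ_two, sub_eq_add_neg]
      refine congrArg₂ (· + ·) ?_ ?_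
      · simp only [Fin.val_zero, pow_zero, one_smul]
        congr 1; funext j; rw [show j = 0 from Fin.ext (by omega)]; rfl
      · simp only [Fin.val_one, pow_one, neg_smul, one_smul]
        congr 2; funext j; rw [show j = 0 from Fin.ext (by omega)]; rfl
    rw [AddMonoidHom.comp_apply, affBd_of, Fin.sum_univ_three]
    simp only [map_add, map_neg, Fin.val_zero, Fin.val_one, Fin.val_two, pow_zero, pow_one,
      one_smul, neg_smul, even_two, Even.neg_pow, one_pow]
    rw [h0, h0, h0]
    simp [Fin.succAbove, Fin.lt_def]
  | succ k ih =>
    suffices h : (affBd (k + 1) n).comp (affBd (k + 2) n) = 0 from congr($h c)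
    refine FreeAbelianGroup.lift_ext _ _ fun w => ?_
    have hw : (of w : Aff (k + 3) n) = cone (w 0) (of (Fin.tail w)) := by
      rw [cone_of, Fin.cons_self_tail]
    rw [AddMonoidHom.comp_apply, hw, affBd_cone, map_sub, affBd_cone, ih]
    simp

theorem affBd_affSdh (c : Aff (k + 1) n) :
    affBd (k + 1) n (affSdh n (k + 1) c) + affSdh n k (affBd k n c) = c - affSd n (k + 1) c := by
  induction k with
  | zero =>
    suffices h : (affBd 1 n).comp (affSdh n 1) + (affSdh n 0).comp (affBd 0 n) =
      AddMonoidHom.id _ - affSd n 1 from congr($h c)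
    refine FreeAbelianGroup.lift_ext _ _ fun w => ?_
    simp only [AddMonoidHom.add_apply, AddMonoidHom.comp_apply, AddMonoidHom.sub_apply,
      AddMonoidHom.id_apply]
    have h1 := affBd_cone (bary w) (of w)
    have h2 : affSdh n 1 (of w) = cone (bary w) (of w) := by rw [affSdh_of]; simp [affSdh]
    have h3 : affSd n 1 (of w) = cone (bary w) (affBd 0 n (of w)) := by rw [affSd_of]; simp [affSd]
    rw [h2, h3]
    simpa [affSdh] using h1
  | succ k ih =>
    suffices h : (affBd (k + 2) n).comp (affSdh n (k + 2)) +
        (affSdh n (k + 1)).comp (affBd (k + 1) n) =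
      AddMonoidHom.id _ - affSd n (k + 2) from congr($h c)
    refine FreeAbelianGroup.lift_ext _ _ fun w => ?_
    have := ih (affBd (k + 1) n (of w))
    rw [affBd_affBd, map_zero, add_zero] at this
    simp only [AddMonoidHom.add_apply, AddMonoidHom.comp_apply, AddMonoidHom.sub_apply,
      AddMonoidHom.id_apply, affSdh_of (k := k + 1), affSd_of (k := k + 1), affBd_cone,
      map_sub, this]
    abel

theorem affMap_affSd (u : Fin (m + 1) → Simp n) (c : Aff k m) :
    affMap u k (affSd m k c) = affSd n k (affMap u k c) := by
  induction k with
  | zero => rfl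
  | succ k ih =>
    suffices h : (affMap u (k + 1)).comp (affSd m (k + 1)) =
        (affSd n (k + 1)).comp (affMap u (k + 1)) from
      congr($h c)
    refine FreeAbelianGroup.lift_ext _ _ fun w => ?_
    simp only [AddMonoidHom.comp_apply, affSd_of, affMap_cone, ih, affMap_affBd, affMap_of,
      bary_aff]

theorem affMap_affSdh (u : Fin (m + 1) → Simp n) (c : Aff k m) :
    affMap u (k + 1) (affSdh m k c) = affSdh n k (affMap u k c) := by
  induction k with
  | zero => simp [affSdh]
  | succ k ih =>
    suffices h : (affMap u (k + 2)).comp (affSdh m (k + 1)) =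
        (affSdh n (k + 1)).comp (affMap u (k + 1)) from
      congr($h c)
    refine FreeAbelianGroup.lift_ext _ _ fun w => ?_
    simp only [AddMonoidHom.comp_apply, affSdh_of, affMap_cone, map_sub, ih, affMap_affBd,
      affMap_of, bary_aff]

/-- The affine chains made of simplices with vertices in `A` and pairwise distances at most `D`
between vertices. -/
def smallAff (A : Set (Simp n)) (D : ℝ) (k : ℕ) : AddSubgroup (Aff k n) :=
  AddSubgroup.closure {c | ∃ u : Fin (k + 1) → Simp n, (∀ i, u i ∈ A) ∧
    (∀ i j, dist (u i) (u j) ≤ D) ∧ c = of u}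

theorem dist_le_iff {x y : Simp n} {D : ℝ} (hD : 0 ≤ D) :
    dist x y ≤ D ↔ ∀ c, |x c - y c| ≤ D := by
  rw [Subtype.dist_eq, dist_pi_le_iff hD]
  rfl

theorem dist_aff_le (w : Fin (k + 1) → Simp n) (x : Simp k) (y : Simp n) {D : ℝ} (hD : 0 ≤ D)
    (h : ∀ i, dist y (w i) ≤ D) : dist y (aff w x) ≤ D := by
  rw [dist_le_iff hD]
  intro c
  have e : y c - aff w x c = ∑ i, x i * (y c - w i c) := by
    simp only [aff_apply, mul_sub, Finset.sum_sub_distrib, ← Finset.sum_mul]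
    rw [stdSimplex.sum_eq_one, one_mul]
  rw [e]
  calc _ ≤ ∑ i, |x i * (y c - w i c)| := Finset.abs_sum_le_sum_abs _ _
    _ ≤ ∑ i, x i * D := Finset.sum_le_sum fun i _ => by
        rw [abs_mul, abs_of_nonneg (stdSimplex.zero_le x i)]
        exact mul_le_mul_of_nonneg_left ((dist_le_iff hD).1 (h i) c) (stdSimplex.zero_le x i)
    _ = D := by rw [← Finset.sum_mul, stdSimplex.sum_eq_one, one_mul]

theorem dist_bary_vertex_le (w : Fin (k + 1) → Simp n) {D : ℝ} (hD : 0 ≤ D)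
    (h : ∀ i j, dist (w i) (w j) ≤ D) (i : Fin (k + 1)) :
    dist (bary w) (w i) ≤ k / (k + 1) * D := by
  rw [dist_le_iff (by positivity)]
  intro c
  have e : bary w c - w i c = (k + 1 : ℝ)⁻¹ * ∑ j, (w j c - w i c) := by
    simp only [bary, aff_apply, Finset.sum_sub_distrib, mul_sub]
    have hx : ∀ j, (stdSimplex.barycenter : Simp k) j = (k + 1 : ℝ)⁻¹ := fun j =>
      (stdSimplex.barycenter_apply j).trans (by simp)
    simp only [hx, ← Finset.mul_sum]
    simp
    field_simp
  rw [e, abs_mul, abs_of_nonneg (by positivity)]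
  have : |∑ j, (w j c - w i c)| ≤ k * D := by
    rw [← Finset.add_sum_erase _ _ (Finset.mem_univ i), sub_self, zero_add]
    refine (Finset.abs_sum_le_sum_abs _ _).trans ?_
    refine (Finset.sum_le_card_nsmul _ _ D fun j _ => (dist_le_iff hD).1 (h j i) c).trans ?_
    simp
  calc _ ≤ (k + 1 : ℝ)⁻¹ * (k * D) := by gcongr
    _ = _ := by ring

/-- Subdivision shrinks a `k`-simplex by the factor `k / (k + 1)`; the distance on the standard
simplex is that of the maximum norm. -/
theorem affSd_mem_smallAff (w : Fin (k + 1) → Simp n) {D : ℝ} (hD : 0 ≤ D)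
    (h : ∀ i j, dist (w i) (w j) ≤ D) :
    affSd n k (of w) ∈ smallAff (range (aff w)) (k / (k + 1) * D) k := by
  induction k with
  | zero =>
    refine AddSubgroup.subset_closure ⟨w, fun i => ⟨stdSimplex.vertex i, aff_vertex _ _⟩, ?_, rfl⟩
    intro i j
    rw [show i = j from Fin.ext (by omega)]
    simp
  | succ k ih =>
    rw [affSd_of, affBd_of]
    simp only [map_sum, map_zsmul]
    refine sum_mem fun i _ => zsmul_mem ?_ _
    have h1 := ih (fun j => w (i.succAbove j)) (fun _ _ => h _ _)
    suffices H : smallAff (range (aff fun j => w (i.succAbove j))) (k / (k + 1) * D) k ≤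
      (smallAff (range (aff w)) ((k + 1 : ℕ) / ((k + 1 : ℕ) + 1) * D) (k + 1)).comap
        (cone (bary w)) from H h1
    refine (AddSubgroup.closure_le _).2 ?_
    rintro _ ⟨u, hu, hu', rfl⟩
    change cone (bary w) (of u) ∈ smallAff _ _ _
    rw [cone_of]
    have hu2 : ∀ i, u i ∈ range (aff w) := fun j => by
      obtain ⟨x, hx⟩ := hu j
      exact ⟨face i x, by rw [aff_face, hx]⟩
    have hle : (k / (k + 1) * D : ℝ) ≤ (k + 1 : ℕ) / ((k + 1 : ℕ) + 1) * D := by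
      gcongr ?_ * D
      rw [div_le_div_iff₀ (by positivity) (by positivity)]
      push_cast
      nlinarith
    have hpos : (0 : ℝ) ≤ (k + 1 : ℕ) / ((k + 1 : ℕ) + 1) * D := by positivity
    have hb : ∀ j, dist (bary w) (u j) ≤ (k + 1 : ℕ) / ((k + 1 : ℕ) + 1) * D := fun j => by
      obtain ⟨x, hx⟩ := hu2 j
      rw [← hx]
      exact dist_aff_le _ _ _ hpos (dist_bary_vertex_le w hD h)
    refine AddSubgroup.subset_closure ⟨_, ?_, ?_, rfl⟩
    · exact fun j => Fin.cases ⟨_, rfl⟩ (fun j => by simpa using hu2 j) j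
    · intro i j
      refine Fin.cases (Fin.cases ?_ (fun j => ?_) j) (fun i => Fin.cases ?_ (fun j => ?_) j) i
      · simpa using hpos
      · simpa using hb j
      · simpa [dist_comm] using hb i
      · simpa using (hu' i j).trans hle

theorem affSd_iterate_mem_smallAff (w : Fin (k + 1) → Simp n) {D : ℝ} (hD : 0 ≤ D)
    (h : ∀ i j, dist (w i) (w j) ≤ D) (m : ℕ) :
    (affSd n k)^[m] (of w) ∈ smallAff univ ((k / (k + 1) : ℝ) ^ m * D) k := by
  induction m with
  | zero => exact AddSubgroup.subset_closure ⟨w, by simp, by simpa using h, rfl⟩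
  | succ m ih =>
    rw [Function.iterate_succ_apply']
    suffices H : smallAff (univ : Set (Simp n)) ((k / (k + 1) : ℝ) ^ m * D) k ≤
      (smallAff univ ((k / (k + 1) : ℝ) ^ (m + 1) * D) k).comap (affSd n k) from H ih
    refine (AddSubgroup.closure_le _).2 ?_
    rintro _ ⟨u, -, hu, rfl⟩
    have h1 := affSd_mem_smallAff u (by positivity) hu
    rw [← mul_assoc, ← pow_succ'] at h1
    exact AddSubgroup.closure_mono (by
      rintro _ ⟨v, -, hv, rfl⟩; exact ⟨v, by simp, hv, rfl⟩) h1

end SingularChains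

end

/-! ### Small singular chains -/

noncomputable section

open CategoryTheory Simplicial AlgebraicTopology

namespace SingularChains
open FreeAbelianGroup (of lift)

variable {G : Type u} [AddCommGroup G] {E E' : Type} [TopologicalSpace E] [TopologicalSpace E']
variable {k m n : ℕ}

/-- The image of an affine chain under the singular simplex `σ`, with coefficient `a`. -/
def realize (σ : C(Simp n, E)) (a : G) : Aff k n →+ (cplx G E).X k :=
  lift fun w => gen (σ.comp (aff w)) a

theorem realize_of (σ : C(Simp n, E)) (a : G) (w : Fin (k + 1) → Simp n) :
    realize σ a (of w) = gen (σ.comp (aff w)) a := by simp [realize]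

theorem bd_realize (σ : C(Simp n, E)) (a : G) (c : Aff (k + 1) n) :
    bd G E k (realize σ a c) = realize σ a (affBd k n c) := by
  suffices h : (bd G E k).comp (realize σ a) = (realize σ a).comp (affBd k n) from congr($h c)
  refine FreeAbelianGroup.lift_ext _ _ fun w => ?_
  simp only [AddMonoidHom.comp_apply, realize_of, bd_gen, affBd_of, map_sum, map_zsmul]
  refine Finset.sum_congr rfl fun i _ => ?_
  congr 3
  ext x
  exact congrArg σ (aff_face w i x)

theorem realize_comp (σ : C(Simp n, E)) (u : Fin (m + 1) → Simp n) (a : G) (c : Aff k m) :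
    realize (σ.comp (aff u)) a c = realize σ a (affMap u k c) := by
  suffices h : realize (σ.comp (aff u)) a = (realize σ a).comp (affMap u k) from congr($h c)
  refine FreeAbelianGroup.lift_ext _ _ fun w => ?_
  simp only [AddMonoidHom.comp_apply, realize_of, affMap_of]
  refine congrArg (fun τ => gen τ a) (ContinuousMap.ext fun x => ?_)
  exact congrArg σ (aff_aff u w x).symm

/-- The identity of the standard simplex as an affine chain. -/
def idSimp (n : ℕ) : Aff n n := of fun i => stdSimplex.vertex i

theorem realize_idSimp (σ : C(Simp n, E)) (a : G) : realize σ a (idSimp n) = gen σ a := by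
  rw [idSimp, realize_of, aff_vertices, ContinuousMap.comp_id]

theorem affMap_idSimp (u : Fin (m + 1) → Simp n) : affMap u m (idSimp m) = of u := by
  rw [idSimp, affMap_of]
  simp only [aff_vertex]

theorem realize_mem_chainsIn {A : Set E} {σ : C(Simp n, E)} (h : range σ ⊆ A) (a : G)
    (c : Aff k n) :
    realize σ a c ∈ chainsIn G A k := by
  induction c using FreeAbelianGroup.induction_on with
  | zero => simp
  | of w =>
    rw [realize_of]
    refine gen_mem_chainsIn ?_ a
    rintro _ ⟨x, rfl⟩
    exact h ⟨_, rfl⟩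
  | neg w hw => rw [map_neg]; exact neg_mem hw
  | add x y hx hy => rw [map_add]; exact add_mem hx hy

/-- `realize` as a homomorphism in the coefficient. -/
def realizeHom (σ : C(Simp n, E)) (c : Aff k n) : G →+ (cplx G E).X k where
  toFun a := realize σ a c
  map_zero' := by
    suffices h : realize σ (0 : G) = (0 : Aff k n →+ (cplx G E).X k) from congr($h c)
    exact FreeAbelianGroup.lift_ext _ _ fun w => by simp [realize_of]
  map_add' a b := by
    suffices h : realize σ (a + b) = (realize σ a + realize σ b : Aff k n →+ (cplx G E).X k) from
      congr($h c)
    exact FreeAbelianGroup.lift_ext _ _ fun w => by simp [realize_of]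

/-- The natural operation on singular chains which sends a simplex `σ` to the image under `σ` of a
fixed affine chain. -/
def naturalOp (G : Type u) [AddCommGroup G] (E : Type) [TopologicalSpace E] (c : Aff k n) :
    (cplx G E).X n →+ (cplx G E).X k :=
  (exists_lift fun σ : C(Simp n, E) => realizeHom (G := G) σ c).choose

theorem naturalOp_gen (c : Aff k n) (σ : C(Simp n, E)) (a : G) :
    naturalOp G E c (gen σ a) = realize σ a c :=
  (exists_lift fun σ : C(Simp n, E) => realizeHom (G := G) σ c).choose_spec σ a

theorem naturalOp_mem_chainsIn {A : Set E} (c : Aff k n) {x : (cplx G E).X n}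
    (hx : x ∈ chainsIn G A n) : naturalOp G E c x ∈ chainsIn G A k := by
  refine chainsIn_le (H := (chainsIn G A k).comap (naturalOp G E c)) (fun σ hσ a => ?_) hx
  rw [AddSubgroup.mem_comap, naturalOp_gen]
  exact realize_mem_chainsIn hσ a c

/-- The barycentric subdivision of singular chains. -/
def sd (G : Type u) [AddCommGroup G] (E : Type) [TopologicalSpace E] (k : ℕ) :
    (cplx G E).X k →+ (cplx G E).X k := naturalOp G E (affSd k k (idSimp k))

/-- The chain homotopy between the identity and barycentric subdivision. -/
def sdh (G : Type u) [AddCommGroup G] (E : Type) [TopologicalSpace E] (k : ℕ) :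
    (cplx G E).X k →+ (cplx G E).X (k + 1) := naturalOp G E (affSdh k k (idSimp k))

theorem sd_realize (σ : C(Simp n, E)) (a : G) (c : Aff k n) :
    sd G E k (realize σ a c) = realize σ a (affSd n k c) := by
  suffices h : (sd G E k).comp (realize σ a) = (realize σ a).comp (affSd n k) from congr($h c)
  refine FreeAbelianGroup.lift_ext _ _ fun w => ?_
  simp only [AddMonoidHom.comp_apply]
  rw [realize_of, sd, naturalOp_gen, realize_comp, affMap_affSd, affMap_idSimp]

theorem sdh_realize (σ : C(Simp n, E)) (a : G) (c : Aff k n) :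
    sdh G E k (realize σ a c) = realize σ a (affSdh n k c) := by
  suffices h : (sdh G E k).comp (realize σ a) = (realize σ a).comp (affSdh n k) from congr($h c)
  refine FreeAbelianGroup.lift_ext _ _ fun w => ?_
  simp only [AddMonoidHom.comp_apply]
  rw [realize_of, sdh, naturalOp_gen, realize_comp, affMap_affSdh, affMap_idSimp]

theorem bd_sdh (c : (cplx G E).X (k + 1)) :
    bd G E (k + 1) (sdh G E (k + 1) c) + sdh G E k (bd G E k c) = c - sd G E (k + 1) c := by
  suffices h : (bd G E (k + 1)).comp (sdh G E (k + 1)) + (sdh G E k).comp (bd G E k) =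
    AddMonoidHom.id _ - sd G E (k + 1) from congr($h c)
  refine hom_ext fun σ a => ?_
  simp only [AddMonoidHom.add_apply, AddMonoidHom.comp_apply, AddMonoidHom.sub_apply,
    AddMonoidHom.id_apply]
  rw [← realize_idSimp σ a, bd_realize, sdh_realize, sdh_realize, sd_realize, bd_realize,
    ← map_add, affBd_affSdh, map_sub]

theorem sd_zero (c : (cplx G E).X 0) : sd G E 0 c = c := by
  suffices h : sd G E 0 = AddMonoidHom.id _ from congr($h c)
  refine hom_ext fun σ a => ?_
  rw [← realize_idSimp σ a, sd_realize]
  rfl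

theorem sdh_zero (c : (cplx G E).X 0) : sdh G E 0 c = 0 := by
  suffices h : sdh G E 0 = 0 from congr($h c)
  refine hom_ext fun σ a => ?_
  rw [← realize_idSimp σ a, sdh_realize]
  simp [affSdh]

theorem bd_sd (c : (cplx G E).X (k + 1)) : bd G E k (sd G E (k + 1) c) = sd G E k (bd G E k c) := by
  have h1 := congrArg (bd G E k) (bd_sdh c)
  rw [map_add, bd_bd, zero_add, map_sub] at h1
  have h2 : bd G E k (sdh G E k (bd G E k c)) = bd G E k c - sd G E k (bd G E k c) := by
    cases k with
    | zero => rw [sdh_zero, map_zero, sd_zero, sub_self]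
    | succ k =>
      have := bd_sdh (bd G E (k + 1) c)
      rwa [bd_bd, map_zero, add_zero] at this
  rw [h2] at h1
  exact (sub_right_injective h1).symm

theorem bd_sd_iterate (m : ℕ) (c : (cplx G E).X (k + 1)) :
    bd G E k ((sd G E (k + 1))^[m] c) = (sd G E k)^[m] (bd G E k c) := by
  induction m with
  | zero => rfl
  | succ m ih => rw [Function.iterate_succ_apply', bd_sd, ih, Function.iterate_succ_apply']

theorem sd_mem_chainsIn {A : Set E} {c : (cplx G E).X k} (hc : c ∈ chainsIn G A k) :
    sd G E k c ∈ chainsIn G A k := naturalOp_mem_chainsIn _ hc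

theorem sd_iterate_mem_chainsIn {A : Set E} (m : ℕ) {c : (cplx G E).X k} (hc : c ∈ chainsIn G A k) :
    (sd G E k)^[m] c ∈ chainsIn G A k := by
  induction m with
  | zero => exact hc
  | succ m ih => rw [Function.iterate_succ_apply']; exact sd_mem_chainsIn ih

/-- The chain `z` is a cycle. In degree `0` this is no condition. -/
def IsCycle (z : (cplx G E).X k) : Prop := ∀ j, (cplx G E).d k j z = 0

theorem isCycle_succ {z : (cplx G E).X (k + 1)} : IsCycle z ↔ bd G E k z = 0 := by
  refine ⟨fun h => h k, fun h j => ?_⟩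
  by_cases hj : j = k
  · subst hj; exact h
  · rw [(cplx G E).shape (k + 1) j (by simpa using fun h => hj h)]
    rfl

theorem isCycle_bd (c : (cplx G E).X (k + 1)) : IsCycle (bd G E k c) := fun j =>
  congr($((cplx G E).d_comp_d (k + 1) k j).hom c)

/-- A cycle is homologous to its subdivisions, inside any set which carries it. -/
theorem exists_bd_eq_sub_sd_iterate {A : Set E} {z : (cplx G E).X k} (hz : z ∈ chainsIn G A k)
    (hc : IsCycle z) (m : ℕ) : ∃ y ∈ chainsIn G A (k + 1), bd G E k y = z - (sd G E k)^[m] z := by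
  have h1 : ∃ y ∈ chainsIn G A (k + 1), bd G E k y = z - sd G E k z := by
    cases k with
    | zero => exact ⟨0, zero_mem _, by rw [sd_zero, sub_self, map_zero]⟩
    | succ k =>
      refine ⟨sdh G E (k + 1) z, naturalOp_mem_chainsIn _ hz, ?_⟩
      have := bd_sdh z
      rwa [isCycle_succ.1 hc, map_zero, add_zero] at this
  obtain ⟨y₁, hy₁, e₁⟩ := h1
  induction m with
  | zero => exact ⟨0, zero_mem _, by simp⟩
  | succ m ih =>
    obtain ⟨y, hy, e⟩ := ih
    refine ⟨y₁ + sd G E (k + 1) y, add_mem hy₁ (sd_mem_chainsIn hy), ?_⟩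
    rw [map_add, bd_sd, e₁, e, map_sub, Function.iterate_succ_apply']
    abel

/-- Affine simplices smaller than a Lebesgue number are carried by one of the two sets. -/
theorem realize_mem_sup {P Q : Set E} {σ : C(Simp n, E)} {δ D : ℝ} (hD : D < δ) (hδ : 0 < δ)
    (h : ∀ x, Metric.ball x δ ⊆ σ ⁻¹' P ∨ Metric.ball x δ ⊆ σ ⁻¹' Q) (a : G) {c : Aff k n}
    (hc : c ∈ smallAff univ D k) : realize σ a c ∈ chainsIn G P k ⊔ chainsIn G Q k := by
  suffices H : smallAff univ D k ≤ (chainsIn G P k ⊔ chainsIn G Q k).comap (realize σ a) from H hc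
  refine (AddSubgroup.closure_le _).2 ?_
  rintro _ ⟨u, -, hu, rfl⟩
  change realize σ a (of u) ∈ chainsIn G P k ⊔ chainsIn G Q k
  rw [realize_of]
  have hr : ∀ x, aff u x ∈ Metric.ball (u 0) δ := fun x => by
    rw [Metric.mem_ball, dist_comm]
    refine (dist_aff_le u x (u 0) (D := max D 0) (le_max_right _ _)
      fun i => (hu 0 i).trans (le_max_left _ _)).trans_lt (max_lt hD hδ)
  rcases h (u 0) with h | h
  · exact AddSubgroup.mem_sup_left (gen_mem_chainsIn (by rintro _ ⟨x, rfl⟩; exact h (hr x)) a)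
  · exact AddSubgroup.mem_sup_right (gen_mem_chainsIn (by rintro _ ⟨x, rfl⟩; exact h (hr x)) a)

/-- The set `P` is relatively open in `P ∪ Q`. -/
def RelOpen (P Q : Set E) : Prop := ∃ O : Set E, IsOpen O ∧ P = O ∩ (P ∪ Q)

theorem RelOpen.isOpen_preimage {P Q : Set E} (h : RelOpen P Q) {σ : C(Simp n, E)}
    (hσ : range σ ⊆ P ∪ Q) : IsOpen (σ ⁻¹' P) := by
  obtain ⟨O, hO, e⟩ := h
  have : σ ⁻¹' P = σ ⁻¹' O := by
    ext x
    constructor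
    · intro hx
      have : σ x ∈ P := hx
      rw [e] at this
      exact this.1
    · intro hx
      change σ x ∈ P
      rw [e]
      exact ⟨hx, hσ ⟨x, rfl⟩⟩
  rw [this]
  exact hO.preimage σ.continuous

/-- The theorem of small chains: after enough subdivisions, a chain of `P ∪ Q` is the sum of a
chain of `P` and a chain of `Q`. -/
theorem exists_sd_iterate_mem {P Q : Set E} (hP : RelOpen P Q) (hQ : RelOpen Q P)
    {c : (cplx G E).X n} (hc : c ∈ chainsIn G (P ∪ Q) n) :
    ∃ m, (sd G E n)^[m] c ∈ chainsIn G P n ⊔ chainsIn G Q n := by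
  have mono : ∀ (c : (cplx G E).X n) (m m' : ℕ), m ≤ m' →
      (sd G E n)^[m] c ∈ chainsIn G P n ⊔ chainsIn G Q n →
      (sd G E n)^[m'] c ∈ chainsIn G P n ⊔ chainsIn G Q n := by
    intro c m m' hm h
    induction hm with
    | refl => exact h
    | step _ ih =>
      rw [Function.iterate_succ_apply']
      obtain ⟨p, hp, q, hq, e⟩ := AddSubgroup.mem_sup.1 ih
      rw [← e, map_add]
      exact AddSubgroup.add_mem_sup (sd_mem_chainsIn hp) (sd_mem_chainsIn hq)
  induction hc using AddSubgroup.closure_induction with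
  | zero => exact ⟨0, zero_mem _⟩
  | add x y _ _ hx hy =>
    obtain ⟨m, hm⟩ := hx
    obtain ⟨m', hm'⟩ := hy
    refine ⟨max m m', ?_⟩
    rw [iterate_map_add]
    exact add_mem (mono _ _ _ (le_max_left _ _) hm) (mono _ _ _ (le_max_right _ _) hm')
  | neg x _ hx =>
    obtain ⟨m, hm⟩ := hx
    exact ⟨m, by rw [iterate_map_neg]; exact neg_mem hm⟩
  | mem x hx =>
    obtain ⟨σ, a, hσ, rfl⟩ := hx
    have hQσ : range σ ⊆ Q ∪ P := by rwa [union_comm]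
    obtain ⟨δ, hδ, hb⟩ := lebesgue_number_lemma_of_metric (s := (univ : Set (Simp n)))
      (c := fun b : Bool => if b then σ ⁻¹' P else σ ⁻¹' Q) isCompact_univ
      (by rintro (_ | _)
          · exact hQ.isOpen_preimage hQσ
          · exact hP.isOpen_preimage hσ)
      (by intro x _
          rcases hσ ⟨x, rfl⟩ with h | h
          · exact mem_iUnion.2 ⟨true, h⟩
          · exact mem_iUnion.2 ⟨false, h⟩)
    obtain ⟨m, hm⟩ := exists_pow_lt_of_lt_one hδ
      (show (n / (n + 1) : ℝ) < 1 by rw [div_lt_one (by positivity)]; linarith)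
    refine ⟨m, ?_⟩
    have e : ∀ m, (sd G E n)^[m] (gen σ a) = realize σ a ((affSd n n)^[m] (idSimp n)) := by
      intro m
      induction m with
      | zero => rw [← realize_idSimp]; rfl
      | succ m ih => rw [Function.iterate_succ_apply', ih, sd_realize, Function.iterate_succ_apply']
    rw [e]
    refine realize_mem_sup (δ := δ) (D := (n / (n + 1) : ℝ) ^ m * 1) (by linarith) hδ ?_ a
      (affSd_iterate_mem_smallAff _ zero_le_one ?_ m)
    · intro x
      obtain ⟨b, hb⟩ := hb x trivial
      cases b
      · exact Or.inr hb
      · exact Or.inl hb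
    · intro i j
      rw [dist_le_iff zero_le_one]
      intro c
      have h1 := stdSimplex.zero_le (stdSimplex.vertex (S := ℝ) i) c
      have h2 := stdSimplex.zero_le (stdSimplex.vertex (S := ℝ) j) c
      have h3 := stdSimplex.le_one (stdSimplex.vertex (S := ℝ) i) c
      have h4 := stdSimplex.le_one (stdSimplex.vertex (S := ℝ) j) c
      rw [abs_le]
      constructor <;> linarith

end SingularChains

end

/-! ### Reduced homology and the Mayer–Vietoris isomorphism -/

noncomputable section

open CategoryTheory Simplicial AlgebraicTopology

namespace SingularChains

variable {G : Type u} [AddCommGroup G] {k m n : ℕ}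

/-- The map to a one-point space. -/
def toPt (A : TopCat.{0}) : A ⟶ TopCat.of PUnit.{1} :=
  TopCat.ofHom ⟨fun _ => PUnit.unit, continuous_const⟩

variable (G k) in
/-- The map `f` is not zero on reduced homology in degree `k`. -/
def ReducedNonzero {A B : TopCat.{0}} (f : A ⟶ B) : Prop :=
  ∃ α : singularHomologyGroup G k A,
    singularHomologyMap G k (toPt A) α = 0 ∧ singularHomologyMap G k f α ≠ 0

theorem homologyMap_comp {A B C : TopCat.{0}} (f : A ⟶ B) (g : B ⟶ C)
    (α : singularHomologyGroup G k A) :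
    singularHomologyMap G k (f ≫ g) α = singularHomologyMap G k g (singularHomologyMap G k f α) :=
  congr($(((singularHomologyFunctor AddCommGrpCat.{u} k).obj
    (AddCommGrpCat.of G)).map_comp f g).hom α)

theorem homologyMap_id {A : TopCat.{0}} (α : singularHomologyGroup G k A) :
    singularHomologyMap G k (𝟙 A) α = α :=
  congr($(((singularHomologyFunctor AddCommGrpCat.{u} k).obj (AddCommGrpCat.of G)).map_id A).hom α)

theorem homologyMap_congr {A B : TopCat.{0}} {f g : A ⟶ B}
    (h : ContinuousMap.Homotopic f.hom g.hom) :
    singularHomologyMap G k f = singularHomologyMap G k g :=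
  TopCat.Homotopy.congr_homologyMap_singularChainComplexFunctor (f := f) (g := g) h.some
    (AddCommGrpCat.of G) k

/-- Up to homotopy, `f'` restricts along `u` to `v ∘ f`, where `v` has a left homotopy inverse. -/
theorem ReducedNonzero.map {A B A' B' : TopCat.{0}} {f : A ⟶ B} {f' : A' ⟶ B'} (u : A ⟶ A')
    (v : B ⟶ B') (r : B' ⟶ B) (hv : ContinuousMap.Homotopic (v ≫ r).hom (𝟙 B : B ⟶ B).hom)
    (h : ContinuousMap.Homotopic (u ≫ f').hom (f ≫ v).hom) (hf : ReducedNonzero G k f) :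
    ReducedNonzero G k f' := by
  obtain ⟨α, h0, h1⟩ := hf
  refine ⟨singularHomologyMap G k u α, ?_, fun h2 => h1 ?_⟩
  · rw [← homologyMap_comp]
    exact h0
  · rw [← homologyMap_comp, homologyMap_congr h, homologyMap_comp] at h2
    rw [← homologyMap_id (singularHomologyMap G k f α), ← homologyMap_congr hv, homologyMap_comp,
      h2, map_zero]

theorem ReducedNonzero.of_comp {A B B' : TopCat.{0}} {f : A ⟶ B} {g : B ⟶ B'}
    (h : ReducedNonzero G k (f ≫ g)) : ReducedNonzero G k f := by
  obtain ⟨α, h0, h1⟩ := h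
  refine ⟨α, h0, fun h2 => h1 ?_⟩
  rw [homologyMap_comp, h2, map_zero]

theorem not_reducedNonzero_of_contractible {A B : TopCat.{0}} (hA : ContractibleSpace A)
    (f : A ⟶ B) : ¬ ReducedNonzero G k f := by
  rintro ⟨α, h0, h1⟩
  apply h1
  obtain ⟨p, hp⟩ := id_nullhomotopic A
  have h2 : ContinuousMap.Homotopic (𝟙 A : A ⟶ A).hom
      (toPt A ≫ TopCat.ofHom (ContinuousMap.const _ p) : A ⟶ A).hom := hp
  rw [← homologyMap_id α, homologyMap_congr h2, homologyMap_comp, h0]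
  simp

variable {E : Type} [TopologicalSpace E]

/-- The inclusion of sets as a morphism of topological spaces. -/
def setIncl {A B : Set E} (h : A ⊆ B) : TopCat.of A ⟶ TopCat.of B :=
  TopCat.ofHom ⟨Set.inclusion h, continuous_inclusion h⟩

/-- The class of the cycle `z` is reduced: the image of `z` in a point is a boundary. -/
def AugZero (z : (cplx G E).X k) : Prop :=
  ∃ y, bd G PUnit.{1} k y = push (toPt (TopCat.of E)).hom k z

theorem IsCycle.push {E' : Type} [TopologicalSpace E'] (f : C(E, E'))
    {z : (cplx G E).X k} (hz : IsCycle z) : IsCycle (push f k z) := fun j => by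
  have h1 : (cplx G E').d k j (SingularChains.push f k z) =
      SingularChains.push f j ((cplx G E).d k j z) :=
    congr($((((singularChainComplexFunctor AddCommGrpCat.{u}).obj (AddCommGrpCat.of G)).map
      (TopCat.ofHom f)).comm k j).hom z)
  rw [h1, hz j, map_zero]

theorem isCycle_of_push_incl {A : Set E} {z : (cplx G A).X k}
    (h : IsCycle (push (incl A) k z)) : IsCycle z := fun j => by
  apply push_incl_injective A
  have h1 : (cplx G E).d k j (SingularChains.push (incl A) k z) =
      SingularChains.push (incl A) j ((cplx G A).d k j z) :=
    congr($((((singularChainComplexFunctor AddCommGrpCat.{u}).obj (AddCommGrpCat.of G)).map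
      (TopCat.ofHom (incl A))).comm k j).hom z)
  rw [← h1, h j, map_zero]

theorem augZero_push {E' : Type} [TopologicalSpace E'] (f : C(E, E')) {z : (cplx G E).X k} :
    AugZero (push f k z) ↔ AugZero z := by
  unfold AugZero
  rw [← push_comp]
  rfl

/-- For the inclusion of two subsets of `E`, all chains may be taken in `E`. -/
theorem reducedNonzero_iff {A B : Set E} (h : A ⊆ B) : ReducedNonzero G k (setIncl h) ↔
    ∃ z ∈ chainsIn G A k, IsCycle z ∧ AugZero z ∧ ∀ y ∈ chainsIn G B (k + 1), bd G E k y ≠ z := by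
  have hcomp : ∀ w : (cplx G A).X k,
      push (incl B) k (push (setIncl h).hom k w) = push (incl A) k w := fun w =>
    (push_comp (setIncl h).hom (incl B) w).symm
  have key : ∀ (w : (cplx G A).X k) (α : singularHomologyGroup G k (TopCat.of A)), Represents w α →
      ((singularHomologyMap G k (toPt (TopCat.of A)) α = 0 ↔ AugZero (push (incl A) k w)) ∧
      (singularHomologyMap G k (setIncl h) α = 0 ↔
        ∃ y ∈ chainsIn G B (k + 1), bd G E k y = push (incl A) k w)) := by
    intro w α hw
    refine ⟨?_, ?_⟩
    · rw [augZero_push]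
      exact (hw.map (((singularChainComplexFunctor AddCommGrpCat.{u}).obj
        (AddCommGrpCat.of G)).map (toPt (TopCat.of A)))).eq_zero_iff
    · refine (hw.map (((singularChainComplexFunctor AddCommGrpCat.{u}).obj
        (AddCommGrpCat.of G)).map (setIncl h))).eq_zero_iff.trans ?_
      constructor
      · rintro ⟨y, hy⟩
        refine ⟨push (incl B) (k + 1) y, mem_chainsIn_iff.2 ⟨y, rfl⟩, ?_⟩
        rw [← push_bd, ← hcomp]
        exact congrArg _ hy
      · rintro ⟨y, hy, e⟩
        obtain ⟨y, rfl⟩ := mem_chainsIn_iff.1 hy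
        refine ⟨y, push_incl_injective B ?_⟩
        rw [← push_bd, ← hcomp] at e
        exact e
  constructor
  · rintro ⟨α, h0, h1⟩
    obtain ⟨w, hw⟩ := Represents.exists_cycle (K := cplx G A) α
    refine ⟨push (incl A) k w, mem_chainsIn_iff.2 ⟨w, rfl⟩,
      IsCycle.push _ (fun j => hw.d_eq_zero j), (key w α hw).1.1 h0, fun y hy e => ?_⟩
    exact h1 ((key w α hw).2.2 ⟨y, hy, e⟩)
  · rintro ⟨z, hz, hc, ha, hb⟩
    obtain ⟨w, rfl⟩ := mem_chainsIn_iff.1 hz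
    obtain ⟨α, hα⟩ := Represents.exists_class (K := cplx G A) (isCycle_of_push_incl hc)
    refine ⟨α, (key w α hα).1.2 ha, fun h0 => ?_⟩
    obtain ⟨y, hy, e⟩ := (key w α hα).2.1 h0
    exact hb y hy e

theorem exists_bd_eq_of_contractible {A : Set E} (hA : ContractibleSpace A) {z : (cplx G E).X k}
    (hz : z ∈ chainsIn G A k) (hc : IsCycle z) (ha : AugZero z) :
    ∃ y ∈ chainsIn G A (k + 1), bd G E k y = z := by
  by_contra! H
  exact not_reducedNonzero_of_contractible hA _
    ((reducedNonzero_iff (Subset.refl A)).2 ⟨z, hz, hc, ha, H⟩)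

/-- In positive degrees every cycle has a reduced class. -/
theorem augZero_succ {z : (cplx G E).X (k + 1)} (hc : IsCycle z) : AugZero z := by
  obtain ⟨α, hα⟩ := Represents.exists_class (K := cplx G PUnit.{1})
    (IsCycle.push (toPt (TopCat.of E)).hom hc)
  refine hα.eq_zero_iff.1 ?_
  have := isZero_singularHomologyFunctor_of_totallyDisconnectedSpace AddCommGrpCat.{u} (k + 1)
    (AddCommGrpCat.of G) (TopCat.of PUnit.{1}) (by omega)
  have h2 := (AddCommGrpCat.subsingleton_of_isZero this)
  exact h2.elim _ _

theorem augZero_bd (c : (cplx G E).X (k + 1)) : AugZero (bd G E k c) :=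
  ⟨push (toPt (TopCat.of E)).hom (k + 1) c, by rw [push_bd]⟩

/-- Chain level form of the naturality of the Mayer–Vietoris isomorphism
`H̃_{k+1}(P ∪ Q) ≃ H̃_k(P ∩ Q)` for contractible `P` and `Q`. -/
theorem reducedNonzero_union_iff {P Q P' Q' : Set E} (hP : P' ⊆ P) (hQ : Q' ⊆ Q)
    (oP : RelOpen P Q) (oQ : RelOpen Q P) (oP' : RelOpen P' Q') (oQ' : RelOpen Q' P')
    (cP : ContractibleSpace P) (cQ : ContractibleSpace Q) (cP' : ContractibleSpace P')
    (cQ' : ContractibleSpace Q') :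
    ReducedNonzero G k (setIncl (inter_subset_inter hP hQ)) ↔
      ReducedNonzero G (k + 1) (setIncl (union_subset_union hP hQ)) := by
  rw [reducedNonzero_iff, reducedNonzero_iff]
  constructor
  · rintro ⟨z, hz, hc, ha, hb⟩
    obtain ⟨p, hp, ep⟩ := exists_bd_eq_of_contractible cP'
      (chainsIn_mono inter_subset_left hz) hc ha
    obtain ⟨q, hq, eq⟩ := exists_bd_eq_of_contractible cQ'
      (chainsIn_mono inter_subset_right hz) hc ha
    have hcyc : IsCycle (p - q) := isCycle_succ.2 (by rw [map_sub, ep, eq, sub_self])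
    refine ⟨p - q, sub_mem (chainsIn_mono subset_union_left hp)
      (chainsIn_mono subset_union_right hq),
      hcyc, augZero_succ hcyc, fun y hy e => ?_⟩
    obtain ⟨m, hm⟩ := exists_sd_iterate_mem oP oQ hy
    obtain ⟨y₁, hy₁, y₂, hy₂, ey⟩ := AddSubgroup.mem_sup.1 hm
    have e1 : bd G E (k + 1) y₁ + bd G E (k + 1) y₂ =
        (sd G E (k + 1))^[m] p - (sd G E (k + 1))^[m] q := by
      rw [← map_add, ey, bd_sd_iterate, e, iterate_map_sub]
    -- the common value is a chain of `P ∩ Q` bounding the subdivision of `z`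
    have hx : (sd G E (k + 1))^[m] p - bd G E (k + 1) y₁ ∈ chainsIn G (P ∩ Q) (k + 1) := by
      have hx₁ : (sd G E (k + 1))^[m] p - bd G E (k + 1) y₁ ∈ chainsIn G P (k + 1) :=
        sub_mem (sd_iterate_mem_chainsIn m (chainsIn_mono hP hp)) (bd_mem_chainsIn hy₁)
      refine chainsIn_inf_le ⟨hx₁, ?_⟩
      have : (sd G E (k + 1))^[m] p - bd G E (k + 1) y₁ =
          (sd G E (k + 1))^[m] q + bd G E (k + 1) y₂ := by
        rw [sub_eq_iff_eq_add, add_assoc, add_comm (bd G E (k + 1) y₂), e1]; abel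
      change _ ∈ chainsIn G Q (k + 1)
      rw [this]
      exact add_mem (sd_iterate_mem_chainsIn m (chainsIn_mono hQ hq)) (bd_mem_chainsIn hy₂)
    obtain ⟨t, ht, et⟩ := exists_bd_eq_sub_sd_iterate
      (chainsIn_mono (inter_subset_inter hP hQ) hz) hc m
    refine hb (t + _) (add_mem ht hx) ?_
    rw [map_add, map_sub, bd_bd, sub_zero, bd_sd_iterate, ep, et]
    abel
  · rintro ⟨z, hz, hc, -, hb⟩
    obtain ⟨m, hm⟩ := exists_sd_iterate_mem oP' oQ' hz
    obtain ⟨p, hp, q, hq, e⟩ := AddSubgroup.mem_sup.1 hm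
    have e0 : bd G E k p + bd G E k q = 0 := by
      rw [← map_add, e, bd_sd_iterate, isCycle_succ.1 hc]
      clear e hm hc hb hz hp hq
      induction m with
      | zero => rfl
      | succ m ih => rw [Function.iterate_succ_apply', ih, map_zero]
    refine ⟨bd G E k p, chainsIn_inf_le ⟨bd_mem_chainsIn hp, ?_⟩, isCycle_bd p, augZero_bd p,
      fun y hy ey => ?_⟩
    · change _ ∈ chainsIn G Q' k
      rw [eq_neg_of_add_eq_zero_left e0]
      exact neg_mem (bd_mem_chainsIn hq)
    have c1 : IsCycle (p - y) := isCycle_succ.2 (by rw [map_sub, ey, sub_self])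
    have c2 : IsCycle (q + y) := isCycle_succ.2 (by rw [map_add, ey, add_comm, e0])
    obtain ⟨y₁, hy₁, e₁⟩ := exists_bd_eq_of_contractible cP
      (sub_mem (chainsIn_mono hP hp) (chainsIn_mono inter_subset_left hy)) c1 (augZero_succ c1)
    obtain ⟨y₂, hy₂, e₂⟩ := exists_bd_eq_of_contractible cQ
      (add_mem (chainsIn_mono hQ hq) (chainsIn_mono inter_subset_right hy)) c2 (augZero_succ c2)
    obtain ⟨t, ht, et⟩ := exists_bd_eq_sub_sd_iterate
      (chainsIn_mono (union_subset_union hP hQ) hz) hc m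
    refine hb (t + (y₁ + y₂)) (add_mem ht (add_mem (chainsIn_mono subset_union_left hy₁)
      (chainsIn_mono subset_union_right hy₂))) ?_
    rw [map_add, map_add, e₁, e₂, et, ← e]
    abel

end SingularChains

end

/-! ### Hyperplanes, and two contractible sets -/

noncomputable section

open CategoryTheory Simplicial AlgebraicTopology

open SingularChains

/-- The isometric embedding `ι` identifies `V` with the hyperplane of `W` orthogonal to the unit
vector `e`, and `P` is the orthogonal projection. -/
structure IsHyperplane {V W : Type} [NormedAddCommGroup V] [InnerProductSpace ℝ V]
    [NormedAddCommGroup W] [InnerProductSpace ℝ W] (ι : V →ₗᵢ[ℝ] W) (P : W →L[ℝ] V) (e : W) :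
    Prop where
  proj : ∀ x, P (ι x) = x
  proj_normal : P e = 0
  norm_normal : ‖e‖ = 1
  orth : ∀ x, inner ℝ e (ι x) = 0
  decomp : ∀ z, z = ι (P z) + inner ℝ e z • e

section
variable {V W : Type} [NormedAddCommGroup V] [InnerProductSpace ℝ V]
    [NormedAddCommGroup W] [InnerProductSpace ℝ W] {ι : V →ₗᵢ[ℝ] W} {P : W →L[ℝ] V} {e : W}

theorem homotopic_of_segment {X : Type} [TopologicalSpace X] {B : Set V} (f g : C(X, B))
    (h : ∀ x, ∀ t ∈ Icc (0 : ℝ) 1, (1 - t) • (f x : V) + t • (g x : V) ∈ B) : f.Homotopic g :=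
  ⟨{ toFun := fun p => ⟨(1 - (p.1 : ℝ)) • (f p.2 : V) + (p.1 : ℝ) • (g p.2 : V), h p.2 _ p.1.2⟩
     continuous_toFun := by fun_prop
     map_zero_left := fun x => by ext; simp
     map_one_left := fun x => by ext; simp }⟩

namespace IsHyperplane

theorem neg (h : IsHyperplane ι P e) : IsHyperplane ι P (-e) where
  proj := h.proj
  proj_normal := by rw [map_neg, h.proj_normal, neg_zero]
  norm_normal := by rw [norm_neg, h.norm_normal]
  orth x := by rw [inner_neg_left, h.orth, neg_zero]
  decomp z := by rw [inner_neg_left, neg_smul_neg]; exact h.decomp z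

theorem inner_self (h : IsHyperplane ι P e) : inner ℝ e e = 1 := by
  rw [real_inner_self_eq_norm_sq, h.norm_normal, one_pow]

theorem norm_sq (h : IsHyperplane ι P e) (z : W) : ‖z‖ ^ 2 = ‖P z‖ ^ 2 + inner ℝ e z ^ 2 := by
  conv_lhs => rw [h.decomp z]
  rw [norm_add_sq_real, inner_smul_right, real_inner_comm e (ι (P z)), h.orth, norm_smul,
    h.norm_normal, ι.norm_map]
  simp

/-- The region above the graph of `τ`, together with the cylinder over `Ω`. -/
def upper (P : W →L[ℝ] V) (e : W) (Ω : Set V) (τ : V → ℝ) : Set W :=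
  {z | P z ∈ Ω ∨ τ (P z) < inner ℝ e z}

theorem isOpen_upper {Ω : Set V} {τ : V → ℝ} (hΩ : IsOpen Ω) (hτ : Continuous τ) :
    IsOpen (upper P e Ω τ) :=
  (hΩ.preimage P.continuous).union (isOpen_lt (hτ.comp P.continuous) (by fun_prop))

/-- The set moves up into the half space above the height `M`, which is convex. -/
theorem contractible_upper (h : IsHyperplane ι P e) {Ω : Set V} {τ : V → ℝ} {M : ℝ}
    (hM : ∀ x, τ x ≤ M) : ContractibleSpace (upper P e Ω τ) := by
  rw [contractible_iff_id_nullhomotopic]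
  have key : ∀ (z : W) (t : ℝ), inner ℝ e (z + t • e) = inner ℝ e z + t := fun z t => by
    rw [inner_add_right, inner_smul_right, h.inner_self, mul_one]
  have hP : ∀ (z : W) (t : ℝ), P (z + t • e) = P z := fun z t => by
    rw [map_add, map_smul, h.proj_normal, smul_zero, add_zero]
  -- push everything above the height `M`, then contract the half space above `M`
  have hup : ∀ (z : W), M < inner ℝ e (z + (|M| + |inner ℝ e z| + 1) • e) := fun z => by
    rw [key]
    have := neg_abs_le (inner ℝ e z)
    have := le_abs_self M
    linarith
  have hmem : ∀ z : W, M < inner ℝ e z → z ∈ upper P e Ω τ := fun z hz =>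
    Or.inr ((hM _).trans_lt hz)
  let f : C(upper P e Ω τ, upper P e Ω τ) :=
    ⟨fun z => ⟨(z : W) + (|M| + |inner ℝ e (z : W)| + 1) • e, hmem _ (hup _)⟩, by fun_prop⟩
  have hpt : M < inner ℝ e ((M + 1) • e) := by
    rw [inner_smul_right, h.inner_self]; linarith
  refine ⟨⟨(M + 1) • e, hmem _ hpt⟩, (homotopic_of_segment (ContinuousMap.id _) f ?_).trans
    (homotopic_of_segment f _ ?_)⟩
  · intro z t ht
    have e1 : (1 - t) • (z : W) + t • (f z : W) =
        (z : W) + (t * (|M| + |inner ℝ e (z : W)| + 1)) • e := by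
      simp only [f, ContinuousMap.coe_mk]
      module
    change (1 - t) • (z : W) + t • (f z : W) ∈ _
    rw [e1]
    have hpos : 0 ≤ t * (|M| + |inner ℝ e (z : W)| + 1) := mul_nonneg ht.1 (by positivity)
    rcases z.2 with hz | hz
    · exact Or.inl (by rwa [hP])
    · refine Or.inr ?_
      rw [hP, key]
      linarith
  · intro z t ht
    refine hmem _ ?_
    rw [inner_add_right, inner_smul_right, inner_smul_right]
    have h1 : M < inner ℝ e (f z : W) := hup _
    change M < (1 - t) * inner ℝ e (f z : W) + t * inner ℝ e ((M + 1) • e)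
    rcases eq_or_lt_of_le ht.1 with rfl | h0
    · linarith
    · nlinarith [ht.2]

/-- The part at height more than `-ε` of the sphere of centre `ι c` and radius `r` in the subspace
`P ⁻¹' A`, which is spanned by `ι '' A` and the direction `e`. -/
def cap (ι : V →ₗᵢ[ℝ] W) (P : W →L[ℝ] V) (e : W) (A : AffineSubspace ℝ V) (c : V) (r ε : ℝ) :
    Set W :=
  {z | (P z ∈ A ∧ dist z (ι c) = r) ∧ -ε < inner ℝ e z}

/-- The cap contracts to its pole `ι c + r • e`, by radial projection of straight segments. -/
theorem contractible_cap (h : IsHyperplane ι P e) {A : AffineSubspace ℝ V} {c : V} (hc : c ∈ A)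
    {r ε : ℝ} (hr : 0 < r) (hε : 0 < ε) (hεr : ε ≤ r) : ContractibleSpace (cap ι P e A c r ε) := by
  rw [contractible_iff_id_nullhomotopic]
  let q : ℝ → W → W := fun s z => (1 - s) • (z - ι c) + (s * r) • e
  have hq : Continuous fun p : ℝ × W => q p.1 p.2 := by fun_prop
  have eq1 : ∀ s z, inner ℝ e (q s z) = (1 - s) * inner ℝ e z + s * r := fun s z => by
    simp only [q]
    rw [inner_add_right, inner_smul_right, inner_smul_right, h.inner_self, inner_sub_right, h.orth]
    ring
  have eq2 : ∀ s z, P (q s z) = (1 - s) • (P z - c) := fun s z => by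
    simp only [q]
    rw [map_add, map_smul, map_smul, h.proj_normal, map_sub, h.proj, smul_zero, add_zero]
  have hle : ∀ z ∈ cap ι P e A c r ε, |inner ℝ e z| ≤ r := fun z hz => by
    have := h.norm_sq (z - ι c)
    rw [← dist_eq_norm, hz.1.2, inner_sub_right, h.orth, sub_zero] at this
    exact abs_le_of_sq_le_sq (by nlinarith [sq_nonneg ‖P (z - ι c)‖]) hr.le
  have hne : ∀ z ∈ cap ι P e A c r ε, ∀ s ∈ Icc (0 : ℝ) 1, q s z ≠ 0 := by
    intro z hz s hs h0
    have h1 := eq1 s z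
    have h2 := eq2 s z
    rw [h0, inner_zero_right] at h1
    rw [h0, map_zero] at h2
    have h3 := hz.2
    have hs1 : s ≠ 1 := by rintro rfl; linarith
    have h4 : P z - c = 0 := (smul_eq_zero.1 h2.symm).resolve_left (sub_ne_zero.2 (Ne.symm hs1))
    have h5 := h.norm_sq (z - ι c)
    rw [← dist_eq_norm, hz.1.2, inner_sub_right, h.orth, sub_zero, map_sub, h.proj, h4] at h5
    simp only [norm_zero] at h5
    have h6 : inner ℝ e z = r := by
      have : (inner ℝ e z - r) * (inner ℝ e z + r) = 0 := by linarith
      rcases mul_eq_zero.1 this with h | h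
      · linarith
      · linarith
    rw [h6] at h1
    linarith
  have hmem : ∀ z ∈ cap ι P e A c r ε, ∀ s ∈ Icc (0 : ℝ) 1,
      ι c + (r / ‖q s z‖) • q s z ∈ cap ι P e A c r ε := by
    intro z hz s hs
    have hpos : 0 < ‖q s z‖ := norm_pos_iff.2 (hne z hz s hs)
    refine ⟨⟨?_, ?_⟩, ?_⟩
    · rw [map_add, h.proj, map_smul, eq2, smul_smul, add_comm]
      exact A.vadd_mem_of_mem_direction (A.direction.smul_mem _ (A.vsub_mem_direction hz.1.1 hc)) hc
    · rw [dist_eq_norm, add_sub_cancel_left, norm_smul, Real.norm_eq_abs,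
        abs_of_nonneg (by positivity)]
      field_simp
    · rw [inner_add_right, h.orth, zero_add, inner_smul_right, eq1]
      have h3 := hz.2
      have hb := hle z hz
      rcases le_or_gt 0 ((1 - s) * inner ℝ e z + s * r) with h0 | h0
      · have : 0 ≤ r / ‖q s z‖ * ((1 - s) * inner ℝ e z + s * r) := by positivity
        linarith
      · have hzneg : inner ℝ e z < 0 := by
          by_contra hcon
          have := mul_nonneg (sub_nonneg.2 hs.2) (not_lt.1 hcon)
          have := mul_nonneg hs.1 hr.le
          linarith
        have hn : (1 - s) * r - s * r ≤ ‖q s z‖ := by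
          have h7 := norm_sub_norm_le ((1 - s) • (z - ι c)) (-((s * r) • e))
          rw [sub_neg_eq_add, norm_neg, norm_smul, norm_smul, h.norm_normal, ← dist_eq_norm z,
            hz.1.2, Real.norm_eq_abs, Real.norm_eq_abs, abs_of_nonneg (sub_nonneg.2 hs.2),
            abs_of_nonneg (mul_nonneg hs.1 hr.le), mul_one] at h7
          exact h7
        rw [abs_of_neg hzneg] at hb
        have : inner ℝ e z ≤ r / ‖q s z‖ * ((1 - s) * inner ℝ e z + s * r) := by
          rw [div_mul_eq_mul_div, le_div_iff₀ hpos]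
          have a1 := mul_le_mul_of_nonpos_left hn hzneg.le
          have a2 := mul_nonneg (mul_nonneg hs.1 hr.le) (by linarith : 0 ≤ r + inner ℝ e z)
          nlinarith
        linarith
  have hN : ι c + r • e ∈ cap ι P e A c r ε := by
    refine ⟨⟨?_, ?_⟩, ?_⟩
    · rw [map_add, h.proj, map_smul, h.proj_normal, smul_zero, add_zero]; exact hc
    · rw [dist_eq_norm, add_sub_cancel_left, norm_smul, h.norm_normal, Real.norm_eq_abs,
        abs_of_pos hr, mul_one]
    · rw [inner_add_right, h.orth, inner_smul_right, h.inner_self]; linarith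
  refine ⟨⟨_, hN⟩, ⟨{ toFun := fun p => ⟨_, hmem p.2 p.2.2 p.1 p.1.2⟩
                      continuous_toFun := ?_
                      map_zero_left := ?_
                      map_one_left := ?_ }⟩⟩
  · refine Continuous.subtype_mk ?_ _
    have hq' : Continuous fun p : unitInterval × cap ι P e A c r ε => q p.1 p.2 :=
      hq.comp ((continuous_subtype_val.comp continuous_fst).prodMk
        (continuous_subtype_val.comp continuous_snd))
    exact continuous_const.add ((continuous_const.div hq'.norm fun p =>
      norm_ne_zero_iff.2 (hne p.2 p.2.2 p.1 p.1.2)).smul hq')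
  · intro z
    ext
    have : q 0 z = z - ι c := by simp [q]
    change ι c + (r / ‖q 0 z‖) • q 0 z = z
    rw [this, ← dist_eq_norm, z.2.1.2, div_self hr.ne', one_smul, add_sub_cancel]
  · intro z
    ext
    have : q 1 z = r • e := by simp [q]
    change ι c + (r / ‖q 1 z‖) • q 1 z = ι c + r • e
    rw [this, norm_smul, h.norm_normal, Real.norm_eq_abs, abs_of_pos hr, mul_one, div_self hr.ne',
      one_smul]

end IsHyperplane
end

end

/-! ### Suspension of a sphere -/

noncomputable section

open CategoryTheory Simplicial AlgebraicTopology

open SingularChains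

namespace IsHyperplane
variable {V W : Type} [NormedAddCommGroup V] [InnerProductSpace ℝ V]
    [NormedAddCommGroup W] [InnerProductSpace ℝ W] {ι : V →ₗᵢ[ℝ] W} {P : W →L[ℝ] V} {e : W}
    {G : Type u} [AddCommGroup G] {k : ℕ}

theorem dist_sq (h : IsHyperplane ι P e) (z : W) (c : V) :
    dist z (ι c) ^ 2 = dist (P z) c ^ 2 + inner ℝ e z ^ 2 := by
  rw [dist_eq_norm, h.norm_sq, map_sub, h.proj, ← dist_eq_norm, inner_sub_right, h.orth, sub_zero]

theorem relOpen_cap {A : AffineSubspace ℝ V} {c : V} {r ε : ℝ} :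
    RelOpen (cap ι P e A c r ε) (cap ι P (-e) A c r ε) := by
  refine ⟨{z | -ε < inner ℝ e z}, isOpen_lt continuous_const (by fun_prop), ?_⟩
  ext z
  constructor
  · exact fun hz => ⟨hz.2, Or.inl hz⟩
  · rintro ⟨h1, hz | hz⟩
    · exact hz
    · exact ⟨hz.1, h1⟩

theorem reducedNonzero_congr {E : Type} [TopologicalSpace E] {A B A' B' : Set E} (hA : A = A')
    (hB : B = B') (h : A ⊆ B) (h' : A' ⊆ B') :
    ReducedNonzero G k (setIncl h) ↔ ReducedNonzero G k (setIncl h') := by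
  subst hA hB; rfl

/-- The sphere of `A` in `Ω`, and the zone of height less than `ε` of its suspension in the
cylinder over `Ω`, are homotopy equivalent; the two equivalences are induced by `ι` and by `P`. -/
theorem reducedNonzero_equator_iff (h : IsHyperplane ι P e) {A : AffineSubspace ℝ V} {c : V}
    (hc : c ∈ A) {r ε : ℝ} (hε : 0 < ε) (hεr : ε ≤ r) {Ω : Set V}
    (hΩ : ∀ z, P z ∈ A → dist z (ι c) = r → |inner ℝ e z| < ε → P z ∈ Ω)
    (hS : {x | x ∈ A ∧ dist x c = r} ⊆ Ω)
    (hS' : {z | (P z ∈ A ∧ dist z (ι c) = r) ∧ |inner ℝ e z| < ε} ⊆ P ⁻¹' Ω) :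
    ReducedNonzero G k (setIncl hS) ↔ ReducedNonzero G k (setIncl hS') := by
  have hr : 0 < r := hε.trans_le hεr
  let j : C(Ω, P ⁻¹' Ω) := ⟨fun x => ⟨ι x, by rw [mem_preimage, h.proj]; exact x.2⟩,
    by exact Continuous.subtype_mk (ι.continuous.comp continuous_subtype_val) _⟩
  let p : C(P ⁻¹' Ω, Ω) := ⟨fun z => ⟨P z, z.2⟩,
    by exact Continuous.subtype_mk (P.continuous.comp continuous_subtype_val) _⟩
  constructor
  · refine ReducedNonzero.map (TopCat.ofHom ⟨fun x => ⟨ι x, ?_⟩, ?_⟩) (TopCat.ofHom j)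
      (TopCat.ofHom p) ?_ ?_
    · refine ⟨⟨by rw [h.proj]; exact x.2.1, by rw [ι.dist_map]; exact x.2.2⟩, ?_⟩
      rw [h.orth, abs_zero]; exact hε
    · exact Continuous.subtype_mk (ι.continuous.comp continuous_subtype_val) _
    · have : TopCat.ofHom j ≫ TopCat.ofHom p = 𝟙 _ := by
        ext x
        exact h.proj x
      rw [this]
    · exact ContinuousMap.Homotopic.refl _
  · have hw : ∀ z ∈ {z | (P z ∈ A ∧ dist z (ι c) = r) ∧ |inner ℝ e z| < ε}, 0 < dist (P z) c := by
      intro z hz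
      refine lt_of_le_of_ne dist_nonneg fun h0 => ?_
      have := h.dist_sq z c
      rw [← h0, hz.1.2] at this
      have h2 : |inner ℝ e z| < |r| := by rw [abs_of_pos hr]; exact hz.2.trans_le hεr
      have := sq_lt_sq.2 h2
      nlinarith
    let ρ : C({z | (P z ∈ A ∧ dist z (ι c) = r) ∧ |inner ℝ e z| < ε}, {x | x ∈ A ∧ dist x c = r}) :=
      ⟨fun z => ⟨(r / dist (P z) c) • (P z - c) + c,
        A.vadd_mem_of_mem_direction (A.direction.smul_mem _
          (A.vsub_mem_direction z.2.1.1 hc)) hc, by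
          rw [dist_eq_norm, add_sub_cancel_right, norm_smul, ← dist_eq_norm, Real.norm_eq_abs,
            abs_of_nonneg (by positivity), div_mul_cancel₀ _ (hw z z.2).ne']⟩, by
        have hc1 : Continuous fun z : {z | (P z ∈ A ∧ dist z (ι c) = r) ∧ |inner ℝ e z| < ε} =>
          P (z : W) := P.continuous.comp continuous_subtype_val
        exact Continuous.subtype_mk (((continuous_const.div (hc1.dist continuous_const)
          fun z => (hw z z.2).ne').smul (hc1.sub continuous_const)).add continuous_const) _⟩
    refine ReducedNonzero.map (TopCat.ofHom ρ) (TopCat.ofHom p) (TopCat.ofHom j) ?_ ?_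
    · refine homotopic_of_segment _ _ fun z t ht => ?_
      change P ((1 - t) • ι (P z) + t • (z : W)) ∈ Ω
      rw [map_add, map_smul, map_smul, h.proj, ← add_smul, sub_add_cancel, one_smul]
      exact z.2
    · refine homotopic_of_segment _ _ fun z t ht => ?_
      change (1 - t) • ((r / dist (P (z : W)) c) • (P z - c) + c) + t • P z ∈ Ω
      obtain ⟨z, hz⟩ := z
      have hd := hw z hz
      change (1 - t) • ((r / dist (P z) c) • (P z - c) + c) + t • P z ∈ Ω
      -- each point of the segment is the projection of a point of the sphere whose height is at
      -- most that of `z`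
      set μ : ℝ := (1 - t) * (r / dist (P z) c) + t with hμ
      have e1 : (1 - t) • ((r / dist (P z) c) • (P z - c) + c) + t • P z = μ • (P z - c) + c := by
        rw [hμ]; module
      rw [e1]
      have hsq := h.dist_sq z c
      rw [hz.1.2] at hsq
      have hdr : dist (P z) c ≤ r := by nlinarith [sq_nonneg (inner ℝ e z), hd, hr]
      have hμd : μ * dist (P z) c = (1 - t) * r + t * dist (P z) c := by
        rw [hμ]; field_simp
      have hμ1 : dist (P z) c ≤ μ * dist (P z) c := by
        rw [hμd]; nlinarith [ht.1, ht.2]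
      have hμ2 : μ * dist (P z) c ≤ r := by
        rw [hμd]; nlinarith [ht.1, ht.2]
      have hv : 0 ≤ r ^ 2 - (μ * dist (P z) c) ^ 2 := by nlinarith
      let y : W := ι (μ • (P z - c) + c) + √(r ^ 2 - (μ * dist (P z) c) ^ 2) • e
      have hPy : P y = μ • (P z - c) + c := by
        simp only [y]
        rw [map_add, h.proj, map_smul, h.proj_normal, smul_zero, add_zero]
      have hey : inner ℝ e y = √(r ^ 2 - (μ * dist (P z) c) ^ 2) := by
        simp only [y]
        rw [inner_add_right, h.orth, zero_add, inner_smul_right, h.inner_self, mul_one]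
      rw [← hPy]
      refine hΩ y ?_ ?_ ?_
      · rw [hPy]
        exact A.vadd_mem_of_mem_direction (A.direction.smul_mem _
          (A.vsub_mem_direction hz.1.1 hc)) hc
      · have := h.dist_sq y c
        rw [hey, Real.sq_sqrt hv, hPy, dist_eq_norm (μ • (P z - c) + c), add_sub_cancel_right,
          norm_smul, ← dist_eq_norm, mul_pow, mul_pow, Real.norm_eq_abs, sq_abs] at this
        exact (sq_eq_sq₀ dist_nonneg hr.le).1 (by linarith)
      · refine lt_of_le_of_lt ?_ hz.2
        rw [hey]
        refine sq_le_sq.1 ?_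
        rw [Real.sq_sqrt hv]
        nlinarith

/-- The sphere in `A` represents a nonzero class of `Ω` if and only if its suspension represents a
nonzero class of the union of the cylinder over `Ω` with the regions above the graph of `τ` and
below the graph of `-τ`. The two halves of that union are contractible, and they meet in the
cylinder. -/
theorem reducedNonzero_suspension_iff [FiniteDimensional ℝ V] [FiniteDimensional ℝ W]
    (h : IsHyperplane ι P e) {A : AffineSubspace ℝ V}
    {c : V} (hc : c ∈ A) {r : ℝ} (hr : 0 < r) {Ω : Set V} (hΩ : IsOpen Ω) {τ : V → ℝ}
    (hτ : Continuous τ) (hτ0 : ∀ x, 0 ≤ τ x) {M : ℝ} (hM : ∀ x, τ x ≤ M)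
    (hS : {x | x ∈ A ∧ dist x c = r} ⊆ Ω)
    (hT : {z | P z ∈ A ∧ dist z (ι c) = r} ⊆ {z | P z ∈ Ω ∨ τ (P z) < |inner ℝ e z|}) :
    ReducedNonzero G k (setIncl hS) ↔ ReducedNonzero G (k + 1) (setIncl hT) := by
  -- the part of the suspended sphere outside the cylinder is compact and avoids height `0`
  obtain ⟨ε, hε, hεr, hεΩ⟩ : ∃ ε, 0 < ε ∧ ε ≤ r ∧
      ∀ z, P z ∈ A → dist z (ι c) = r → |inner ℝ e z| < ε → P z ∈ Ω := by
    have hcpt : IsCompact {z | (P z ∈ A ∧ dist z (ι c) = r) ∧ P z ∉ Ω} := by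
      refine Metric.isCompact_of_isClosed_isBounded ?_ ?_
      · refine IsClosed.inter (IsClosed.inter ?_ ?_) ?_
        · exact (AffineSubspace.closed_of_finiteDimensional A).preimage P.continuous
        · exact isClosed_eq (by fun_prop) continuous_const
        · exact (hΩ.isClosed_compl).preimage P.continuous
      · exact (Metric.isBounded_closedBall (x := ι c) (r := r)).subset fun z hz => hz.1.2.le
    obtain ⟨ε, hε, hb⟩ := hcpt.exists_forall_le' (f := fun z => |inner ℝ e z|) (a := 0)
      (by fun_prop) (fun z hz => (hτ0 _).trans_lt ((hT hz.1).resolve_left hz.2))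
    refine ⟨min ε r, lt_min hε hr, min_le_right _ _, fun z h1 h2 h3 => ?_⟩
    by_contra hcon
    exact absurd (hb z ⟨⟨h1, h2⟩, hcon⟩) (not_le.2 (h3.trans_le (min_le_left _ _)))
  have h1 : cap ι P e A c r ε ⊆ upper P e Ω τ := by
    intro z hz
    by_cases hv : |inner ℝ e z| < ε
    · exact Or.inl (hεΩ z hz.1.1 hz.1.2 hv)
    · refine (hT hz.1).imp id fun h3 => ?_
      have := hz.2
      rcases abs_choice (inner ℝ e z) with h4 | h4
      · rwa [h4] at h3
      · exact absurd (by rw [h4]; linarith) hv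
  have h2 : cap ι P (-e) A c r ε ⊆ upper P (-e) Ω τ := by
    intro z hz
    by_cases hv : |inner ℝ e z| < ε
    · exact Or.inl (hεΩ z hz.1.1 hz.1.2 hv)
    · refine (hT hz.1).imp id fun h3 => ?_
      have := hz.2
      rw [inner_neg_left] at this ⊢
      rcases abs_choice (inner ℝ e z) with h4 | h4
      · exact absurd (by rw [h4]; linarith) hv
      · rwa [h4] at h3
  have hS' : {z | (P z ∈ A ∧ dist z (ι c) = r) ∧ |inner ℝ e z| < ε} ⊆ P ⁻¹' Ω :=
    fun z hz => hεΩ z hz.1.1 hz.1.2 hz.2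
  rw [h.reducedNonzero_equator_iff hc hε hεr hεΩ hS hS']
  have main := reducedNonzero_union_iff (G := G) (k := k) h1 h2
    ⟨_, isOpen_upper (P := P) (e := e) hΩ hτ, (inter_eq_left.2 subset_union_left).symm⟩
    ⟨_, isOpen_upper (P := P) (e := -e) hΩ hτ, (inter_eq_left.2 subset_union_left).symm⟩
    relOpen_cap (by
      simpa using relOpen_cap (ι := ι) (P := P) (e := -e) (A := A) (c := c) (r := r) (ε := ε))
    (h.contractible_upper hM) (h.neg.contractible_upper hM)
    (h.contractible_cap hc hr hε hεr) (h.neg.contractible_cap hc hr hε hεr)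
  refine Iff.trans (reducedNonzero_congr ?_ ?_ _ _) (main.trans (reducedNonzero_congr ?_ ?_ _ _))
  · ext z
    simp only [cap, mem_inter_iff, mem_ofPred_eq, inner_neg_left, abs_lt]
    constructor
    · rintro ⟨h1, h2, h3⟩; exact ⟨⟨h1, h2⟩, h1, by linarith⟩
    · rintro ⟨⟨h1, h2⟩, -, h3⟩; exact ⟨h1, h2, by linarith⟩
  · ext z
    simp only [upper, mem_inter_iff, mem_ofPred_eq, inner_neg_left, mem_preimage]
    constructor
    · intro h; exact ⟨Or.inl h, Or.inl h⟩
    · rintro ⟨h1 | h1, h2 | h2⟩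
      · exact h1
      · exact h1
      · exact h2
      · have := hτ0 (P z); linarith
  · ext z
    simp only [cap, mem_union, mem_ofPred_eq, inner_neg_left]
    constructor
    · rintro (h | h)
      · exact h.1
      · exact h.1
    · intro h
      rcases le_or_gt 0 (inner ℝ e z) with h0 | h0
      · exact Or.inl ⟨h, by linarith⟩
      · exact Or.inr ⟨h, by linarith⟩
  · ext z
    simp only [upper, mem_union, mem_ofPred_eq, inner_neg_left, lt_abs]
    tauto

end IsHyperplane

end

/-! ### Topological competitors and the projection onto a hyperplane -/

noncomputable section

open CategoryTheory Simplicial AlgebraicTopology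

open SingularChains

variable {G : Type u} [AddCommGroup G]

theorem RepresentsNonzero.mono {n k : ℕ} {S Ω Ω' : Set (EuclideanSpace ℝ (Fin n))}
    (h : RepresentsNonzero G k S Ω) (hS : S ⊆ Ω') (hΩ : Ω' ⊆ Ω) : RepresentsNonzero G k S Ω' := by
  obtain ⟨h1, h2⟩ := h
  refine ⟨hS, ReducedNonzero.of_comp (f := setIncl hS) (g := setIncl hΩ) ?_⟩
  exact h2

/-- The image of a closed set under a left inverse of `ι` is closed if the set lies in the range of
`ι` outside a ball. -/
theorem isClosed_image_proj {V W : Type} [NormedAddCommGroup V] [NormedSpace ℝ V]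
    [NormedAddCommGroup W] [NormedSpace ℝ W] [ProperSpace W] {ι : V → W} (hι : Continuous ι)
    {P : W → V} (hP : Continuous P) (h : ∀ x, P (ι x) = x) {F : Set W} (hF : IsClosed F) {R : ℝ}
    (hR : ∀ z ∈ F, R < ‖z‖ → z ∈ range ι) : IsClosed (P '' F) := by
  have : P '' F = P '' (F ∩ Metric.closedBall 0 R) ∪ ι ⁻¹' F := by
    ext x
    constructor
    · rintro ⟨z, hz, rfl⟩
      rcases le_or_gt ‖z‖ R with h0 | h0
      · exact Or.inl ⟨z, ⟨hz, by simpa using h0⟩, rfl⟩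
      · obtain ⟨x, rfl⟩ := hR z hz h0
        exact Or.inr (by rw [mem_preimage, h]; exact hz)
    · rintro (⟨z, hz, rfl⟩ | hx)
      · exact ⟨z, hz.1, rfl⟩
      · exact ⟨ι x, hx, h x⟩
  rw [this]
  exact (((isCompact_closedBall 0 R).inter_left hF).image hP).isClosed.union (hF.preimage hι)

namespace IsHyperplane

variable {d : ℕ} {ι : EuclideanSpace ℝ (Fin d) →ₗᵢ[ℝ] EuclideanSpace ℝ (Fin (d + 1))}
  {P : EuclideanSpace ℝ (Fin (d + 1)) →L[ℝ] EuclideanSpace ℝ (Fin d)}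
  {e : EuclideanSpace ℝ (Fin (d + 1))}

/-- The suspension of a round sphere is a round sphere. -/
theorem isEuclideanSphere (h : IsHyperplane ι P e) {k : ℕ}
    {A : AffineSubspace ℝ (EuclideanSpace ℝ (Fin d))} (hA : Module.finrank ℝ A.direction = k + 1)
    {c : EuclideanSpace ℝ (Fin d)} (hc : c ∈ A) {r : ℝ} (hr : 0 < r) :
    IsEuclideanSphere (k + 1) {z | P z ∈ A ∧ dist z (ι c) = r} := by
  let D := A.direction.comap (P : EuclideanSpace ℝ (Fin (d + 1)) →ₗ[ℝ] EuclideanSpace ℝ (Fin d))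
  have hD : Module.finrank ℝ D = k + 2 := by
    let φ : (A.direction × ℝ) ≃ₗ[ℝ] D :=
      { toFun := fun p => ⟨ι p.1 + p.2 • e, by
          change P _ ∈ A.direction
          rw [map_add, h.proj, map_smul, h.proj_normal, smul_zero, add_zero]
          exact p.1.2⟩
        map_add' := fun p q => by
          ext1
          simp only [Prod.fst_add, Prod.snd_add, Submodule.coe_add, map_add, add_smul]
          abel
        map_smul' := fun t p => by
          ext1
          simp only [Prod.smul_fst, Prod.smul_snd, Submodule.coe_smul, map_smul, RingHom.id_apply,
            smul_add, smul_assoc]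
        invFun := fun z => (⟨P z, z.2⟩, inner ℝ e (z : EuclideanSpace ℝ (Fin (d + 1))))
        left_inv := fun p => by
          ext1
          · ext1
            change P _ = _
            rw [map_add, h.proj, map_smul, h.proj_normal, smul_zero, add_zero]
          · change inner ℝ e _ = _
            rw [inner_add_right, h.orth, inner_smul_right, h.inner_self, zero_add, mul_one]
        right_inv := fun z => by
          ext1
          exact (h.decomp z).symm }
    rw [← φ.finrank_eq, Module.finrank_prod, hA, Module.finrank_self]
  refine ⟨AffineSubspace.mk' (ι c) D, ?_, ι c, AffineSubspace.self_mem_mk' _ _, r, hr, ?_⟩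
  · rw [AffineSubspace.direction_mk', hD]
  · ext z
    have : z ∈ AffineSubspace.mk' (ι c) D ↔ P z ∈ A := by
      rw [AffineSubspace.mem_mk']
      change P (z - ι c) ∈ A.direction ↔ _
      rw [map_sub, h.proj]
      exact AffineSubspace.vsub_right_mem_direction_iff_mem hc _
    change _ ↔ z ∈ AffineSubspace.mk' (ι c) D ∧ _
    rw [this]
    rfl

/-- The equator comes at least as close to the projection of a point of the suspended sphere as the
height of that point. -/
theorem exists_near_equator {V W : Type} [NormedAddCommGroup V] [InnerProductSpace ℝ V]
    [NormedAddCommGroup W] [InnerProductSpace ℝ W] {ι : V →ₗᵢ[ℝ] W} {P : W →L[ℝ] V} {e : W}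
    (h : IsHyperplane ι P e) {A : AffineSubspace ℝ V} {c : V} (hc : c ∈ A)
    (hA : A.direction ≠ ⊥) {r : ℝ} (hr : 0 < r) {z : W} (hz : P z ∈ A) (hz' : dist z (ι c) = r) :
    ∃ x ∈ A, dist x c = r ∧ dist (P z) x ≤ |inner ℝ e z| := by
  obtain ⟨y, hy, hy0⟩ : ∃ y ∈ A.direction, ‖y‖ = 1 ∧ P z - c = dist (P z) c • y := by
    by_cases h0 : P z = c
    · obtain ⟨y, hy, hy0⟩ := A.direction.exists_mem_ne_zero_of_ne_bot hA
      refine ⟨‖y‖⁻¹ • y, A.direction.smul_mem _ hy, norm_smul_inv_norm hy0, ?_⟩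
      rw [h0, dist_self, sub_self, zero_smul]
    · have : P z - c ≠ 0 := sub_ne_zero.2 h0
      refine ⟨‖P z - c‖⁻¹ • (P z - c), A.direction.smul_mem _ (A.vsub_mem_direction hz hc),
        norm_smul_inv_norm this, ?_⟩
      rw [dist_eq_norm, smul_smul, mul_inv_cancel₀ (norm_ne_zero_iff.2 this), one_smul]
  have hsq := h.dist_sq z c
  rw [hz'] at hsq
  have hd : dist (P z) c ≤ r := by
    nlinarith [sq_nonneg (inner ℝ e z), dist_nonneg (x := P z) (y := c)]
  refine ⟨r • y + c, A.vadd_mem_of_mem_direction (A.direction.smul_mem _ hy) hc, ?_, ?_⟩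
  · rw [dist_eq_norm, add_sub_cancel_right, norm_smul, hy0.1, mul_one, Real.norm_eq_abs,
      abs_of_pos hr]
  · rw [dist_eq_norm, ← sub_sub_sub_cancel_right _ _ c, add_sub_cancel_right, hy0.2, ← sub_smul,
      norm_smul, hy0.1, mul_one, Real.norm_eq_abs, abs_of_nonpos (by linarith)]
    refine le_abs.2 ?_
    by_contra! hcon
    nlinarith [dist_nonneg (x := P z) (y := c), neg_abs_le (inner ℝ e z), le_abs_self (inner ℝ e z)]

/-- Topological competitors project to topological competitors in a hyperplane: a sphere which
represents a nonzero class of the complement of `K` is suspended, the competitor condition is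
applied to the suspension, and the result is desuspended in the complement of `P '' F`. -/
theorem isTopologicalCompetitor_proj_hyperplane (h : IsHyperplane ι P e)
    {K : Set (EuclideanSpace ℝ (Fin d))} (hK : IsClosed K)
    {F : Set (EuclideanSpace ℝ (Fin (d + 1)))} (hF : IsTopologicalCompetitor G (ι '' K) F) :
    IsTopologicalCompetitor G K (P '' F) := by
  obtain ⟨hFc, B, hBc, hBb, hFB, hS⟩ := hF
  obtain ⟨R, hR0, hR⟩ : ∃ R, 0 < R ∧ ∀ z ∈ B, ‖z‖ < R := by
    obtain ⟨R, hR⟩ := hBb.subset_ball 0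
    exact ⟨max R 1, by positivity, fun z hz => by
      have := hR hz
      rw [mem_ball_zero_iff] at this
      exact this.trans_le (le_max_left _ _)⟩
  have hPn : ∀ z, ‖P z‖ ≤ ‖z‖ := fun z => by
    have := h.norm_sq z
    exact (sq_le_sq₀ (norm_nonneg _) (norm_nonneg _)).1 (by nlinarith [sq_nonneg (inner ℝ e z)])
  have hin : ∀ z, |inner ℝ e z| ≤ ‖z‖ := fun z => by
    have := abs_real_inner_le_norm e z
    rwa [h.norm_normal, one_mul] at this
  have hFK : ∀ z ∈ F, z ∉ B → z ∈ ι '' K := fun z hz hzB => (hFB.le ⟨hz, hzB⟩).1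
  have hcl : IsClosed (P '' F) := by
    refine isClosed_image_proj ι.continuous P.continuous h.proj hFc (R := R) fun z hz hzR => ?_
    obtain ⟨x, -, hx⟩ := hFK z hz fun hB => (hR z hB).not_gt hzR
    exact ⟨x, hx⟩
  have hout : ∀ x, R ≤ ‖x‖ → (x ∈ P '' F ↔ x ∈ K) := by
    intro x hx
    constructor
    · rintro ⟨z, hz, rfl⟩
      obtain ⟨y, hy, rfl⟩ := hFK z hz fun hB => (hR z hB).not_ge (hx.trans (hPn z))
      rwa [h.proj]
    · intro hxK
      have hxB : ι x ∉ B := fun hB => (hR _ hB).not_ge (by rwa [ι.norm_map])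
      exact ⟨ι x, (hFB.ge ⟨⟨x, hxK, rfl⟩, hxB⟩).1, h.proj x⟩
  refine ⟨hcl, Metric.ball 0 (4 * R), convex_ball _ _, Metric.isBounded_ball, ?_, ?_⟩
  · ext x
    simp only [mem_sdiff, mem_ball_zero_iff, not_lt]
    exact and_congr_left fun hx => hout x (by linarith)
  rintro k hk S ⟨A, hA, c, hc, r, hr, rfl⟩ hSK hnz
  have hA0 : A.direction ≠ ⊥ := fun h0 => by rw [h0, finrank_bot] at hA; omega
  have hfar : ∀ x, x ∈ A → dist x c = r → 4 * R ≤ ‖x‖ := fun x h1 h2 => by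
    have := hSK (show x ∈ {x | x ∈ A ∧ dist x c = r} from ⟨h1, h2⟩)
    by_contra! hcon
    exact this (Or.inl (by simpa using hcon))
  -- points of the suspended sphere are far from the origin
  have hfar' : ∀ z, P z ∈ A → dist z (ι c) = r → 4 * R ≤ ‖P z‖ + |inner ℝ e z| := by
    intro z h1 h2
    obtain ⟨x, hx, hxr, hd⟩ := h.exists_near_equator hc hA0 hr h1 h2
    have := hfar x hx hxr
    have h3 := norm_le_norm_add_norm_sub (P z) x
    rw [← dist_eq_norm] at h3
    linarith
  obtain ⟨hSE, hnz⟩ := hnz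
  have heq : {z | P z ∈ Kᶜ ∨ (0 : ℝ) < |inner ℝ e z|} = (ι '' K)ᶜ := by
    ext z
    constructor
    · rintro hz ⟨x, hx, rfl⟩
      rcases hz with hz | hz
      · rw [h.proj] at hz; exact hz hx
      · rw [h.orth, abs_zero] at hz; exact lt_irrefl _ hz
    · intro hz
      by_contra hcon
      rw [mem_ofPred_eq, not_or] at hcon
      refine hz ⟨P z, not_not.1 hcon.1, ?_⟩
      have : inner ℝ e z = 0 := by simpa using hcon.2
      conv_rhs => rw [h.decomp z, this, zero_smul, add_zero]
  have hpole : ∀ z, P z ∈ A → dist z (ι c) = r → inner ℝ e z = 0 → dist (P z) c = r := by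
    intro z _ h2 h3
    have := h.dist_sq z c
    rw [h3, h2] at this
    exact (sq_eq_sq₀ dist_nonneg hr.le).1 (by linarith)
  have hT0 : {z | P z ∈ A ∧ dist z (ι c) = r} ⊆ {z | P z ∈ Kᶜ ∨ (0 : ℝ) < |inner ℝ e z|} := by
    rintro z ⟨h1, h2⟩
    by_cases h3 : inner ℝ e z = 0
    · exact Or.inl (hSE ⟨h1, hpole z h1 h2 h3⟩)
    · exact Or.inr (abs_pos.2 h3)
  have hnz1 := (h.reducedNonzero_suspension_iff (G := G) (k := k) hc hr hK.isOpen_compl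
    (τ := fun _ => 0) continuous_const (fun _ => le_rfl) (M := 0) (fun _ => le_rfl) hSE hT0).1 hnz
  have hnz2 : RepresentsNonzero G (k + 1) {z | P z ∈ A ∧ dist z (ι c) = r} (ι '' K)ᶜ :=
    ⟨heq ▸ hT0, (reducedNonzero_congr rfl heq _ _).1 hnz1⟩
  have hnz3 := hS (k + 1) (by omega) _ (h.isEuclideanSphere hA hc hr) (by
    rintro z ⟨h1, h2⟩ (hzB | hzK)
    · have := hfar' z h1 h2
      have := hR z hzB
      have := hPn z
      have := hin z
      linarith
    · exact (heq.le (hT0 ⟨h1, h2⟩)) hzK) hnz2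
  -- over its projection, `F` lies between the graphs of `-τ` and `τ`; the suspended sphere stays
  -- far from the origin and, outside the equator, avoids the region between these graphs
  let τ : EuclideanSpace ℝ (Fin d) → ℝ := fun x => max 0 (2 * R - ‖x‖)
  have hSF : {x | x ∈ A ∧ dist x c = r} ⊆ (P '' F)ᶜ := by
    rintro x ⟨h1, h2⟩ hx
    exact hSE ⟨h1, h2⟩ ((hout x (by linarith [hfar x h1 h2])).1 hx)
  have hTF : {z | P z ∈ A ∧ dist z (ι c) = r} ⊆
      {z | P z ∈ (P '' F)ᶜ ∨ τ (P z) < |inner ℝ e z|} := by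
    rintro z ⟨h1, h2⟩
    by_cases h3 : inner ℝ e z = 0
    · exact Or.inl (hSF ⟨h1, hpole z h1 h2 h3⟩)
    · refine Or.inr (max_lt (abs_pos.2 h3) ?_)
      linarith [hfar' z h1 h2]
  have hsub : {z | P z ∈ (P '' F)ᶜ ∨ τ (P z) < |inner ℝ e z|} ⊆ Fᶜ := by
    rintro z (hz | hz) hzF
    · exact hz ⟨z, hzF, rfl⟩
    · by_cases hzB : z ∈ B
      · have h1 := hR z hzB
        have h2 := hPn z
        have h3 := hin z
        have h4 : 2 * R - ‖P z‖ ≤ τ (P z) := le_max_right _ _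
        linarith
      · obtain ⟨x, -, rfl⟩ := hFK z hzF hzB
        rw [h.orth, abs_zero] at hz
        exact absurd hz (not_lt.2 (le_max_left _ _))
  obtain ⟨hT', hnz4⟩ := hnz3.mono hTF hsub
  refine ⟨hSF, (h.reducedNonzero_suspension_iff (G := G) (k := k) hc hr hcl.isOpen_compl (τ := τ)
    (by fun_prop) (fun _ => le_max_left _ _) (M := 2 * R) (fun x => ?_) hSF hTF).2 hnz4⟩
  exact max_le (by linarith) (by linarith [norm_nonneg x])

end IsHyperplane

end

/-! ### Topological competitors and the projection onto a subspace -/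

noncomputable section

open CategoryTheory Simplicial AlgebraicTopology

open SingularChains

variable {G : Type u} [AddCommGroup G]

/-- The orthogonal projection onto the range of an isometric embedding `ι`, in the coordinates
given by `ι`. -/
def proj {d n : ℕ} (ι : EuclideanSpace ℝ (Fin d) →ₗᵢ[ℝ] EuclideanSpace ℝ (Fin n)) :
    EuclideanSpace ℝ (Fin n) →L[ℝ] EuclideanSpace ℝ (Fin d) :=
  ι.toContinuousLinearMap.adjoint

section proj
variable {d n m : ℕ} (ι : EuclideanSpace ℝ (Fin d) →ₗᵢ[ℝ] EuclideanSpace ℝ (Fin n))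

theorem inner_proj_left (z : EuclideanSpace ℝ (Fin n)) (x : EuclideanSpace ℝ (Fin d)) :
    inner ℝ (proj ι z) x = inner ℝ z (ι x) := ContinuousLinearMap.adjoint_inner_left _ _ _

theorem proj_apply (x : EuclideanSpace ℝ (Fin d)) : proj ι (ι x) = x :=
  ext_inner_right ℝ fun y => by rw [inner_proj_left, ι.inner_map_map]

theorem norm_proj_le (z : EuclideanSpace ℝ (Fin n)) : ‖proj ι z‖ ≤ ‖z‖ := by
  have h1 : ‖proj ι z‖ ^ 2 ≤ ‖z‖ * ‖proj ι z‖ := by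
    rw [← real_inner_self_eq_norm_sq, inner_proj_left]
    exact (real_inner_le_norm _ _).trans_eq (by rw [ι.norm_map])
  rcases eq_or_lt_of_le (norm_nonneg (proj ι z)) with h | h
  · rw [← h]; exact norm_nonneg _
  · nlinarith

theorem dist_proj_le (z w : EuclideanSpace ℝ (Fin n)) : dist (proj ι z) (proj ι w) ≤ dist z w := by
  rw [dist_eq_norm, dist_eq_norm, ← map_sub]
  exact norm_proj_le ι _

theorem lipschitzWith_proj : LipschitzWith 1 (proj ι) :=
  LipschitzWith.of_dist_le_mul fun z w => by simpa using dist_proj_le ι z w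

theorem proj_comp (ι₂ : EuclideanSpace ℝ (Fin n) →ₗᵢ[ℝ] EuclideanSpace ℝ (Fin m))
    (z : EuclideanSpace ℝ (Fin m)) : proj (ι₂.comp ι) z = proj ι (proj ι₂ z) :=
  ext_inner_right ℝ fun y => by simp [inner_proj_left]

end proj

theorem RepresentsNonzero.image {n m k : ℕ}
    (f : EuclideanSpace ℝ (Fin n) ≃ₜ EuclideanSpace ℝ (Fin m))
    {S Ω : Set (EuclideanSpace ℝ (Fin n))} (h : RepresentsNonzero G k S Ω) :
    RepresentsNonzero G k (f '' S) (f '' Ω) := by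
  obtain ⟨h1, h2⟩ := h
  refine ⟨image_mono h1, ?_⟩
  refine ReducedNonzero.map (f := setIncl h1) (TopCat.ofHom (f.image S : C(_, _)))
    (TopCat.ofHom (f.image Ω : C(_, _)))
    (TopCat.ofHom ⟨(f.image Ω).symm, (f.image Ω).symm.continuous⟩) ?_
    (ContinuousMap.Homotopic.refl _) h2
  have : TopCat.ofHom (f.image Ω : C(_, _)) ≫
      TopCat.ofHom ⟨(f.image Ω).symm, (f.image Ω).symm.continuous⟩ = 𝟙 _ := by
    ext x
    simp
  rw [this]

theorem IsEuclideanSphere.image {n m k : ℕ}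
    (f : EuclideanSpace ℝ (Fin n) ≃ₗᵢ[ℝ] EuclideanSpace ℝ (Fin m))
    {S : Set (EuclideanSpace ℝ (Fin n))} (h : IsEuclideanSphere k S) :
    IsEuclideanSphere k (f '' S) := by
  obtain ⟨A, hA, c, hc, r, hr, rfl⟩ := h
  refine ⟨A.map (f.toLinearEquiv.toLinearMap.toAffineMap), ?_, f c, ?_, r, hr, ?_⟩
  · rw [AffineSubspace.map_direction, ← hA]
    exact LinearEquiv.finrank_map_eq f.toLinearEquiv A.direction
  · exact ⟨c, hc, rfl⟩
  · ext z
    constructor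
    · rintro ⟨x, ⟨h1, h2⟩, rfl⟩
      exact ⟨⟨x, h1, rfl⟩, by rw [f.dist_map]; exact h2⟩
    · rintro ⟨⟨x, h1, rfl⟩, h2⟩
      exact ⟨x, ⟨h1, by rw [← h2]; exact (f.dist_map x c).symm⟩, rfl⟩

theorem IsTopologicalCompetitor.image {n : ℕ}
    (f : EuclideanSpace ℝ (Fin n) ≃ₗᵢ[ℝ] EuclideanSpace ℝ (Fin n))
    {E F : Set (EuclideanSpace ℝ (Fin n))} (h : IsTopologicalCompetitor G E F) :
    IsTopologicalCompetitor G (f '' E) (f '' F) := by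
  obtain ⟨hF, B, hB, hBb, hFB, hS⟩ := h
  have hff : ∀ A, f.symm '' (f '' A) = A := fun A => by
    rw [← image_comp]; simp
  refine ⟨f.toHomeomorph.isClosedMap _ hF, f '' B, hB.is_linear_image ⟨f.map_add, f.map_smul⟩,
    f.lipschitz.isBounded_image hBb, ?_, fun k hk S hSs hSE hnz => ?_⟩
  · rw [← image_sdiff f.injective, ← image_sdiff f.injective, hFB]
  have hcompl : ∀ A, f '' Aᶜ = (f '' A)ᶜ := fun A => image_compl_eq f.bijective
  have hcompl' : ∀ A, f.symm '' (f '' A)ᶜ = Aᶜ := fun A => by rw [← hcompl, hff]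
  have h1 := hS k hk (f.symm '' S) (hSs.image f.symm) (by
    rintro _ ⟨z, hz, rfl⟩ h2
    refine hSE hz ?_
    rcases h2 with h2 | h2
    · exact Or.inl ⟨_, h2, f.apply_symm_apply z⟩
    · exact Or.inr ⟨_, h2, f.apply_symm_apply z⟩) (by
    have := hnz.image f.symm.toHomeomorph
    change RepresentsNonzero G k (f.symm '' S) (f.symm '' (f '' E)ᶜ) at this
    rwa [hcompl'] at this)
  have h2 := h1.image f.toHomeomorph
  change RepresentsNonzero G k (f '' (f.symm '' S)) (f '' Fᶜ) at h2
  rw [hcompl, ← image_comp] at h2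
  simpa using h2

/-- Every unit vector is the normal of an isometrically embedded hyperplane. -/
theorem exists_hyperplane {n : ℕ} {e : EuclideanSpace ℝ (Fin (n + 1))} (he : ‖e‖ = 1) :
    ∃ ι : EuclideanSpace ℝ (Fin n) →ₗᵢ[ℝ] EuclideanSpace ℝ (Fin (n + 1)),
      IsHyperplane ι (proj ι) e := by
  have : Fact (Module.finrank ℝ (EuclideanSpace ℝ (Fin (n + 1))) = n + 1) := ⟨by simp⟩
  have he0 : e ≠ 0 := by rintro rfl; simp at he
  let b := (OrthonormalBasis.fromOrthogonalSpanSingleton (𝕜 := ℝ) n he0).repr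
  let ι := (Submodule.subtypeₗᵢ _).comp b.symm.toLinearIsometry
  have hmem : ∀ x, (ι x) ∈ (Submodule.span ℝ {e})ᗮ := fun x => (b.symm x).2
  have horth : ∀ x, inner ℝ e (ι x) = 0 := fun x =>
    Submodule.mem_orthogonal_singleton_iff_inner_right.1 (hmem x)
  refine ⟨ι, proj_apply ι, ext_inner_right ℝ fun y => ?_, he, horth, fun z => ?_⟩
  · rw [inner_proj_left, horth, inner_zero_left]
  · have h1 : z - inner ℝ e z • e ∈ (Submodule.span ℝ {e})ᗮ := by
      rw [Submodule.mem_orthogonal_singleton_iff_inner_right, inner_sub_right, inner_smul_right,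
        real_inner_self_eq_norm_sq, he]
      simp
    have h2 : ι (b ⟨_, h1⟩) = z - inner ℝ e z • e := by
      change ((b.symm (b _) : (Submodule.span ℝ {e})ᗮ) : EuclideanSpace ℝ (Fin (n + 1))) = _
      rw [b.symm_apply_apply]
    have h3 : proj ι z = b ⟨_, h1⟩ := by
      rw [← proj_apply ι (b _), h2, map_sub, map_smul]
      have : proj ι e = 0 := ext_inner_right ℝ fun y => by
        rw [inner_proj_left, horth, inner_zero_left]
      rw [this, smul_zero, sub_zero]
    rw [h3, h2, sub_add_cancel]

theorem isTopologicalCompetitor_proj {d n : ℕ} (hdn : d ≤ n)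
    (ι : EuclideanSpace ℝ (Fin d) →ₗᵢ[ℝ] EuclideanSpace ℝ (Fin n))
    {K : Set (EuclideanSpace ℝ (Fin d))} (hK : IsClosed K)
    {F : Set (EuclideanSpace ℝ (Fin n))} (hF : IsTopologicalCompetitor G (ι '' K) F) :
    IsTopologicalCompetitor G K (proj ι '' F) := by
  induction n, hdn using Nat.le_induction with
  | base =>
    let f := ι.toLinearIsometryEquiv rfl
    have hf : ∀ x, f x = ι x := fun x => rfl
    have h1 := hF.image f.symm
    have h2 : f.symm '' (ι '' K) = K := by
      rw [← image_comp]
      exact (image_congr fun x _ => f.symm_apply_apply x).trans (image_id K)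
    have h3 : ∀ z, f.symm z = proj ι z := fun z => by
      obtain ⟨x, rfl⟩ := f.surjective z
      rw [f.symm_apply_apply, hf, proj_apply]
    rw [h2, image_congr fun z _ => h3 z] at h1
    exact h1
  | succ n hdn ih =>
    obtain ⟨e, he, horth⟩ : ∃ e : EuclideanSpace ℝ (Fin (n + 1)), ‖e‖ = 1 ∧
        ∀ x, inner ℝ e (ι x) = 0 := by
      have h1 : (LinearMap.range ι.toLinearMap)ᗮ ≠ ⊥ := by
        intro h0
        have h2 := Submodule.finrank_add_finrank_orthogonal (LinearMap.range ι.toLinearMap)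
        rw [h0, finrank_bot, LinearMap.finrank_range_of_inj ι.injective] at h2
        simp at h2
        omega
      obtain ⟨y, hy, hy0⟩ := Submodule.exists_mem_ne_zero_of_ne_bot h1
      refine ⟨‖y‖⁻¹ • y, norm_smul_inv_norm hy0, fun x => ?_⟩
      have h3 : inner ℝ y (ι x) = 0 :=
        Submodule.inner_left_of_mem_orthogonal (LinearMap.mem_range_self ι.toLinearMap x) hy
      rw [inner_smul_left, h3, mul_zero]
    obtain ⟨ι₂, h⟩ := exists_hyperplane he
    have hι : ∀ x, ι₂ (proj ι₂ (ι x)) = ι x := fun x => by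
      conv_rhs => rw [h.decomp (ι x), horth, zero_smul, add_zero]
    let ι₁ : EuclideanSpace ℝ (Fin d) →ₗᵢ[ℝ] EuclideanSpace ℝ (Fin n) :=
      { toLinearMap := (proj ι₂).toLinearMap ∘ₗ ι.toLinearMap
        norm_map' := fun x => by
          change ‖proj ι₂ (ι x)‖ = _
          rw [← ι₂.norm_map, hι, ι.norm_map] }
    have hι₁ : ι = ι₂.comp ι₁ := by ext1 x; exact (hι x).symm
    have h1 : ι '' K = ι₂ '' (ι₁ '' K) := by
      rw [← image_comp, hι₁]; rfl
    have h2 : proj ι '' F = proj ι₁ '' (proj ι₂ '' F) := by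
      rw [← image_comp, hι₁]
      exact image_congr fun z _ => proj_comp _ _ z
    rw [h2]
    rw [h1] at hF
    exact ih ι₁ (h.isTopologicalCompetitor_proj_hyperplane
      (ι₁.isometry.isClosedEmbedding.isClosedMap _ hK) hF)

end

/-! ### Measures, minimal cones and convex domains under the embedding -/

noncomputable section

variable {d n : ℕ} (ι : EuclideanSpace ℝ (Fin d) →ₗᵢ[ℝ] EuclideanSpace ℝ (Fin n))
  {K : Set (EuclideanSpace ℝ (Fin d))}

theorem hausdorffMeasure_image_proj_le (A : Set (EuclideanSpace ℝ (Fin n))) :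
    μH[2] (proj ι '' A) ≤ μH[2] A := by
  have := (lipschitzWith_proj ι).hausdorffMeasure_image_le (d := 2) (by norm_num) A
  simpa using this

theorem hausdorffMeasure_image_isometry (A : Set (EuclideanSpace ℝ (Fin d))) :
    μH[2] (ι '' A) = μH[2] A :=
  ι.isometry.hausdorffMeasure_image (Or.inl (by norm_num)) A

/-- Comparison with the projected competitor. Points of `F` outside `ι '' E` may project into `E`,
and the part of `E` they cover is counted once on each side. -/
theorem measure_sdiff_le_of_proj {E : Set (EuclideanSpace ℝ (Fin d))} (hE : IsClosed E)
    {F : Set (EuclideanSpace ℝ (Fin n))}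
    (h : μH[2] (E \ proj ι '' F) ≤ μH[2] (proj ι '' F \ E)) :
    μH[2] (ι '' E \ F) ≤ μH[2] (F \ ι '' E) := by
  have h1 : ι '' E \ F = ι '' (E \ ι ⁻¹' F) := by
    ext z
    constructor
    · rintro ⟨⟨x, hx, rfl⟩, hz⟩; exact ⟨x, ⟨hx, hz⟩, rfl⟩
    · rintro ⟨x, ⟨hx, hz⟩, rfl⟩; exact ⟨⟨x, hx, rfl⟩, hz⟩
  have h2 : E \ ι ⁻¹' F ⊆ (E \ proj ι '' F) ∪ (proj ι '' (F \ ι '' E) ∩ E) := by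
    rintro x ⟨hx, hxF⟩
    by_cases hP : x ∈ proj ι '' F
    · obtain ⟨z, hz, rfl⟩ := hP
      refine Or.inr ⟨⟨z, ⟨hz, ?_⟩, rfl⟩, hx⟩
      rintro ⟨y, hy, rfl⟩
      rw [mem_preimage, proj_apply] at hxF
      exact hxF hz
    · exact Or.inl ⟨hx, hP⟩
  have h3 : proj ι '' F \ E ⊆ proj ι '' (F \ ι '' E) \ E := by
    rintro _ ⟨⟨z, hz, rfl⟩, hx⟩
    refine ⟨⟨z, ⟨hz, ?_⟩, rfl⟩, hx⟩
    rintro ⟨y, hy, rfl⟩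
    rw [proj_apply] at hx
    exact hx hy
  calc μH[2] (ι '' E \ F) = μH[2] (E \ ι ⁻¹' F) := by rw [h1, hausdorffMeasure_image_isometry]
    _ ≤ μH[2] (E \ proj ι '' F) + μH[2] (proj ι '' (F \ ι '' E) ∩ E) :=
        (measure_mono h2).trans (measure_union_le _ _)
    _ ≤ μH[2] (proj ι '' (F \ ι '' E) \ E) + μH[2] (proj ι '' (F \ ι '' E) ∩ E) := by
        gcongr ?_ + _
        exact h.trans (measure_mono h3)
    _ = μH[2] (proj ι '' (F \ ι '' E)) := by
        rw [add_comm]; exact measure_inter_add_sdiff _ hE.measurableSet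
    _ ≤ μH[2] (F \ ι '' E) := hausdorffMeasure_image_proj_le ι _

theorem isClosed_image_isometry (hK : IsClosed K) : IsClosed (ι '' K) :=
  ι.isometry.isClosedEmbedding.isClosedMap _ hK

theorem IsConeAtZero.image (h : IsConeAtZero K) : IsConeAtZero (ι '' K) := by
  refine ⟨⟨0, h.1, map_zero ι⟩, ?_⟩
  rintro _ ⟨x, hx, rfl⟩ t ht
  exact ⟨t • x, h.2 x hx t ht, map_smul ι t x⟩

theorem IsReduced2.image (h : IsReduced2 K) : IsReduced2 (ι '' K) := by
  rintro _ ⟨x, hx, rfl⟩ r hr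
  have : ι '' K ∩ Metric.ball (ι x) r = ι '' (K ∩ Metric.ball x r) := by
    ext z
    constructor
    · rintro ⟨⟨y, hy, rfl⟩, hz⟩
      exact ⟨y, ⟨hy, by rwa [Metric.mem_ball, ι.dist_map] at hz⟩, rfl⟩
    · rintro ⟨y, ⟨hy, hz⟩, rfl⟩
      exact ⟨⟨y, hy, rfl⟩, by rwa [Metric.mem_ball, ι.dist_map]⟩
  rw [this, hausdorffMeasure_image_isometry]
  exact h x hx r hr

theorem measure_image_inter_closedBall_lt_top
    (h : ∀ (x : EuclideanSpace ℝ (Fin d)) (r : ℝ), μH[2] (K ∩ Metric.closedBall x r) < ∞)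
    (z : EuclideanSpace ℝ (Fin n)) (r : ℝ) : μH[2] (ι '' K ∩ Metric.closedBall z r) < ∞ := by
  refine lt_of_le_of_lt (measure_mono ?_)
    ((hausdorffMeasure_image_isometry ι (K ∩ Metric.closedBall (proj ι z) r)).trans_lt (h _ r))
  rintro _ ⟨⟨x, hx, rfl⟩, hz⟩
  refine ⟨x, ⟨hx, ?_⟩, rfl⟩
  have := dist_proj_le ι (ι x) z
  rw [proj_apply] at this
  exact this.trans hz

/-- The deformation of `ℝᵈ` is the deformation of `ℝⁿ` along `ι '' ℝᵈ`, projected back. -/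
theorem isAlmgrenCompetitor_proj {F : Set (EuclideanSpace ℝ (Fin n))}
    (h : IsAlmgrenCompetitor (ι '' K) F) : IsAlmgrenCompetitor K (proj ι '' F) := by
  obtain ⟨hF, φ, h0, hc, ⟨L, hL⟩, hb, rfl⟩ := h
  refine ⟨?_, fun t x => proj ι (φ t (ι x)), fun x => by simp only [h0, proj_apply], ?_,
    ⟨1 * (L * 1), (lipschitzWith_proj ι).comp (hL.comp ι.lipschitz)⟩, ?_, ?_⟩
  · obtain ⟨R, hR⟩ := hb.subset_closedBall 0
    refine isClosed_image_proj ι.continuous (proj ι).continuous (proj_apply ι) hF (R := R) ?_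
    rintro _ ⟨_, ⟨x, hx, rfl⟩, rfl⟩ hlt
    by_cases hfix : φ 1 (ι x) = ι x
    · exact ⟨x, hfix.symm⟩
    · have := hR (mem_iUnion₂.2 ⟨1, right_mem_Icc.2 zero_le_one, Or.inr ⟨_, hfix, rfl⟩⟩)
      rw [mem_closedBall_zero_iff] at this
      exact absurd hlt (not_lt.2 this)
  · refine (proj ι).continuous.comp_continuousOn (hc.comp
      (f := fun p : ℝ × EuclideanSpace ℝ (Fin d) => (p.1, ι p.2)) (by fun_prop) ?_)
    rintro ⟨t, x⟩ ⟨ht, -⟩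
    exact ⟨ht, mem_univ _⟩
  · refine ((lipschitzWith_proj ι).isBounded_image hb).subset ?_
    have hmv : ∀ t x, proj ι (φ t (ι x)) ≠ x → φ t (ι x) ≠ ι x := fun t x hx h => by
      rw [h, proj_apply] at hx; exact hx rfl
    refine iUnion₂_subset fun t ht => ?_
    rintro x (hx | ⟨x, hx, rfl⟩)
    · exact ⟨ι x, mem_iUnion₂.2 ⟨t, ht, Or.inl (hmv t x hx)⟩, proj_apply ι x⟩
    · exact ⟨φ t (ι x), mem_iUnion₂.2 ⟨t, ht, Or.inr ⟨_, hmv t x hx, rfl⟩⟩, rfl⟩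
  · rw [← image_comp, ← image_comp]; rfl

theorem IsMinimalAmong.image_univ {𝓕 : Set (Set (EuclideanSpace ℝ (Fin d)))}
    {𝓕' : Set (Set (EuclideanSpace ℝ (Fin n)))} (h : IsMinimalAmong univ K 𝓕)
    (h𝓕 : ∀ F ∈ 𝓕', proj ι '' F ∈ 𝓕) : IsMinimalAmong univ (ι '' K) 𝓕' :=
  ⟨isClosed_image_isometry ι h.1, fun z r _ =>
    measure_image_inter_closedBall_lt_top ι (fun x r => h.2.1 x r (subset_univ _)) z r,
    fun F hF => measure_sdiff_le_of_proj ι h.1 (h.2.2 _ (h𝓕 F hF))⟩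

theorem IsAlmgrenMinimalCone.image (h : IsAlmgrenMinimalCone K) : IsAlmgrenMinimalCone (ι '' K) :=
  ⟨h.cone.image ι, h.reduced.image ι, h.minimal.image_univ ι fun _ hF =>
    isAlmgrenCompetitor_proj ι hF⟩

theorem IsTopologicalMinimalCone.image {G : Type u} [AddCommGroup G] (hdn : d ≤ n)
    (h : IsTopologicalMinimalCone G K) : IsTopologicalMinimalCone G (ι '' K) :=
  ⟨h.cone.image ι, h.reduced.image ι, h.minimal.image_univ ι fun _ hF =>
    isTopologicalCompetitor_proj hdn ι h.minimal.1 hF⟩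

theorem IsYPoint.mem {a : EuclideanSpace ℝ (Fin d)} (h : IsYPoint K a) : a ∈ K := by
  obtain ⟨-, w, -, -, r, hr, e⟩ := h
  exact (e.ge ⟨⟨0, 1, 0, le_rfl, by simp⟩, Metric.mem_ball_self hr⟩).1

theorem isYPoint_image_iff {b : EuclideanSpace ℝ (Fin n)} :
    IsYPoint (ι '' K) b ↔ ∃ a, IsYPoint K a ∧ ι a = b := by
  constructor
  · intro hb
    obtain ⟨a, -, rfl⟩ := hb.mem
    obtain ⟨h1, w, hw, hww, r, hr, e⟩ := hb
    -- the half planes lie in `ι '' K` near `ι a`, so their directions lie in the range of `ι`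
    have hwr : ∀ i, ∃ v, ι v = w i := by
      intro i
      have hmem : ι a + (r / 2) • w i ∈ ι '' K ∩ Metric.ball (ι a) r := by
        refine e.ge ⟨⟨i, 1, r / 2, by positivity, by rw [one_smul]⟩, ?_⟩
        rw [mem_ball_iff_norm, add_sub_cancel_left, norm_smul, (hw i).1, mul_one, Real.norm_eq_abs,
          abs_of_pos (by positivity)]
        linarith
      obtain ⟨x, -, hx⟩ := hmem.1
      refine ⟨(r / 2)⁻¹ • (x - a), ?_⟩
      rw [map_smul, map_sub, hx, add_sub_cancel_left, smul_smul, inv_mul_cancel₀ (by positivity),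
        one_smul]
    choose v hv using hwr
    refine ⟨a, ⟨by rwa [ι.norm_map] at h1, v, fun i => ?_, fun i j hij => ?_, r, hr, ?_⟩, rfl⟩
    · rw [← ι.norm_map, ← ι.inner_map_map, hv]; exact hw i
    · rw [← ι.inner_map_map, hv, hv]; exact hww i j hij
    · ext x
      have := Set.ext_iff.1 e (ι x)
      simp only [mem_inter_iff, ι.injective.mem_set_image, Metric.mem_ball, ι.dist_map,
        mem_ofPred_eq, ← hv, ← map_smul, ← map_add, ι.injective.eq_iff] at this ⊢
      exact this
  · rintro ⟨a, ⟨h1, w, hw, hww, r, hr, e⟩, rfl⟩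
    refine ⟨by rwa [ι.norm_map], fun i => ι (w i), fun i => ?_, fun i j hij => ?_, r, hr, ?_⟩
    · rw [ι.norm_map, ι.inner_map_map]; exact hw i
    · rw [ι.inner_map_map]; exact hww i j hij
    · have key : ∀ x, (x ∈ K ∧ x ∈ Metric.ball a r) ↔ _ := fun x => Set.ext_iff.1 e x
      ext z
      constructor
      · rintro ⟨⟨x, hx, rfl⟩, hz⟩
        rw [Metric.mem_ball, ι.dist_map] at hz
        obtain ⟨⟨i, s, t, ht, rfl⟩, -⟩ := (key x).1 ⟨hx, hz⟩
        exact ⟨⟨i, s, t, ht, by simp⟩, by rwa [Metric.mem_ball, ι.dist_map]⟩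
      · rintro ⟨⟨i, s, t, ht, rfl⟩, hz⟩
        have hx : s • ι a + t • ι (w i) = ι (s • a + t • w i) := by simp
        rw [hx, Metric.mem_ball, ι.dist_map] at hz
        rw [hx]
        exact ⟨⟨_, ((key _).2 ⟨⟨i, s, t, ht, rfl⟩, hz⟩).1, rfl⟩,
          by rwa [Metric.mem_ball, ι.dist_map]⟩

variable {η δ : ℝ}

theorem mem_convexDomain_image_iff {z : EuclideanSpace ℝ (Fin n)} :
    z ∈ convexDomain (ι '' K) η ↔ ‖z‖ < 1 ∧ proj ι z ∈ convexDomain K η := by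
  simp only [convexDomain, mem_ofPred_eq, isYPoint_image_iff, forall_mem_image, ι.norm_map,
    forall_exists_index, and_imp, forall_apply_eq_imp_iff₂, mem_ball_zero_iff, inner_proj_left]
  constructor
  · rintro ⟨h1, h2, h3⟩
    exact ⟨h1, (norm_proj_le ι z).trans_lt h1, h2, h3⟩
  · rintro ⟨h1, -, h2, h3⟩
    exact ⟨h1, h2, h3⟩

theorem map_mem_convexDomain_image_iff {x : EuclideanSpace ℝ (Fin d)} :
    ι x ∈ convexDomain (ι '' K) η ↔ x ∈ convexDomain K η := by
  rw [mem_convexDomain_image_iff, ι.norm_map, proj_apply]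
  exact and_iff_right_of_imp fun h => by simpa using h.1

theorem proj_mem_closure_convexDomain {z : EuclideanSpace ℝ (Fin n)}
    (hz : z ∈ closure (convexDomain (ι '' K) η)) : proj ι z ∈ closure (convexDomain K η) :=
  map_mem_closure (proj ι).continuous hz fun _ h => ((mem_convexDomain_image_iff ι).1 h).2

theorem map_mem_closure_convexDomain_iff {x : EuclideanSpace ℝ (Fin d)} :
    ι x ∈ closure (convexDomain (ι '' K) η) ↔ x ∈ closure (convexDomain K η) :=
  ⟨fun h => by simpa [proj_apply] using proj_mem_closure_convexDomain ι h, fun h =>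
    map_mem_closure ι.continuous h fun _ h => (map_mem_convexDomain_image_iff ι).2 h⟩

theorem image_inter_closure_convexDomain : ι '' K ∩ closure (convexDomain (ι '' K) η) =
    ι '' (K ∩ closure (convexDomain K η)) := by
  ext z
  constructor
  · rintro ⟨⟨x, hx, rfl⟩, hz⟩
    exact ⟨x, ⟨hx, (map_mem_closure_convexDomain_iff ι).1 hz⟩, rfl⟩
  · rintro ⟨x, ⟨hx, hz⟩, rfl⟩
    exact ⟨⟨x, hx, rfl⟩, (map_mem_closure_convexDomain_iff ι).2 hz⟩

theorem map_mem_frontier_convexDomain {x : EuclideanSpace ℝ (Fin d)}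
    (hx : x ∈ frontier (convexDomain K η)) : ι x ∈ frontier (convexDomain (ι '' K) η) := by
  refine ⟨(map_mem_closure_convexDomain_iff ι).2 hx.1, fun h => hx.2 ?_⟩
  refine mem_interior.2 ⟨ι ⁻¹' interior (convexDomain (ι '' K) η), fun y hy => ?_,
    isOpen_interior.preimage ι.continuous, h⟩
  exact (map_mem_convexDomain_image_iff ι).1 (interior_subset hy)

/-- Inside the open unit ball the domain of `ι '' K` is the cylinder over the domain of `K`. -/
theorem proj_mem_frontier_convexDomain {z : EuclideanSpace ℝ (Fin n)}
    (hz : z ∈ frontier (convexDomain (ι '' K) η)) (h1 : ‖z‖ < 1) :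
    proj ι z ∈ frontier (convexDomain K η) := by
  refine ⟨proj_mem_closure_convexDomain ι hz.1, fun h => hz.2 ?_⟩
  refine mem_interior.2 ⟨Metric.ball 0 1 ∩ proj ι ⁻¹' interior (convexDomain K η),
    fun y hy => ?_, Metric.isOpen_ball.inter (isOpen_interior.preimage (proj ι).continuous),
    by simpa using h1, h⟩
  exact (mem_convexDomain_image_iff ι).2 ⟨by simpa using hy.1, interior_subset hy.2⟩

theorem notMem_interior_of_proj_mem_frontier {z : EuclideanSpace ℝ (Fin n)}
    (hz : proj ι z ∈ frontier (convexDomain K η)) :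
    z ∉ interior (convexDomain (ι '' K) η) := by
  intro h
  have hsurj : Function.Surjective (proj ι) := fun x => ⟨ι x, proj_apply ι x⟩
  refine hz.2 (mem_interior.2 ⟨proj ι '' interior (convexDomain (ι '' K) η), ?_,
    (proj ι).isOpenMap hsurj _ isOpen_interior, ⟨z, h, rfl⟩⟩)
  rintro _ ⟨y, hy, rfl⟩
  exact ((mem_convexDomain_image_iff ι).1 (interior_subset hy)).2

theorem inner_le_of_mem_closure_convexDomain {x y : EuclideanSpace ℝ (Fin d)}
    (hx : x ∈ closure (convexDomain K η)) (hy : y ∈ K) (hy1 : ‖y‖ = 1) :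
    inner ℝ x y ≤ 1 - η :=
  closure_minimal (s := convexDomain K η) (t := {x | inner ℝ x y ≤ 1 - η})
    (fun _ h => (h.2.1 y hy hy1).le) (isClosed_le (by fun_prop) continuous_const) hx

theorem inner_le_mul_norm_of_mem_closure_convexDomain (hK : IsConeAtZero K)
    {x y : EuclideanSpace ℝ (Fin d)}
    (hx : x ∈ closure (convexDomain K η)) (hy : y ∈ K) : inner ℝ x y ≤ (1 - η) * ‖y‖ := by
  rcases eq_or_ne y 0 with rfl | h0
  · simp
  have h1 := inner_le_of_mem_closure_convexDomain hx (hK.2 y hy ‖y‖⁻¹ (by positivity))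
    (norm_smul_inv_norm h0)
  have h2 : 0 < ‖y‖ := norm_pos_iff.2 h0
  rw [inner_smul_right, inv_mul_le_iff₀ h2] at h1
  linarith

/-- The cone stays at distance `η` from the unit sphere inside the domain. -/
theorem norm_le_of_mem_closure_convexDomain (hK : IsConeAtZero K) (hη : η < 1)
    {x : EuclideanSpace ℝ (Fin d)} (hx : x ∈ closure (convexDomain K η)) (hxK : x ∈ K) :
    ‖x‖ ≤ 1 - η := by
  have := inner_le_mul_norm_of_mem_closure_convexDomain hK hx hxK
  rw [real_inner_self_eq_norm_sq] at this
  rcases eq_or_lt_of_le (norm_nonneg x) with h | h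
  · linarith
  · nlinarith

theorem closure_convexDomain_subset : closure (convexDomain K η) ⊆ Metric.closedBall 0 1 :=
  closure_minimal (fun _ h => Metric.ball_subset_closedBall h.1) Metric.isClosed_closedBall

theorem convex_convexDomain : Convex ℝ (convexDomain K η) := by
  have hlin : ∀ (y : EuclideanSpace ℝ (Fin d)) (c : ℝ), Convex ℝ {x | inner ℝ x y < c} :=
    fun y c => convex_halfSpace_lt ⟨fun _ _ => inner_add_left _ _ _,
      fun _ _ => by rw [real_inner_smul_left, smul_eq_mul]⟩ c
  intro x hx y hy a b ha hb hab
  exact ⟨convex_ball _ _ hx.1 hy.1 ha hb hab,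
    fun v hv hv1 => hlin v _ (hx.2.1 v hv hv1) (hy.2.1 v hv hv1) ha hb hab,
    fun v hv => hlin v _ (hx.2.2 v hv) (hy.2.2 v hv) ha hb hab⟩

theorem exists_ball_subset_convexDomain (hη : 0 < η) (hη1 : η < 1) (h0 : 0 ∈ convexDomain K η) :
    ∃ ρ > 0, Metric.ball 0 ρ ⊆ convexDomain K η := by
  classical
  refine ⟨if ∃ a, IsYPoint K a then 1 - 2 * η else 1 - η, ?_, fun x hx => ?_⟩
  · split_ifs with h
    · obtain ⟨a, ha⟩ := h
      simpa using h0.2.2 a ha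
    · linarith
  have hle : (if ∃ a, IsYPoint K a then 1 - 2 * η else 1 - η) ≤ 1 - η := by
    split_ifs <;> linarith
  rw [mem_ball_zero_iff] at hx
  have hxy : ∀ y : EuclideanSpace ℝ (Fin d), ‖y‖ = 1 → inner ℝ x y ≤ ‖x‖ := fun y hy => by
    have := real_inner_le_norm x y
    rwa [hy, mul_one] at this
  refine ⟨by rw [mem_ball_zero_iff]; linarith, fun y _ hy => by linarith [hxy y hy], fun a ha => ?_⟩
  rw [if_pos ⟨a, ha⟩] at hx
  exact (hxy a ha.1).trans_lt hx

end

/-! ### Admissible widths -/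

noncomputable section

variable {d n : ℕ} {K : Set (EuclideanSpace ℝ (Fin d))} {η δ : ℝ}

theorem IsReduced2.exists_norm_eq_one (hc : IsConeAtZero K) (hr : IsReduced2 K) :
    ∃ y ∈ K, ‖y‖ = 1 := by
  obtain ⟨x, hx, h0⟩ : ∃ x ∈ K, x ≠ 0 := by
    by_contra! h
    have h1 : K ∩ Metric.ball 0 1 ⊆ {0} := fun x hx => h x hx.1
    have h2 := (hr 0 hc.1 1 one_pos).trans_le (measure_mono h1)
    have h3 : μH[2] ({0} : Set (EuclideanSpace ℝ (Fin d))) = 0 := by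
      have := Measure.nullSingletonClass_hausdorff (EuclideanSpace ℝ (Fin d)) (d := 2) (by norm_num)
      exact measure_singleton _
    exact absurd h3 h2.ne'
  exact ⟨‖x‖⁻¹ • x, hc.2 x hx _ (by positivity), norm_smul_inv_norm h0⟩

theorem convexDomain_anti {η' : ℝ} (h : η ≤ η') : convexDomain K η' ⊆ convexDomain K η :=
  fun _ hx => ⟨hx.1, fun y hy hy1 => (hx.2.1 y hy hy1).trans_le (by linarith),
    fun a ha => (hx.2.2 a ha).trans_le (by linarith)⟩

theorem lt_one_of_zero_mem_convexDomain (h : ∃ y ∈ K, ‖y‖ = 1) (h0 : 0 ∈ convexDomain K η) :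
    η < 1 := by
  obtain ⟨y, hy, hy1⟩ := h
  have := h0.2.1 y hy hy1
  rw [inner_zero_left] at this
  linarith

theorem exists_isAdmissibleWidth (hη : 0 < η) (h : η < etaOne K) :
    ∃ η', η < η' ∧ IsAdmissibleWidth K η' := by
  have hne : {η : ℝ | 0 < η ∧ IsAdmissibleWidth K η}.Nonempty := by
    by_contra! h0
    rw [etaOne, h0, Real.sSup_empty] at h
    exact lt_asymm hη h
  obtain ⟨η', h1, h2⟩ := exists_lt_of_lt_csSup hne h
  exact ⟨η', h2, h1.2⟩

theorem IsAdmissibleWidth.le_etaOne (h : ∃ y ∈ K, ‖y‖ = 1) (hη : 0 < η)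
    (hw : IsAdmissibleWidth K η) : η ≤ etaOne K :=
  le_csSup ⟨1, fun _ h' => (lt_one_of_zero_mem_convexDomain h h'.2.1).le⟩ ⟨hη, hw⟩

variable (ι : EuclideanSpace ℝ (Fin d) →ₗᵢ[ℝ] EuclideanSpace ℝ (Fin n))

theorem mem_planarPart_image_iff {x : EuclideanSpace ℝ (Fin n)} {a : EuclideanSpace ℝ (Fin d)}
    : x ∈ planarPart (ι '' K) η (ι a) ↔ ‖x‖ ≤ 1 ∧ proj ι x ∈ planarPart K η a := by
  simp only [planarPart, mem_ofPred_eq, forall_mem_image, ι.norm_map, mem_closedBall_zero_iff,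
    inner_proj_left]
  constructor
  · rintro ⟨h1, h2⟩
    exact ⟨h1, (norm_proj_le ι x).trans h1, h2⟩
  · rintro ⟨h1, -, h2⟩
    exact ⟨h1, h2⟩

theorem LinearIsometry.connectedComponentIn_image (S : Set (EuclideanSpace ℝ (Fin d)))
    {p : EuclideanSpace ℝ (Fin d)} (hp : p ∈ S) :
    connectedComponentIn (ι '' S) (ι p) = ι '' connectedComponentIn S p := by
  apply Subset.antisymm
  · have h := (isPreconnected_connectedComponentIn (F := ι '' S) (x := ι p)).image (proj ι)
      (proj ι).continuous.continuousOn
    have h2 : proj ι '' connectedComponentIn (ι '' S) (ι p) ⊆ connectedComponentIn S p := by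
      refine h.subset_connectedComponentIn
        ⟨ι p, mem_connectedComponentIn (mem_image_of_mem ι hp), proj_apply ι p⟩ ?_
      rintro _ ⟨z, hz, rfl⟩
      obtain ⟨x, hx, rfl⟩ := connectedComponentIn_subset _ _ hz
      rwa [proj_apply]
    intro z hz
    obtain ⟨x, hx, rfl⟩ := connectedComponentIn_subset _ _ hz
    exact ⟨x, h2 ⟨_, hz, proj_apply ι x⟩, rfl⟩
  · exact (isPreconnected_connectedComponentIn.image ι ι.continuous.continuousOn
      ).subset_connectedComponentIn ⟨p, mem_connectedComponentIn hp, rfl⟩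
      (image_mono (connectedComponentIn_subset _ _))

theorem exists_of_mem_netPieces_image {C : Set (EuclideanSpace ℝ (Fin n))}
    (hC : C ∈ netPieces (ι '' K)) : ∃ D ∈ netPieces K, C = ι '' D := by
  have e : {x | x ∈ ι '' K ∧ ‖x‖ = 1 ∧ ¬ IsYPoint (ι '' K) x} =
      ι '' {x | x ∈ K ∧ ‖x‖ = 1 ∧ ¬ IsYPoint K x} := by
    ext z
    constructor
    · rintro ⟨⟨x, hx, rfl⟩, h1, h2⟩
      exact ⟨x, ⟨hx, by rwa [ι.norm_map] at h1,
        fun h => h2 ((isYPoint_image_iff ι).2 ⟨x, h, rfl⟩)⟩, rfl⟩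
    · rintro ⟨x, ⟨hx, h1, h2⟩, rfl⟩
      refine ⟨⟨x, hx, rfl⟩, by rwa [ι.norm_map], fun h => ?_⟩
      obtain ⟨a, ha, hax⟩ := (isYPoint_image_iff ι).1 h
      rw [ι.injective hax] at ha
      exact h2 ha
  obtain ⟨p, hp, rfl⟩ := hC
  rw [e] at hp ⊢
  obtain ⟨p, hp, rfl⟩ := hp
  exact ⟨_, ⟨p, hp, rfl⟩, LinearIsometry.connectedComponentIn_image ι _ hp⟩

theorem closure_subset_of_mem_netPieces (hK : IsClosed K) {C : Set (EuclideanSpace ℝ (Fin d))}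
    (hC : C ∈ netPieces K) : closure C ⊆ {y | y ∈ K ∧ ‖y‖ = 1} := by
  obtain ⟨p, -, rfl⟩ := hC
  refine closure_minimal (fun x hx => ?_)
    (hK.inter (isClosed_eq continuous_norm continuous_const))
  have := connectedComponentIn_subset _ _ hx
  exact ⟨this.1, this.2.1⟩

/-- Bands project into bands. If the projection of a point `x` of a band lies on the ray through a
point `z` of a planar part, then it lies beyond `z`, so that `x` itself can be scaled down into the
unit ball onto the corresponding planar part. -/
theorem proj_mem_band (hK : IsClosed K) (hη : η < 1) {C : Set (EuclideanSpace ℝ (Fin d))}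
    (hC : C ∈ netPieces K) {x : EuclideanSpace ℝ (Fin n)} (hx : x ∈ band (ι '' K) η (ι '' C)) :
    proj ι x ∈ band K η C ∧ ∃ y ∈ K, ‖y‖ = 1 ∧ inner ℝ (proj ι x) y = 1 - η := by
  obtain ⟨h1, ⟨y', hy', hxy⟩, h3⟩ := hx
  rw [← ι.isometry.isClosedEmbedding.isClosed_iff_image_isClosed] at h3
  rw [ι.isometry.isClosedEmbedding.closure_image_eq] at hy'
  obtain ⟨y, hy, rfl⟩ := hy'
  rw [← inner_proj_left] at hxy
  obtain ⟨hyK, hy1⟩ := closure_subset_of_mem_netPieces hK hC hy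
  rw [mem_closedBall_zero_iff] at h1
  refine ⟨⟨by simpa using (norm_proj_le ι x).trans h1, ⟨y, hy, hxy⟩, fun hCc => ?_⟩,
    y, hyK, hy1, hxy⟩
  rintro ⟨a, ha, z, hz, t, ht, hxt⟩
  -- the projection of `x` is `t • z` with `t ≥ 1`, so `t⁻¹ • x` lies in the closed unit ball
  refine h3 hCc ⟨ι a, (isYPoint_image_iff ι).2 ⟨a, ha, rfl⟩, t⁻¹ • x, ?_, t, ht, ?_⟩
  all_goals
    have hzy := hz.2.2 y hyK hy1
    rw [hxt, real_inner_smul_left] at hxy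
    have ht1 : 1 ≤ t := by nlinarith
    have ht0 : t ≠ 0 := by positivity
  · rw [mem_planarPart_image_iff, map_smul, hxt, smul_smul, inv_mul_cancel₀ ht0, one_smul,
      norm_smul, norm_inv, Real.norm_of_nonneg ht]
    refine ⟨?_, hz⟩
    rw [inv_mul_le_iff₀ (by positivity)]
    linarith
  · rw [smul_smul, mul_inv_cancel₀ ht0, one_smul]

theorem IsAdmissibleWidth.image (hK : IsClosed K) (h1 : η < 1)
    (h : IsAdmissibleWidth K η) : IsAdmissibleWidth (ι '' K) η := by
  obtain ⟨h0, hb, hp⟩ := h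
  refine ⟨by rw [← map_zero ι]; exact (map_mem_convexDomain_image_iff ι).2 h0, ?_, ?_⟩
  · intro C₁ hC₁ C₂ hC₂ C₃ hC₃ h12 h13 h23
    obtain ⟨D₁, hD₁, rfl⟩ := exists_of_mem_netPieces_image ι hC₁
    obtain ⟨D₂, hD₂, rfl⟩ := exists_of_mem_netPieces_image ι hC₂
    obtain ⟨D₃, hD₃, rfl⟩ := exists_of_mem_netPieces_image ι hC₃
    rw [eq_empty_iff_forall_notMem]
    rintro x ⟨hx, ⟨hx1, hx2⟩, hx3⟩
    have k1 := proj_mem_band ι hK h1 hD₁ hx1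
    obtain ⟨y, hy, hy1, hxy⟩ := k1.2
    -- the projection may fall into the interior of the domain in general, but not for band points
    refine (eq_empty_iff_forall_notMem.1 (hb D₁ hD₁ D₂ hD₂ D₃ hD₃ (ne_of_apply_ne _ h12)
      (ne_of_apply_ne _ h13) (ne_of_apply_ne _ h23)) (proj ι x))
        ⟨⟨proj_mem_closure_convexDomain ι hx.1, fun hi => ?_⟩, ⟨k1.1,
          (proj_mem_band ι hK h1 hD₂ hx2).1⟩, (proj_mem_band ι hK h1 hD₃ hx3).1⟩
    exact ((interior_subset hi).2.1 y hy hy1).ne hxy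
  · intro a b ha hb hab
    obtain ⟨a, ha', rfl⟩ := (isYPoint_image_iff ι).1 ha
    obtain ⟨b, hb', rfl⟩ := (isYPoint_image_iff ι).1 hb
    refine Set.disjoint_left.2 fun x hxa hxb => ?_
    exact Set.disjoint_left.1 (hp a b ha' hb' (ne_of_apply_ne _ hab))
      ((mem_planarPart_image_iff ι).1 hxa).2 ((mem_planarPart_image_iff ι).1 hxb).2

/-- A width below `η₁(K)` is below `η₁` in the larger space. -/
theorem lt_etaOne_image (hK : IsClosed K) (hu : ∃ y ∈ K, ‖y‖ = 1) (hη : 0 < η)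
    (h : η < etaOne K) : η < 1 ∧ 0 ∈ convexDomain K η ∧ η < etaOne (ι '' K) := by
  obtain ⟨η', hlt, hw⟩ := exists_isAdmissibleWidth hη h
  have h1 := lt_one_of_zero_mem_convexDomain hu hw.1
  refine ⟨hlt.trans h1, convexDomain_anti hlt.le hw.1,
    hlt.trans_le (IsAdmissibleWidth.le_etaOne ?_ (hη.trans hlt) (hw.image ι hK h1))⟩
  obtain ⟨y, hy, hy1⟩ := hu
  exact ⟨ι y, ⟨y, hy, rfl⟩, by rwa [ι.norm_map]⟩

end

/-! ### Making a Lipschitz map slide along the boundary -/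

noncomputable section

section Lipschitz

variable {X V : Type*} [PseudoMetricSpace X] [NormedAddCommGroup V] [NormedSpace ℝ V] {S : Set X}

theorem LipschitzOnWith.smul_of_bounded {f : X → ℝ} {v : X → V} {k l : ℝ≥0} (a b : ℝ≥0)
    (hf : LipschitzOnWith k f S) (hv : LipschitzOnWith l v S)
    (ha : ∀ x ∈ S, |f x| ≤ a) (hb : ∀ x ∈ S, ‖v x‖ ≤ b) :
    LipschitzOnWith (a * l + k * b) (fun x => f x • v x) S := by
  refine LipschitzOnWith.of_dist_le_mul fun x hx y hy => ?_
  have h1 := hf.dist_le_mul x hx y hy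
  have h2 := hv.dist_le_mul x hx y hy
  rw [dist_eq_norm, Real.norm_eq_abs] at h1
  rw [dist_eq_norm] at h2 ⊢
  have e : f x • v x - f y • v y = f x • (v x - v y) + (f x - f y) • v y := by
    rw [smul_sub, sub_smul]; abel
  calc ‖f x • v x - f y • v y‖ ≤ |f x| * ‖v x - v y‖ + |f x - f y| * ‖v y‖ := by
        rw [e]; refine (norm_add_le _ _).trans ?_; rw [norm_smul, norm_smul]; rfl
    _ ≤ a * (l * dist x y) + (k * dist x y) * b := by
        gcongr
        · exact ha x hx
        · exact hb y hy
    _ = _ := by push_cast; ring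

theorem LipschitzOnWith.inv_of_le {f : X → ℝ} {k : ℝ≥0} {c : ℝ≥0} (hc : 0 < c)
    (hf : LipschitzOnWith k f S) (h : ∀ x ∈ S, c ≤ f x) :
    LipschitzOnWith (c⁻¹ * c⁻¹ * k) (fun x => (f x)⁻¹) S := by
  refine LipschitzOnWith.of_dist_le_mul fun x hx y hy => ?_
  have hc' : (0 : ℝ) < c := hc
  have hx0 : 0 < f x := hc'.trans_le (h x hx)
  have hy0 : 0 < f y := hc'.trans_le (h y hy)
  have h1 := hf.dist_le_mul y hy x hx
  rw [Real.dist_eq, dist_comm y x] at h1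
  have e : (f x)⁻¹ - (f y)⁻¹ = (f x)⁻¹ * (f y)⁻¹ * (f y - f x) := by field_simp
  rw [Real.dist_eq, e, abs_mul, abs_of_pos (by positivity)]
  push_cast
  rw [mul_assoc _ (k : ℝ)]
  gcongr
  · exact h x hx
  · exact h y hy

end Lipschitz

section Slide

variable {V : Type*}

section Cutoff

variable [PseudoMetricSpace V]

/-- The cut-off function which is `1` on `E` and vanishes at distance at least `a` from `E`. -/
def distCutoff (E : Set V) (a : ℝ) (x : V) : ℝ := max 0 (1 - Metric.infDist x E / a)

theorem distCutoff_nonneg (E : Set V) (a : ℝ) (x : V) : 0 ≤ distCutoff E a x := le_max_left _ _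

theorem distCutoff_le_one (E : Set V) {a : ℝ} (ha : 0 < a) (x : V) : distCutoff E a x ≤ 1 :=
  max_le zero_le_one (by
    have : 0 ≤ Metric.infDist x E / a := div_nonneg Metric.infDist_nonneg ha.le
    linarith)

theorem distCutoff_of_mem {E : Set V} (a : ℝ) {x : V} (hx : x ∈ E) : distCutoff E a x = 1 := by
  simp [distCutoff, Metric.infDist_zero_of_mem hx]

theorem exists_dist_lt_of_distCutoff_ne_zero {E : Set V} (hE : E.Nonempty) {a : ℝ} (ha : 0 < a)
    {x : V} (hx : distCutoff E a x ≠ 0) : ∃ y ∈ E, dist x y < a := by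
  rw [← Metric.infDist_lt_iff hE]
  by_contra! h
  exact hx (max_eq_left (by rw [sub_nonpos]; exact (one_le_div ha).2 h))

theorem lipschitzWith_distCutoff (E : Set V) (a : ℝ≥0) : LipschitzWith a⁻¹ (distCutoff E a) := by
  refine LipschitzWith.const_max (LipschitzWith.of_dist_le_mul fun x y => ?_) 0
  have h := (Metric.lipschitz_infDist_pt E).dist_le_mul x y
  rw [Real.dist_eq, NNReal.coe_one, one_mul] at h
  rw [Real.dist_eq]
  have e : (1 - Metric.infDist x E / a) - (1 - Metric.infDist y E / a) =
      -((a : ℝ)⁻¹ * (Metric.infDist x E - Metric.infDist y E)) := by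
    rw [div_eq_inv_mul, div_eq_inv_mul]; ring
  rw [e, abs_neg, abs_mul, abs_of_nonneg (by positivity)]
  push_cast
  gcongr

end Cutoff

variable [NormedAddCommGroup V] [NormedSpace ℝ V]

/-- The straight line homotopy from the identity to `g`, slowed down away from `E`. -/
def driftMap (E : Set V) (g : V → V) (a t : ℝ) (x : V) : V :=
  x + (t * distCutoff E a x) • (g x - x)

/-- The straight line homotopy from the identity to `g` near `E`, corrected by a radial dilation
which is large enough to keep the boundary of the convex set `U` on the boundary. The constant `C`
confines the dilation to a neighbourhood of the boundary. -/
def slideMap (U E : Set V) (g : V → V) (a C t : ℝ) (x : V) : V :=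
  max 1 ((1 - C * (1 - gauge U x)) / max (gauge U (driftMap E g a t x)) (1 / 2)) •
    driftMap E g a t x

variable {U K E : Set V} {g : V → V} {ρ L a : ℝ≥0} {C δ δ' t : ℝ} {x : V}

theorem driftMap_mem_closure (hU : Convex ℝ U) (ha : 0 < a) (hg : MapsTo g (closure U) (closure U))
    (ht : t ∈ Icc (0 : ℝ) 1) (hx : x ∈ closure U) : driftMap E g a t x ∈ closure U :=
  hU.closure.add_smul_sub_mem hx (hg hx) ⟨mul_nonneg ht.1 (distCutoff_nonneg _ _ _),
    mul_le_one₀ ht.2 (distCutoff_nonneg _ _ _) (distCutoff_le_one _ ha _)⟩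

theorem abs_gauge_sub_gauge_le (hU : Convex ℝ U) (hρ : 0 < ρ) (hball : Metric.ball (0 : V) ρ ⊆ U)
    (x y : V) : |gauge U x - gauge U y| ≤ ‖x - y‖ / ρ := by
  have := (hU.lipschitzWith_gauge hρ hball).dist_le_mul x y
  rw [Real.dist_eq, dist_eq_norm] at this
  rw [div_eq_inv_mul]
  exact this

/-- A point of the cone `K` inside the convex set `U` is as close to the boundary of `U` along its
ray as its gauge is to `1`. -/
theorem exists_mem_frontier_ray (hU : Convex ℝ U) (hU0 : U ∈ 𝓝 0)
    (hU1 : closure U ⊆ Metric.closedBall 0 1) (hK : ∀ x ∈ K, ∀ t : ℝ, 0 ≤ t → t • x ∈ K)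
    (hx : x ∈ K ∩ closure U) (hx0 : gauge U x ≠ 0) :
    ∃ y ∈ K ∩ closure U ∩ frontier U, ‖x - y‖ ≤ 1 - gauge U x := by
  have hp : 0 < gauge U x := (gauge_nonneg x).lt_of_ne' hx0
  have hp1 : gauge U x ≤ 1 := (gauge_le_one_iff_mem_closure hU hU0).2 hx.2
  have hy : (gauge U x)⁻¹ • x ∈ frontier U := by
    rw [← gauge_eq_one_iff_mem_frontier hU hU0, gauge_smul_of_nonneg (by positivity), smul_eq_mul,
      inv_mul_cancel₀ hx0]
  refine ⟨_, ⟨⟨hK x hx.1 _ (by positivity), hy.1⟩, hy⟩, ?_⟩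
  have hn := hU1 hy.1
  rw [mem_closedBall_zero_iff] at hn
  have e : x - (gauge U x)⁻¹ • x = -((1 - gauge U x) • (gauge U x)⁻¹ • x) := by
    rw [smul_smul, ← sub_eq_zero]
    have : x - (gauge U x)⁻¹ • x - -(((1 - gauge U x) * (gauge U x)⁻¹) • x) =
      (1 - (gauge U x)⁻¹ + (1 - gauge U x) * (gauge U x)⁻¹) • x := by module
    rw [this]
    convert zero_smul ℝ x using 2
    field_simp
    ring
  rw [e, norm_neg, norm_smul, Real.norm_of_nonneg (by linarith)]
  nlinarith

theorem one_sub_mul_le_gauge (hU : Convex ℝ U) (hU0 : U ∈ 𝓝 0)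
    (hx : x ∈ closure U) (hC : 1 ≤ C) : 1 - C * (1 - gauge U x) ≤ gauge U x := by
  have : gauge U x ≤ 1 := (gauge_le_one_iff_mem_closure hU hU0).2 hx
  nlinarith

theorem norm_driftMap_sub_le (ht : t ∈ Icc (0 : ℝ) 1) (ha : 0 < a) :
    ‖driftMap E g a t x - x‖ ≤ ‖g x - x‖ := by
  rw [driftMap, add_sub_cancel_left, norm_smul, Real.norm_of_nonneg
    (mul_nonneg ht.1 (distCutoff_nonneg _ _ _))]
  exact mul_le_of_le_one_left (norm_nonneg _)
    (mul_le_one₀ ht.2 (distCutoff_nonneg _ _ _) (distCutoff_le_one _ ha _))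

/-- The homotopy `driftMap` moves no boundary point far inwards: the points which move at all are
close to `E`, hence close to a boundary point of `E`, which `g` moves by less than `δ'`. -/
theorem half_le_gauge_driftMap (hU : Convex ℝ U) (hρ : 0 < ρ)
    (hball : Metric.ball (0 : V) ρ ⊆ U) (hU1 : closure U ⊆ Metric.closedBall 0 1)
    (hK : ∀ x ∈ K, ∀ t : ℝ, 0 ≤ t → t • x ∈ K) (hK0 : 0 ∈ K)
    (hgL : LipschitzOnWith L g (closure U))
    (hgδ : ∀ x ∈ K ∩ closure U ∩ frontier U, ‖g x - x‖ < δ') (hδ' : δ' ≤ ρ / 4)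
    (ha : 0 < a) (haρ : (a : ℝ) < ρ) (haL : (L + 1) * (a * (1 + 1 / ρ)) ≤ (ρ / 4 : ℝ))
    (ht : t ∈ Icc (0 : ℝ) 1) (hx : x ∈ frontier U) :
    1 / 2 ≤ gauge U (driftMap (K ∩ closure U) g a t x) := by
  have hρ' : (0 : ℝ) < ρ := hρ
  have hU0 : U ∈ 𝓝 0 := Filter.mem_of_superset (Metric.ball_mem_nhds 0 hρ') hball
  have hx1 : gauge U x = 1 := (gauge_eq_one_iff_mem_frontier hU hU0).2 hx
  by_cases hcut : distCutoff (K ∩ closure U) a x = 0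
  · rw [driftMap, hcut, mul_zero, zero_smul, add_zero, hx1]; norm_num
  have hne : (K ∩ closure U).Nonempty := ⟨0, hK0, subset_closure (mem_of_mem_nhds hU0)⟩
  obtain ⟨y, hy, hxy⟩ := exists_dist_lt_of_distCutoff_ne_zero hne ha hcut
  replace hxy : ‖x - y‖ < a := by rwa [← dist_eq_norm]
  have h1 := (abs_le.1 (abs_gauge_sub_gauge_le hU hρ hball x y)).2
  rw [hx1] at h1
  have h2 : ‖x - y‖ / ρ < a / ρ := div_lt_div_of_pos_right hxy hρ'
  have h3 : (a : ℝ) / ρ < 1 := (div_lt_one hρ').2 haρ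
  obtain ⟨y', hy', hyy'⟩ := exists_mem_frontier_ray hU hU0 hU1 hK hy (by linarith)
  have h4 : ‖x - y'‖ ≤ a * (1 + 1 / ρ) := by
    have := norm_sub_le_norm_sub_add_norm_sub x y y'
    have e : (a : ℝ) * (1 + 1 / ρ) = a + a / ρ := by ring
    linarith
  have h5 : ‖g x - x‖ ≤ ρ / 2 := by
    have k1 := norm_sub_le_norm_sub_add_norm_sub (g x) (g y') x
    have k2 := norm_sub_le_norm_sub_add_norm_sub (g y') y' x
    have k3 := hgL.dist_le_mul x hx.1 y' hy'.1.2
    rw [dist_eq_norm, dist_eq_norm] at k3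
    have k4 := hgδ y' hy'
    rw [norm_sub_rev y' x] at k2
    have k5 : (L : ℝ) * ‖x - y'‖ ≤ L * (a * (1 + 1 / ρ)) := by gcongr
    linarith
  have h6 := (abs_le.1 (abs_gauge_sub_gauge_le hU hρ hball (driftMap (K ∩ closure U) g a t x) x)).1
  have h7 := norm_driftMap_sub_le (E := K ∩ closure U) (g := g) (x := x) ht ha
  have h8 : ‖driftMap (K ∩ closure U) g a t x - x‖ / ρ ≤ 1 / 2 := by
    rw [div_le_iff₀ hρ']; linarith
  rw [hx1] at h6
  linarith

theorem gauge_slideMap : gauge U (slideMap U E g a C t x) =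
    max 1 ((1 - C * (1 - gauge U x)) / max (gauge U (driftMap E g a t x)) (1 / 2)) *
      gauge U (driftMap E g a t x) :=
  gauge_smul_of_nonneg (zero_le_one.trans (le_max_left _ _)) _

/-- The dilation factor never carries a point out of the closure of `U`. -/
theorem gauge_slideMap_le_one (hU : Convex ℝ U) (hU0 : U ∈ 𝓝 0) (ha : 0 < a) (hC : 1 ≤ C)
    (hg : MapsTo g (closure U) (closure U)) (ht : t ∈ Icc (0 : ℝ) 1) (hx : x ∈ closure U) :
    gauge U (slideMap U E g a C t x) ≤ 1 := by
  have h1 : gauge U (driftMap E g a t x) ≤ 1 :=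
    (gauge_le_one_iff_mem_closure hU hU0).2 (driftMap_mem_closure hU ha hg ht hx)
  have h0 := gauge_nonneg (s := U) (driftMap E g a t x)
  have hm : 1 - C * (1 - gauge U x) ≤ 1 := (one_sub_mul_le_gauge hU hU0 hx hC).trans
    ((gauge_le_one_iff_mem_closure hU hU0).2 hx)
  rw [gauge_slideMap, max_mul_of_nonneg _ _ h0, one_mul, max_le_iff]
  refine ⟨h1, ?_⟩
  have hq : 0 < max (gauge U (driftMap E g a t x)) (1 / 2) := lt_max_of_lt_right (by norm_num)
  rw [div_mul_eq_mul_div, div_le_one hq]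
  exact (mul_le_of_le_one_left h0 hm).trans (le_max_left _ _)

theorem slideMap_eq_driftMap
    (h : 1 - C * (1 - gauge U x) ≤ gauge U (driftMap E g a t x)) :
    slideMap U E g a C t x = driftMap E g a t x := by
  have hq : 0 < max (gauge U (driftMap E g a t x)) (1 / 2) := lt_max_of_lt_right (by norm_num)
  rw [slideMap, max_eq_left, one_smul]
  rw [div_le_one hq]
  exact h.trans (le_max_left _ _)

theorem slideMap_of_mem_frontier (hU : Convex ℝ U) (hU0 : U ∈ 𝓝 0)
    (hd : driftMap E g a t x ∈ closure U) (hx : x ∈ frontier U)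
    (h : 1 / 2 ≤ gauge U (driftMap E g a t x)) :
    slideMap U E g a C t x = (gauge U (driftMap E g a t x))⁻¹ • driftMap E g a t x := by
  have h1 := (gauge_le_one_iff_mem_closure hU hU0).2 hd
  rw [slideMap, (gauge_eq_one_iff_mem_frontier hU hU0).2 hx, max_eq_left h, sub_self, mul_zero,
    sub_zero, one_div, max_eq_right]
  exact (one_le_inv₀ (by linarith)).2 h1

/-- On `E` the radial correction is not needed at time `1`, since `g` moves the points on a ray of
`E` no further inwards than the slope `C` allows. -/
theorem slideMap_one (hU : Convex ℝ U) (hρ : 0 < ρ)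
    (hball : Metric.ball (0 : V) ρ ⊆ U) (hU1 : closure U ⊆ Metric.closedBall 0 1)
    (hK : ∀ x ∈ K, ∀ t : ℝ, 0 ≤ t → t • x ∈ K)
    (hgL : LipschitzOnWith L g (closure U))
    (hgU : ∀ x ∈ K ∩ closure U ∩ frontier U, g x ∈ frontier U) (hC : 1 ≤ C) (hCL : L / ρ ≤ C)
    (hx : x ∈ K ∩ closure U) : slideMap U (K ∩ closure U) g a C 1 x = g x := by
  have hρ' : (0 : ℝ) < ρ := hρ
  have hU0 : U ∈ 𝓝 0 := Filter.mem_of_superset (Metric.ball_mem_nhds 0 hρ') hball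
  have e : driftMap (K ∩ closure U) g a 1 x = g x := by
    rw [driftMap, distCutoff_of_mem _ hx, mul_one, one_smul, add_sub_cancel]
  have hp1 : gauge U x ≤ 1 := (gauge_le_one_iff_mem_closure hU hU0).2 hx.2
  rw [slideMap_eq_driftMap, e]
  rw [e]
  by_cases hx0 : gauge U x = 0
  · rw [hx0]
    linarith [gauge_nonneg (s := U) (g x)]
  obtain ⟨y, hy, hxy⟩ := exists_mem_frontier_ray hU hU0 hU1 hK hx hx0
  have h1 := (abs_le.1 (abs_gauge_sub_gauge_le hU hρ hball (g x) (g y))).1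
  rw [(gauge_eq_one_iff_mem_frontier hU hU0).2 (hgU y hy)] at h1
  have h2 := hgL.dist_le_mul x hx.2 y hy.1.2
  rw [dist_eq_norm, dist_eq_norm] at h2
  have h3 : ‖g x - g y‖ / ρ ≤ C * (1 - gauge U x) := calc
    ‖g x - g y‖ / ρ ≤ L * (1 - gauge U x) / ρ := by
      gcongr
      exact h2.trans (mul_le_mul_of_nonneg_left hxy L.2)
    _ = L / ρ * (1 - gauge U x) := by ring
    _ ≤ _ := mul_le_mul_of_nonneg_right hCL (by linarith)
  linarith

theorem norm_slideMap_sub_lt (hU : Convex ℝ U) (hρ : 0 < ρ)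
    (hball : Metric.ball (0 : V) ρ ⊆ U) (hU1 : closure U ⊆ Metric.closedBall 0 1)
    (hx : x ∈ frontier U) (hd : driftMap E g a t x ∈ closure U)
    (h : 1 / 2 ≤ gauge U (driftMap E g a t x)) (hlt : ‖driftMap E g a t x - x‖ < δ')
    (hδ : δ' * (1 + 2 / ρ) ≤ δ) : ‖slideMap U E g a C t x - x‖ < δ := by
  have hρ' : (0 : ℝ) < ρ := hρ
  have hU0 : U ∈ 𝓝 0 := Filter.mem_of_superset (Metric.ball_mem_nhds 0 hρ') hball
  rw [slideMap_of_mem_frontier hU hU0 hd hx h]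
  set y := driftMap E g a t x
  have h1 := (abs_le.1 (abs_gauge_sub_gauge_le hU hρ hball y x)).1
  rw [(gauge_eq_one_iff_mem_frontier hU hU0).2 hx] at h1
  have hy1 : gauge U y ≤ 1 := (gauge_le_one_iff_mem_closure hU hU0).2 hd
  have hyn := hU1 hd
  rw [mem_closedBall_zero_iff] at hyn
  have h2 : ‖(gauge U y)⁻¹ • y - y‖ ≤ 2 * (1 - gauge U y) := by
    have e : (gauge U y)⁻¹ • y - y = ((gauge U y)⁻¹ * (1 - gauge U y)) • y := by
      rw [mul_sub, inv_mul_cancel₀ (by linarith), mul_one, sub_smul, one_smul]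
    rw [e, norm_smul, Real.norm_of_nonneg (mul_nonneg (by positivity) (by linarith))]
    refine (mul_le_of_le_one_right (mul_nonneg (by positivity) (by linarith)) hyn).trans ?_
    refine mul_le_mul_of_nonneg_right ?_ (by linarith)
    rw [inv_le_comm₀ (by linarith) (by norm_num)]
    linarith
  have h3 := norm_sub_le_norm_sub_add_norm_sub ((gauge U y)⁻¹ • y) y x
  calc _ ≤ 2 * (‖y - x‖ / ρ) + ‖y - x‖ := by linarith
    _ = ‖y - x‖ * (1 + 2 / ρ) := by ring
    _ < δ' * (1 + 2 / ρ) := by gcongr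
    _ ≤ δ := hδ

theorem continuousOn_slideMap (hU : Convex ℝ U) (hU0 : U ∈ 𝓝 0)
    (hg : ContinuousOn g (closure U)) :
    ContinuousOn (fun p : ℝ × V => slideMap U E g a C p.1 p.2) (Icc (0 : ℝ) 1 ×ˢ closure U) := by
  have hp : Continuous (gauge U) := continuous_gauge hU hU0
  have hc : Continuous (distCutoff E a) := (lipschitzWith_distCutoff E a).continuous
  have hg' : ContinuousOn (fun p : ℝ × V => g p.2) (Icc (0 : ℝ) 1 ×ˢ closure U) :=
    hg.comp continuousOn_snd fun p h => h.2
  have hd : ContinuousOn (fun p : ℝ × V => driftMap E g a p.1 p.2)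
      (Icc (0 : ℝ) 1 ×ˢ closure U) := by
    have hc' : Continuous fun p : ℝ × V => distCutoff E a p.2 := hc.comp continuous_snd
    unfold driftMap
    exact continuousOn_snd.add ((continuousOn_fst.mul hc'.continuousOn).smul
      (hg'.sub continuousOn_snd))
  have hpd := hp.comp_continuousOn hd
  unfold slideMap
  refine ContinuousOn.smul (ContinuousOn.sup continuousOn_const (ContinuousOn.div (by fun_prop)
    (hpd.sup continuousOn_const) fun p _ => ?_)) hd
  exact (lt_max_of_lt_right (by norm_num)).ne'

theorem exists_lipschitzOnWith_slideMap (hU : Convex ℝ U) (hρ : 0 < ρ)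
    (hball : Metric.ball (0 : V) ρ ⊆ U) (hU1 : closure U ⊆ Metric.closedBall 0 1)
    (hg : MapsTo g (closure U) (closure U)) (hgL : LipschitzOnWith L g (closure U))
    (ha : 0 < a) {C : ℝ≥0} (hC : 1 ≤ (C : ℝ)) :
    ∃ l, LipschitzOnWith l (slideMap U E g a C 1) (closure U) := by
  have hρ' : (0 : ℝ) < ρ := hρ
  have hU0 : U ∈ 𝓝 0 := Filter.mem_of_superset (Metric.ball_mem_nhds 0 hρ') hball
  have hp := hU.lipschitzWith_gauge hρ hball
  have hn : ∀ x ∈ closure U, ‖x‖ ≤ 1 := fun x hx => mem_closedBall_zero_iff.1 (hU1 hx)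
  have hdm : MapsTo (driftMap E g a 1) (closure U) (closure U) := fun x hx =>
    driftMap_mem_closure hU ha hg (right_mem_Icc.2 zero_le_one) hx
  have hd : LipschitzOnWith (1 + (1 * (L + 1) + a⁻¹ * 2)) (driftMap E g a 1) (closure U) := by
    unfold driftMap
    simp only [one_mul]
    refine LipschitzOnWith.add LipschitzWith.id.lipschitzOnWith ?_
    have := LipschitzOnWith.smul_of_bounded (v := fun x => g x - x) 1 2
      ((lipschitzWith_distCutoff E a).lipschitzOnWith (s := closure U))
      (hgL.sub LipschitzWith.id.lipschitzOnWith)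
      (fun x _ => by
        rw [abs_of_nonneg (distCutoff_nonneg _ _ _)]
        exact distCutoff_le_one _ ha _)
      (fun x hx => by
        refine (norm_sub_le _ _).trans ?_
        have := hn _ (hg hx)
        have := hn _ hx
        push_cast
        linarith)
    simpa using this
  have hq : LipschitzOnWith (1 * (ρ⁻¹ * (1 + (1 * (L + 1) + a⁻¹ * 2))))
      (fun x => max (gauge U (driftMap E g a 1 x)) (1 / 2)) (closure U) :=
    (LipschitzWith.id.max_const (1 / 2 : ℝ)).comp_lipschitzOnWith (hp.comp_lipschitzOnWith hd)
  have hqi := hq.inv_of_le (c := 1 / 2) (by positivity) fun x _ => by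
    push_cast
    exact le_max_right _ _
  have hm : LipschitzOnWith (C * ρ⁻¹) (fun x => 1 - C * (1 - gauge U x))
      (closure U) := by
    refine LipschitzOnWith.of_dist_le_mul fun x _ y _ => ?_
    have e : (1 - C * (1 - gauge U x)) - (1 - C * (1 - gauge U y)) =
        C * (gauge U x - gauge U y) := by ring
    have h := hp.dist_le_mul x y
    rw [Real.dist_eq] at h ⊢
    rw [e, abs_mul, abs_of_nonneg (by linarith)]
    calc C * |gauge U x - gauge U y| ≤ C * ((ρ⁻¹ : ℝ≥0) * dist x y) := by gcongr
      _ = _ := by push_cast; ring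
  have hmb : ∀ x ∈ closure U, |1 - C * (1 - gauge U x)| ≤ C := by
    intro x hx
    have h0 := gauge_nonneg (s := U) x
    have h1 := (gauge_le_one_iff_mem_closure hU hU0).2 hx
    rw [abs_le]
    constructor <;> nlinarith
  have hr := (hm.smul_of_bounded _ 2 hqi hmb) fun x _ => by
    rw [Real.norm_of_nonneg (inv_nonneg.2 (le_max_of_le_right (by norm_num)))]
    refine inv_le_of_inv_le₀ (by norm_num) (le_max_of_le_right ?_)
    norm_num
  have hs : LipschitzOnWith _ (fun x => max 1 ((1 - C * (1 - gauge U x)) *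
      (max (gauge U (driftMap E g a 1 x)) (1 / 2))⁻¹)) (closure U) :=
    (LipschitzWith.id.const_max (1 : ℝ)).comp_lipschitzOnWith hr
  refine ⟨_, hs.smul_of_bounded (C * 2) 1 hd (fun x hx => ?_)
    fun x hx => by simpa using hn _ (hdm hx)⟩
  rw [abs_of_nonneg (zero_le_one.trans (le_max_left _ _))]
  have hq2 : (max (gauge U (driftMap E g a 1 x)) (1 / 2))⁻¹ ≤ 2 :=
    inv_le_of_inv_le₀ (by norm_num) (le_max_of_le_right (by norm_num))
  have hq0 : 0 ≤ (max (gauge U (driftMap E g a 1 x)) (1 / 2))⁻¹ :=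
    inv_nonneg.2 (le_max_of_le_right (by norm_num))
  push_cast
  refine max_le (by linarith) ?_
  exact mul_le_mul ((le_abs_self _).trans (hmb x hx)) hq2 hq0 C.2

/-- A Lipschitz map `g` which preserves `closure U`, and which moves the boundary points of
`K ∩ closure U` only a little and inside the boundary, agrees on `K ∩ closure U` with the end of a
sliding deformation. The other boundary points need not stay on the boundary under `g`. -/
theorem isSlidingDeformation_image {d : ℕ} {U K : Set (EuclideanSpace ℝ (Fin d))}
    {g : EuclideanSpace ℝ (Fin d) → EuclideanSpace ℝ (Fin d)} (hU : Convex ℝ U) (hρ : 0 < ρ)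
    (hball : Metric.ball 0 (ρ : ℝ) ⊆ U) (hU1 : closure U ⊆ Metric.closedBall 0 1)
    (hK : IsConeAtZero K) (hg : MapsTo g (closure U) (closure U))
    (hgL : LipschitzOnWith L g (closure U))
    (hgU : ∀ x ∈ K ∩ closure U ∩ frontier U, g x ∈ frontier U)
    (hgδ : ∀ x ∈ K ∩ closure U ∩ frontier U, ‖g x - x‖ < δ') (hδ' : δ' ≤ ρ / 4)
    (hδ : δ' * (1 + 2 / ρ) ≤ δ) :
    IsSlidingDeformation U (K ∩ closure U) δ (g '' (K ∩ closure U)) := by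
  have hρ' : (0 : ℝ) < ρ := hρ
  have hU0 : U ∈ 𝓝 0 := Filter.mem_of_superset (Metric.ball_mem_nhds 0 hρ') hball
  -- a cut-off radius so small that `half_le_gauge_driftMap` applies
  obtain ⟨a, ha, haρ, haL⟩ : ∃ a : ℝ≥0, 0 < a ∧ (a : ℝ) < ρ ∧
      (L + 1) * (a * (1 + 1 / ρ)) ≤ (ρ / 4 : ℝ) := by
    have hb : (0 : ℝ) < (L + 1) * (1 + 1 / ρ) := by positivity
    refine ⟨min (ρ / 2) (ρ / 4 / ((L + 1) * (1 + 1 / ρ))), by positivity, ?_, ?_⟩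
    · push_cast
      exact (min_le_left _ _).trans_lt (half_lt_self hρ')
    · push_cast
      calc ((L : ℝ) + 1) * (min (ρ / 2 : ℝ) (ρ / 4 / ((L + 1) * (1 + 1 / ρ))) * (1 + 1 / ρ))
          = (L + 1) * (1 + 1 / ρ) * min (ρ / 2 : ℝ) (ρ / 4 / ((L + 1) * (1 + 1 / ρ))) := by ring
        _ ≤ (L + 1) * (1 + 1 / ρ) * (ρ / 4 / ((L + 1) * (1 + 1 / ρ))) := by
            gcongr; exact min_le_right _ _
        _ = ρ / 4 := mul_div_cancel₀ _ hb.ne'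
  set C : ℝ≥0 := max 1 (L / ρ) with hCdef
  have hC : 1 ≤ (C : ℝ) := le_max_left (1 : ℝ≥0) _
  have hCL : (L : ℝ) / ρ ≤ C := by
    rw [← NNReal.coe_div]; exact NNReal.coe_le_coe.2 (le_max_right _ _)
  have hd := fun t ht x hx =>
    driftMap_mem_closure (E := K ∩ closure U) (t := t) (x := x) hU ha hg ht hx
  have hhalf := fun t ht x hx => half_le_gauge_driftMap (t := t) (x := x) hU hρ hball hU1 hK.2 hK.1
    hgL hgδ hδ' ha haρ haL ht hx
  have hone := fun x hx => slideMap_one (a := a) (x := x) hU hρ hball hU1 hK.2 hgL hgU hC hCL hx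
  refine ⟨slideMap U (K ∩ closure U) g a C, fun t ht x hx => ?_, fun x hx => ?_,
    continuousOn_slideMap hU hU0 hgL.continuousOn,
    exists_lipschitzOnWith_slideMap hU hρ hball hU1 hg hgL ha hC, fun t ht x hx => ?_,
    fun t ht x hx => ?_, ?_⟩
  · exact (gauge_le_one_iff_mem_closure hU hU0).1 (gauge_slideMap_le_one hU hU0 ha hC hg ht hx)
  · have e : driftMap (K ∩ closure U) g a 0 x = x := by
      rw [driftMap, zero_mul, zero_smul, add_zero]
    rw [slideMap_eq_driftMap, e]
    rw [e]
    exact one_sub_mul_le_gauge hU hU0 hx hC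
  · have h := hhalf t ht x hx
    rw [← gauge_eq_one_iff_mem_frontier hU hU0, slideMap_of_mem_frontier hU hU0
      (hd t ht x hx.1) hx h, gauge_smul_of_nonneg (by positivity), smul_eq_mul,
      inv_mul_cancel₀ (by positivity)]
  · exact norm_slideMap_sub_lt hU hρ hball hU1 hx.2 (hd t ht x hx.2.1) (hhalf t ht x hx.2)
      ((norm_driftMap_sub_le ht ha).trans_lt (hgδ x hx)) hδ
  · exact (image_congr hone).symm

end Slide

end

/-! ### Stability -/

noncomputable section

theorem LipschitzWith.hausdorffEDist_image_le {X Y : Type*} [PseudoEMetricSpace X]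
    [PseudoEMetricSpace Y] {f : X → Y} (hf : LipschitzWith 1 f) (s t : Set X) :
    Metric.hausdorffEDist (f '' s) (f '' t) ≤ Metric.hausdorffEDist s t := by
  have key : ∀ s t : Set X, ∀ x ∈ s,
      Metric.infEDist (f x) (f '' t) ≤ Metric.hausdorffEDist s t := by
    intro s t x hx
    refine le_of_forall_gt fun r hr => ?_
    obtain ⟨y, hy, hxy⟩ := Metric.exists_edist_lt_of_hausdorffEDist_lt hx hr
    refine (Metric.infEDist_le_edist_of_mem (mem_image_of_mem f hy)).trans_lt ?_
    exact (hf x y).trans_lt (by simpa using hxy)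
  refine Metric.hausdorffEDist_le_of_infEDist ?_ ?_
  · rintro _ ⟨x, hx, rfl⟩
    exact key s t x hx
  · rintro _ ⟨x, hx, rfl⟩
    rw [Metric.hausdorffEDist_comm]
    exact key t s x hx

variable {d n : ℕ} (ι : EuclideanSpace ℝ (Fin d) →ₗᵢ[ℝ] EuclideanSpace ℝ (Fin n))
  {K : Set (EuclideanSpace ℝ (Fin d))} {η δ δ' : ℝ} {ρ : ℝ≥0}

/-- The projection of a sliding deformation is again one, with a larger displacement. The cone
stays at distance `η` from the unit sphere, so that the small displacement keeps the moved boundary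
points away from the part of the boundary on the unit sphere; there the projection could move
boundary points into the interior. -/
theorem isSlidingDeformation_proj (hK : IsConeAtZero K) (hη1 : η < 1) (hρ : 0 < ρ)
    (hball : Metric.ball 0 (ρ : ℝ) ⊆ convexDomain K η) (hδη : δ' ≤ η) (hδρ : δ' ≤ ρ / 4)
    (hδ : δ' * (1 + 2 / ρ) ≤ δ) {F : Set (EuclideanSpace ℝ (Fin n))}
    (hF : IsSlidingDeformation (convexDomain (ι '' K) η)
      (ι '' (K ∩ closure (convexDomain K η))) δ' F) :
    IsSlidingDeformation (convexDomain K η) (K ∩ closure (convexDomain K η)) δ (proj ι '' F) := by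
  obtain ⟨φ, hm, -, -, ⟨L, hL⟩, hfr, hdisp, rfl⟩ := hF
  have h1 : (1 : ℝ) ∈ Icc (0 : ℝ) 1 := right_mem_Icc.2 zero_le_one
  have hι : MapsTo ι (closure (convexDomain K η)) (closure (convexDomain (ι '' K) η)) :=
    fun x hx => (map_mem_closure_convexDomain_iff ι).2 hx
  have hdisp' : ∀ x ∈ K ∩ closure (convexDomain K η) ∩ frontier (convexDomain K η),
      ‖φ 1 (ι x) - ι x‖ < δ' := fun x hx =>
    hdisp 1 h1 _ ⟨⟨x, hx.1, rfl⟩, map_mem_frontier_convexDomain ι hx.2⟩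
  have := isSlidingDeformation_image (g := fun x => proj ι (φ 1 (ι x))) (δ := δ) (δ' := δ')
    (convex_convexDomain (K := K) (η := η)) hρ hball closure_convexDomain_subset hK
    (fun x hx => proj_mem_closure_convexDomain ι (hm 1 h1 (hι hx)))
    ((lipschitzWith_proj ι).comp_lipschitzOnWith (hL.comp ι.lipschitz.lipschitzOnWith hι))
    (fun x hx => ?_) (fun x hx => ?_) hδρ hδ
  · rwa [image_image, image_image]
  · refine proj_mem_frontier_convexDomain ι (hfr 1 h1 (map_mem_frontier_convexDomain ι hx.2)) ?_
    have h2 := hdisp' x hx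
    have h3 := norm_le_of_mem_closure_convexDomain hK hη1 hx.1.2 hx.1.1
    have h4 := norm_le_norm_add_norm_sub (ι x) (φ 1 (ι x))
    rw [ι.norm_map] at h4
    rw [norm_sub_rev] at h2
    linarith
  · refine lt_of_le_of_lt ?_ (hdisp' x hx)
    have := norm_proj_le ι (φ 1 (ι x) - ι x)
    rwa [map_sub, proj_apply] at this

/-- Hausdorff limits of sliding deformations project to such limits. -/
theorem proj_mem_slidingLimits (hK : IsConeAtZero K) (hη1 : η < 1) (hρ : 0 < ρ)
    (hball : Metric.ball 0 (ρ : ℝ) ⊆ convexDomain K η) (hδη : δ' ≤ η) (hδρ : δ' ≤ ρ / 4)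
    (hδ : δ' * (1 + 2 / ρ) ≤ δ) {F : Set (EuclideanSpace ℝ (Fin n))}
    (hF : F ∈ slidingLimits (convexDomain (ι '' K) η)
      (ι '' (K ∩ closure (convexDomain K η))) δ') (hfin : μH[2] F < ∞) :
    proj ι '' F ∈ slidingLimits (convexDomain K η) (K ∩ closure (convexDomain K η)) δ := by
  obtain ⟨hc, hsub, -, Fs, hFs, hlim⟩ := hF
  have hcomp : IsCompact F := (isCompact_closedBall 0 1).of_isClosed_subset hc
    (hsub.trans closure_convexDomain_subset)
  refine ⟨(hcomp.image (proj ι).continuous).isClosed, ?_, fun x r _ => ?_,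
    fun j => proj ι '' Fs j,
    fun j => isSlidingDeformation_proj ι hK hη1 hρ hball hδη hδρ hδ (hFs j), ?_⟩
  · rintro _ ⟨z, hz, rfl⟩
    exact proj_mem_closure_convexDomain ι (hsub hz)
  · exact (measure_mono inter_subset_left).trans_lt
      ((hausdorffMeasure_image_proj_le ι F).trans_lt hfin)
  · exact tendsto_of_tendsto_of_tendsto_of_le_of_le tendsto_const_nhds hlim (fun _ => zero_le)
      fun j => (lipschitzWith_proj ι).hausdorffEDist_image_le _ _

theorem IsSlidingStableWith.image (hK : IsConeAtZero K)
    (hfin : ∀ (x : EuclideanSpace ℝ (Fin d)) (r : ℝ), μH[2] (K ∩ Metric.closedBall x r) < ∞)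
    (hη1 : η < 1) (hρ : 0 < ρ) (hball : Metric.ball 0 (ρ : ℝ) ⊆ convexDomain K η) (hδη : δ' ≤ η)
    (hδρ : δ' ≤ ρ / 4) (hδ : δ' * (1 + 2 / ρ) ≤ δ) (h : IsSlidingStableWith K η δ) :
    IsSlidingStableWith (ι '' K) η δ' := by
  rw [IsSlidingStableWith, image_inter_closure_convexDomain]
  set E := K ∩ closure (convexDomain K η) with hE
  have hEfin : μH[2] (ι '' E) < ∞ := by
    rw [hausdorffMeasure_image_isometry]
    exact (measure_mono (inter_subset_inter_right K closure_convexDomain_subset)).trans_lt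
      (hfin 0 1)
  refine ⟨isClosed_image_isometry ι h.1, fun z r _ =>
    (measure_mono inter_subset_left).trans_lt hEfin, fun F hF => ?_⟩
  -- the projection of `F` must have finite measure to be an admissible competitor
  rcases eq_or_ne (μH[2] (F \ ι '' E)) ∞ with htop | htop
  · rw [htop]
    exact le_top
  refine measure_sdiff_le_of_proj ι h.1 (h.2.2 _ ?_)
  refine proj_mem_slidingLimits ι hK hη1 hρ hball hδη hδρ hδ hF ?_
  have : F ⊆ (F \ ι '' E) ∪ ι '' E := by rw [sdiff_union_self]; exact subset_union_left
  exact (measure_mono this).trans_lt ((measure_union_le _ _).trans_lt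
    (ENNReal.add_lt_top.2 ⟨htop.lt_top, hEfin⟩))

theorem IsAlmgrenSlidingStable.image (hmin : IsAlmgrenMinimalCone K)
    (h : IsAlmgrenSlidingStable K) : IsAlmgrenSlidingStable (ι '' K) := by
  obtain ⟨η, δ, hδ, hδη, hη, hst⟩ := h
  obtain ⟨hη1, h0, hη'⟩ := lt_etaOne_image ι hmin.minimal.1
    (hmin.reduced.exists_norm_eq_one hmin.cone) (hδ.trans hδη) hη
  obtain ⟨ρ, hρ, hball⟩ := exists_ball_subset_convexDomain (hδ.trans hδη) hη1 h0
  lift ρ to ℝ≥0 using hρ.le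
  have hb : (0 : ℝ) < 1 + 2 / ρ := by positivity
  have h1 : δ / (1 + 2 / ρ) ≤ δ :=
    div_le_self hδ.le (le_add_of_nonneg_right (by positivity))
  have h2 : min (ρ / 4 : ℝ) (δ / (1 + 2 / ρ)) < η :=
    ((min_le_right _ _).trans h1).trans_lt hδη
  refine ⟨η, min (ρ / 4 : ℝ) (δ / (1 + 2 / ρ)), by positivity, h2, hη',
    hst.image ι hmin.cone (fun x r => hmin.minimal.2.1 x r (subset_univ _)) hη1 hρ hball h2.le
      (min_le_left _ _) ?_⟩
  calc min (ρ / 4 : ℝ) (δ / (1 + 2 / ρ)) * (1 + 2 / ρ) ≤ δ / (1 + 2 / ρ) * (1 + 2 / ρ) := by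
        gcongr; exact min_le_right _ _
    _ = δ := div_mul_cancel₀ _ hb.ne'

theorem infDist_proj_le (hK : K.Nonempty) (z : EuclideanSpace ℝ (Fin n)) :
    Metric.infDist (proj ι z) K ≤ Metric.infDist z (ι '' K) := by
  rw [Metric.le_infDist (hK.image ι)]
  rintro _ ⟨y, hy, rfl⟩
  refine (Metric.infDist_le_dist_of_mem hy).trans ?_
  have := dist_proj_le ι z (ι y)
  rwa [proj_apply] at this

/-- Boundary points close to the cone do not lie on the unit sphere. -/
theorem norm_lt_one_of_mem_boundaryNhd (hK : IsConeAtZero K) (hη1 : η < 1) (hη : 0 < η)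
    (hδη : δ < η) {z : EuclideanSpace ℝ (Fin n)} (hz : z ∈ boundaryNhd (ι '' K) η δ) :
    ‖z‖ < 1 := by
  have hne : (ι '' K).Nonempty := ⟨_, 0, hK.1, rfl⟩
  obtain ⟨_, ⟨y, hy, rfl⟩, hzy⟩ := (Metric.infDist_lt_iff hne).1 (hz.2.trans_lt hδη)
  have h1 := inner_le_mul_norm_of_mem_closure_convexDomain hK
    (proj_mem_closure_convexDomain ι hz.1.1) hy
  rw [inner_proj_left] at h1
  rw [dist_eq_norm] at hzy
  have h2 := norm_sub_sq_real z (ι y)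
  rw [ι.norm_map] at h2
  by_contra! h3
  have h4 : ‖z - ι y‖ ^ 2 < η ^ 2 := by gcongr
  nlinarith [sq_nonneg (‖y‖ - (1 - η))]

theorem image_proj_boundaryNhd (hK : IsConeAtZero K) (hη1 : η < 1) (hη : 0 < η) (hδη : δ < η) :
    proj ι '' boundaryNhd (ι '' K) η δ = boundaryNhd K η δ := by
  apply Subset.antisymm
  · rintro _ ⟨z, hz, rfl⟩
    exact ⟨proj_mem_frontier_convexDomain ι hz.1
      (norm_lt_one_of_mem_boundaryNhd ι hK hη1 hη hδη hz),
      (infDist_proj_le ι ⟨0, hK.1⟩ z).trans hz.2⟩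
  · exact fun x hx => ⟨ι x, ⟨map_mem_frontier_convexDomain ι hx.1,
      (Metric.infDist_image ι.isometry).trans_le hx.2⟩, proj_apply ι x⟩

/-- The projection maps the boundary neighbourhood of `ι '' K` onto that of `K`, so that
competitors relative to these neighbourhoods project to competitors. -/
theorem isTopologicalCompetitorWith_proj {G : Type u} [AddCommGroup G] (hdn : d ≤ n)
    (hKc : IsClosed K) (hK : IsConeAtZero K) (hη1 : η < 1) (hη : 0 < η) (hδ : 0 ≤ δ) (hδη : δ < η)
    {F : Set (EuclideanSpace ℝ (Fin n))} (hF : IsTopologicalCompetitorWith G (ι '' K) η δ F) :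
    IsTopologicalCompetitorWith G K η δ (proj ι '' F) := by
  obtain ⟨hc, hout, hfr, hcomp⟩ := hF
  have hout' : ∀ z ∈ F, z ∉ closure (convexDomain (ι '' K) η) → z ∈ ι '' K :=
    fun z hz hzU => (hout.le ⟨hz, hzU⟩).1
  refine ⟨isClosed_image_proj ι.continuous (proj ι).continuous (proj_apply ι) hc (R := 1) ?_, ?_,
    ?_, ?_⟩
  · intro z hz h1
    obtain ⟨x, -, hx⟩ := hout' z hz fun h => by
      have := closure_convexDomain_subset h
      rw [mem_closedBall_zero_iff] at this
      linarith
    exact ⟨x, hx⟩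
  · ext x
    constructor
    · rintro ⟨⟨z, hz, rfl⟩, hx⟩
      obtain ⟨y, hy, rfl⟩ := hout' z hz fun h => hx (proj_mem_closure_convexDomain ι h)
      rw [proj_apply] at hx ⊢
      exact ⟨hy, hx⟩
    · rintro ⟨hx, hxU⟩
      exact ⟨⟨ι x, (hout.ge ⟨⟨x, hx, rfl⟩,
        fun h => hxU ((map_mem_closure_convexDomain_iff ι).1 h)⟩).1, proj_apply ι x⟩, hxU⟩
  · rintro _ ⟨⟨z, hz, rfl⟩, hx⟩
    refine ⟨hx, ?_⟩
    by_cases hzU : z ∈ closure (convexDomain (ι '' K) η)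
    · exact (infDist_proj_le ι ⟨0, hK.1⟩ z).trans
        (hfr ⟨hz, hzU, notMem_interior_of_proj_mem_frontier ι hx⟩).2
    · obtain ⟨y, hy, rfl⟩ := hout' z hz hzU
      rw [proj_apply, Metric.infDist_zero_of_mem hy]
      exact hδ
  · have := isTopologicalCompetitor_proj hdn ι hKc hcomp
    rwa [image_union, image_proj_boundaryNhd ι hK hη1 hη hδη] at this

theorem IsTopologicallyStableWith.image {G : Type u} [AddCommGroup G] (hdn : d ≤ n)
    (hKc : IsClosed K) (hK : IsConeAtZero K) (hη1 : η < 1) (hη : 0 < η) (hδ : 0 ≤ δ) (hδη : δ < η)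
    (h : IsTopologicallyStableWith G K η δ) : IsTopologicallyStableWith G (ι '' K) η δ := by
  intro F hF
  have hsub : proj ι '' F ∩ closure (convexDomain K η) ⊆
      proj ι '' (F ∩ closure (convexDomain (ι '' K) η)) := by
    rintro _ ⟨⟨z, hz, rfl⟩, hx⟩
    refine ⟨z, ⟨hz, ?_⟩, rfl⟩
    by_contra hzU
    obtain ⟨y, -, rfl⟩ := (hF.2.1.le ⟨hz, hzU⟩).1
    rw [proj_apply] at hx
    exact hzU ((map_mem_closure_convexDomain_iff ι).2 hx)
  rw [image_inter_closure_convexDomain, hausdorffMeasure_image_isometry]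
  calc μH[2] (K ∩ closure (convexDomain K η))
      ≤ μH[2] (proj ι '' F ∩ closure (convexDomain K η)) :=
        h _ (isTopologicalCompetitorWith_proj ι hdn hKc hK hη1 hη hδ hδη hF)
    _ ≤ μH[2] (proj ι '' (F ∩ closure (convexDomain (ι '' K) η))) := measure_mono hsub
    _ ≤ _ := hausdorffMeasure_image_proj_le ι _

theorem IsTopologicallyStable.image {G : Type u} [AddCommGroup G] (hdn : d ≤ n)
    (hmin : IsTopologicalMinimalCone G K) (h : IsTopologicallyStable G K) :
    IsTopologicallyStable G (ι '' K) := by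
  obtain ⟨η, δ, hδ, hδη, hη, hst⟩ := h
  obtain ⟨hη1, -, hη'⟩ := lt_etaOne_image ι hmin.minimal.1
    (hmin.reduced.exists_norm_eq_one hmin.cone) (hδ.trans hδη) hη
  exact ⟨η, δ, hδ, hδη, hη',
    hst.image ι hdn hmin.minimal.1 hmin.cone hη1 (hδ.trans hδη) hδ.le hδη⟩

end

theorem proposition4p2 (d n : ℕ) (hd : 3 ≤ d) (hdn : d ≤ n)
    (ι : EuclideanSpace ℝ (Fin d) →ₗᵢ[ℝ] EuclideanSpace ℝ (Fin n))
    (K : Set (EuclideanSpace ℝ (Fin d))) :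
    (IsAlmgrenMinimalCone K → IsAlmgrenSlidingStable K →
      IsAlmgrenMinimalCone (ι '' K) ∧ IsAlmgrenSlidingStable (ι '' K)) ∧
    (∀ (G : Type u) [AddCommGroup G],
      IsTopologicalMinimalCone G K → IsTopologicallyStable G K →
        IsTopologicalMinimalCone G (ι '' K) ∧ IsTopologicallyStable G (ι '' K)) :=
  ⟨fun h₁ h₂ => ⟨h₁.image ι, h₂.image ι h₁⟩, fun _ _ h₁ h₂ => ⟨h₁.image ι hdn, h₂.image ι hdn h₁⟩⟩
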